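/- Fix integers $N,n\ge 0$. Let $V=(\mathbb C^N)^{\otimes n}$ with basis $v_I=v_{i_1}\otimes\cdots\otimes v_{i_n}$, where $I=(I_1,\dots,I_N)$, $I_a=\{k : i_k=a\}$, runs over the decompositions of $\{1,\dots,n\}$ into $N$ disjoint (possibly empty) subsets, and consider $V$-valued rational functions of $z_1,\dots,z_n,h$, i.e. elements of $V\otimes\mathbb C(z_1,\dots,z_n,h)$. Fix a sign $\pm$ and use the upper or the lower sign everywhere accordingly. For $1\le i<n$ put $$\tilde s_i^{\pm}f(z_1,\dots,z_n,h)=\frac{(z_i-z_{i+1})P^{(i,i+1)}\mp h}{z_i-z_{i+1}\mp h}\,f(z_1,\dots,z_{i+1},z_i,\dots,z_n,h),$$ where $P^{(i,j)}$ permutes the $i$-th and $j$-th tensor factors, and let $s_i=(i,i+1)$ act on decompositions by $s_i(I)_a=s_i(I_a)$. For $\lambda\in\mathbb Z_{\ge0}^N$, $|\lambda|=n$, let $I^{\min}$ (resp. $I^{\max}$) be the decomposition with $|I_a|=\lambda_a$ for which $i_1\le\dots\le i_n$ (resp. $i_1\ge\dots\ge i_n$). Then there is a unique family of $V$-valued rational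 functions $\xi^\pm_I$, indexed by all decompositions $I$, such that $\xi^\pm_{s_i(I)}=\tilde s_i^\pm\xi^\pm_I$ for all $I$ and $1\le i<n$, and, for all $\lambda$, $\xi^+_{I^{\min}}=v_{I^{\min}}$ (sign $+$), resp. $\xi^-_{I^{\max}}=v_{I^{\max}}$ (sign $-$). Let $Y(\mathfrak{gl}_N)$ be the Yangian: the unital associative $\mathbb C$-algebra with generators $T^{(s)}_{i,j}$, $1\le i,j\le N$, $s\ge1$, and relations $$(u-v)[T_{i,j}(u),T_{k,l}(v)]=T_{k,j}(v)T_{i,l}(u)-T_{k,j}(u)T_{i,l}(v),\qquad T_{i,j}(u)=\delta_{i,j}+\sum_{s\ge1}T^{(s)}_{i,j}u^{-s}.$$ For $\mathbf i=\{i_1<\dots<i_p\}$ and $\mathbf j=\{j_1<\dots<j_p\}$ let $M_{\mathbf i,\mathbf j}(u)=\sum_{\sigma\in S_p}(-1)^\sigma\,T_{i_1,j_{\sigma(1)}}(u)\cdots T_{i_p,j_{\sigma(p)}}(u-p+1)$. With $\mathbf i=\{1,\dots,p\}$, $\mathbf j=\{1,\dots,p-1,p+1\}$ put $$A_p(u)=M_{\mathbf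 i,\mathbf i}(u/h)\ \ (1\le p\le N),$$ $$E_p(u)=h^{-1}M_{\mathbf j,\mathbf i}(u/h)\,M_{\mathbf i,\mathbf i}(u/h)^{-1},\quad F_p(u)=h^{-1}M_{\mathbf i,\mathbf i}(u/h)^{-1}M_{\mathbf i,\mathbf j}(u/h)\ \ (1\le p<N),$$ which are series in $u^{-1}$ with coefficients in $Y(\mathfrak{gl}_N)\otimes\mathbb C[h]$. Let $\phi^\pm$ be the action on $V$-valued rational functions of $z_1,\dots,z_n,h$ in which $h$ acts by multiplication and $T_{i,j}(u/h)$ acts by the expansion in $u^{-1}$ of $L^\pm_{i,j}(u)\prod_{a=1}^n(u-z_a)^{-1}$, where, labelling the factors of $\mathbb C^N\otimes V$ by $0,1,\dots,n$, $$L^+(u)=(u-z_n+hP^{(0,n)})\cdots(u-z_1+hP^{(0,1)}),\qquad L^-(u)=(u-z_1+hP^{(0,1)})\cdots(u-z_n+hP^{(0,n)}),$$ and $L^\pm(u)=\sum_{i,j}E_{i,j}\otimes L^\pm_{i,j}(u)$, with $E_{i,j}$ the matrix units of the $0$-th factor. Put $A^\pm_p(u)=\phi^\pm(A_p(u))$,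 $E^\pm_p(u)=\phi^\pm(E_p(u))$, $F^\pm_p(u)=\phi^\pm(F_p(u))$. Then for every decomposition $I$, as identities of series in $u^{-1}$, $$A_p^\pm(u)\,\xi_I^\pm=\xi_I^\pm\prod_{a=1}^p\prod_{i\in I_a}\Bigl(1+\frac h{u-z_i}\Bigr)\qquad(1\le p\le N),$$ $$E_p^\pm(u)\,\xi_I^\pm=\sum_{i\in I_{p+1}}\frac{\xi^\pm_{I^{i\prime}}}{u-z_i}\prod_{k\in I_{p+1},\,k\ne i}\frac{z_i-z_k+h}{z_i-z_k}\qquad(1\le p<N),$$ $$F_p^\pm(u)\,\xi_I^\pm=\sum_{j\in I_p}\frac{\xi^\pm_{I^{\prime j}}}{u-z_j}\prod_{k\in I_p,\,k\ne j}\frac{z_j-z_k-h}{z_j-z_k}\qquad(1\le p<N),$$ where $I^{i\prime}$ is obtained from $I$ by moving $i$ from $I_{p+1}$ to $I_p$, and $I^{\prime j}$ is obtained from $I$ by moving $j$ from $I_p$ to $I_{p+1}$. -/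

import Mathlib

open scoped PowerSeries

noncomputable section

namespace YangianXi

/-! ### Rational functions, `V`-valued functions -/

/-- The field `ℂ(z₁, …, zₙ, h)`; the variable `h` is indexed by `none`, `z_i` by `some i`. -/
abbrev RatFn (n : ℕ) : Type := FractionRing (MvPolynomial (Option (Fin n)) ℂ)

/-- The variable `z_i`. -/
def z {n : ℕ} (i : Fin n) : RatFn n :=
  algebraMap (MvPolynomial (Option (Fin n)) ℂ) (RatFn n) (MvPolynomial.X (some i))

/-- The variable `h`. -/
def h {n : ℕ} : RatFn n :=
  algebraMap (MvPolynomial (Option (Fin n)) ℂ) (RatFn n) (MvPolynomial.X none)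

/-- The substitution exchanging the variables `z_i` and `z_j` in a rational function. -/
def swapVars {n : ℕ} (i j : Fin n) : RatFn n ≃+* RatFn n :=
  IsFractionRing.ringEquivOfRingEquiv
    (MvPolynomial.renameEquiv ℂ (Equiv.optionCongr (Equiv.swap i j))).toRingEquiv

/-- A word `w : Fin n → Fin N` stands for the basis vector `v_I = v_{w 1} ⊗ ⋯ ⊗ v_{w n}` of
`V = (ℂ^N)^{⊗ n}` and for the decomposition `I = (I_1, …, I_N)` of `{1, …, n}` with
`I_a = {k | w k = a}`. -/
abbrev Word (N n : ℕ) : Type := Fin n → Fin N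

/-- `V ⊗ ℂ(z, h)`: the `V`-valued rational functions of `z₁, …, zₙ, h`, in coordinates with
respect to the basis `v_I`. -/
abbrev VFun (N n : ℕ) : Type := Word N n → RatFn n

/-- The basis vector `v_I`. -/
def basisVec {N n : ℕ} (I : Word N n) : VFun N n := Pi.single I 1

/-- The choice of sign in `±`. -/
inductive PM : Type
  | plus
  | minus

/-- The sign as a number. -/
def PM.sgn {n : ℕ} : PM → RatFn n
  | .plus => 1
  | .minus => -1

/-- The operator `s̃_i^±`:
`f ↦ ((z_i - z_{i+1}) P^{(i,i+1)} ∓ h) / (z_i - z_{i+1} ∓ h) · f(…, z_{i+1}, z_i, …)`. -/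
def sTilde {N n : ℕ} (ε : PM) (i : ℕ) (hi : i + 1 < n) (f : VFun N n) : VFun N n :=
  let a : Fin n := ⟨i, Nat.lt_of_succ_lt hi⟩
  let b : Fin n := ⟨i + 1, hi⟩
  fun w =>
    ((z a - z b) * swapVars a b (f (w ∘ Equiv.swap a b)) - ε.sgn * h * swapVars a b (f w)) /
      (z a - z b - ε.sgn * h)

/-- The decomposition `I` is `I^min` (for `+`), i.e. its word is weakly increasing, or `I^max`
(for `-`), i.e. its word is weakly decreasing. -/
def IsExtremal {N n : ℕ} (ε : PM) (I : Word N n) : Prop :=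
  match ε with
  | .plus => Monotone I
  | .minus => Antitone I

/-- The defining properties of the vectors `ξ^±_I`: `ξ^+_{I^min} = v_{I^min}`, respectively
`ξ^-_{I^max} = v_{I^max}`, for all weights `λ`, and `ξ^±_{s_i(I)} = s̃_i^± ξ^±_I` for all `I`
and all simple transpositions `s_i`. -/
structure IsXi {N n : ℕ} (ε : PM) (ξ : Word N n → VFun N n) : Prop where
  extremal : ∀ I, IsExtremal ε I → ξ I = basisVec I
  swap : ∀ (i : ℕ) (hi : i + 1 < n) (I : Word N n),
    ξ (I ∘ Equiv.swap (⟨i, Nat.lt_of_succ_lt hi⟩ : Fin n) ⟨i + 1, hi⟩) = sTilde ε i hi (ξ I)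

/-! ### The Yangian `Y(gl_N)` -/

/-- The element `T_{i,j}^{(s)}` of the free algebra on the symbols `T_{i,j}^{(s)}`, `s ≥ 1`
(the symbol `(i, j, s)` is `T_{i,j}^{(s+1)}`), with the convention `T_{i,j}^{(0)} = δ_{i,j}`. -/
def freeT (N : ℕ) (i j : Fin N) : ℕ → FreeAlgebra ℂ (Fin N × Fin N × ℕ)
  | 0 => if i = j then 1 else 0
  | s + 1 => FreeAlgebra.ι ℂ (i, j, s)

/-- The coefficients at `u^{-r} v^{-s}` of the defining relations
`(u-v) [T_{i,j}(u), T_{k,l}(v)] = T_{k,j}(v) T_{i,l}(u) - T_{k,j}(u) T_{i,l}(v)`. -/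
inductive YangianRel (N : ℕ) :
    FreeAlgebra ℂ (Fin N × Fin N × ℕ) → FreeAlgebra ℂ (Fin N × Fin N × ℕ) → Prop
  | rel (i j k l : Fin N) (r s : ℕ) : YangianRel N
      ((freeT N i j (r + 1) * freeT N k l s - freeT N k l s * freeT N i j (r + 1)) -
        (freeT N i j r * freeT N k l (s + 1) - freeT N k l (s + 1) * freeT N i j r))
      (freeT N k j s * freeT N i l r - freeT N k j r * freeT N i l s)

/-- The Yangian `Y(gl_N)`. -/
abbrev Yangian (N : ℕ) : Type := RingQuot (YangianRel N)

/-- The series `T_{i,j}(u) = δ_{i,j} + ∑_{s ≥ 1} T_{i,j}^{(s)} u^{-s}`. Here and below the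
variable of a power series is `u^{-1}`. -/
def Tser (N : ℕ) (i j : Fin N) : (Yangian N)⟦X⟧ :=
  PowerSeries.mk fun s => RingQuot.mkAlgHom ℂ (YangianRel N) (freeT N i j s)

/-- The series `f(u - k)` in `u^{-1}`, from
`(u-k)^{-s} = ∑_{r ≥ s} (r-1 choose r-s) k^{r-s} u^{-r}`. -/
def shift {A : Type} [Ring A] (k : ℕ) (f : A⟦X⟧) : A⟦X⟧ :=
  PowerSeries.mk fun r =>
    ∑ s ∈ Finset.range (r + 1), ((r - 1).choose (r - s) * k ^ (r - s)) • PowerSeries.coeff s f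

/-- The quantum minor
`M_{i,j}(u) = ∑_σ (-1)^σ T_{i_1,j_{σ(1)}}(u) ⋯ T_{i_p,j_{σ(p)}}(u-p+1)`. -/
def qminor (N : ℕ) {p : ℕ} (ib jb : Fin p → Fin N) : (Yangian N)⟦X⟧ :=
  ∑ σ : Equiv.Perm (Fin p),
    (Equiv.Perm.sign σ : ℤ) •
      (List.ofFn fun k : Fin p => shift (k : ℕ) (Tser N (ib k) (jb (σ k)))).prod

/-- The sequence `{1, …, p}`. -/
def idxI {N p : ℕ} (hp : p ≤ N) : Fin p → Fin N := Fin.castLE hp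

/-- The sequence `{1, …, p-1, p+1}` (with indices counted from `0`). -/
def idxJ {N p : ℕ} (hp : p < N) : Fin p → Fin N := fun k =>
  if (k : ℕ) + 1 < p then ⟨k, lt_trans k.2 hp⟩ else ⟨p, hp⟩

/-- `Y(gl_N) ⊗ ℂ[h]`. -/
abbrev YangianH (N : ℕ) : Type := Polynomial (Yangian N)

/-- The series `f(u/h)` with coefficients in `Y(gl_N) ⊗ ℂ[h]`. -/
def divH {N : ℕ} (f : (Yangian N)⟦X⟧) : (YangianH N)⟦X⟧ :=
  PowerSeries.mk fun s => Polynomial.monomial s (PowerSeries.coeff s f)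

/-- For a series `f(u) = ∑_{s ≥ 1} f_s u^{-s}` without constant term, the series
`h^{-1} f(u/h) = ∑_{s ≥ 1} h^{s-1} f_s u^{-s}`. -/
def hInvDivH {N : ℕ} (f : (Yangian N)⟦X⟧) : (YangianH N)⟦X⟧ :=
  PowerSeries.mk fun s =>
    if s = 0 then 0 else Polynomial.monomial (s - 1) (PowerSeries.coeff s f)

/-- The inverse of a series with constant term `1`. -/
def serInv {A : Type} [Ring A] (f : A⟦X⟧) : A⟦X⟧ := PowerSeries.invOfUnit f 1

/-- `A_p(u) = M_{i,i}(u/h)`, `i = {1, …, p}`. -/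
def serA (N : ℕ) {p : ℕ} (hp : p ≤ N) : (YangianH N)⟦X⟧ :=
  divH (qminor N (idxI hp) (idxI hp))

/-- `E_p(u) = h^{-1} M_{j,i}(u/h) (M_{i,i}(u/h))^{-1}`, `i = {1, …, p}`,
`j = {1, …, p-1, p+1}`. -/
def serE (N : ℕ) {p : ℕ} (hp : p < N) : (YangianH N)⟦X⟧ :=
  hInvDivH (qminor N (idxJ hp) (idxI hp.le) * serInv (qminor N (idxI hp.le) (idxI hp.le)))

/-- `F_p(u) = h^{-1} (M_{i,i}(u/h))^{-1} M_{i,j}(u/h)`, `i = {1, …, p}`,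
`j = {1, …, p-1, p+1}`. -/
def serF (N : ℕ) {p : ℕ} (hp : p < N) : (YangianH N)⟦X⟧ :=
  hInvDivH (serInv (qminor N (idxI hp.le) (idxI hp.le)) * qminor N (idxI hp.le) (idxJ hp))

/-! ### The actions `φ^±` -/

/-- `End(V) ⊗ ℂ(z, h)`. -/
abbrev EndV (N n : ℕ) : Type := Module.End (RatFn n) (VFun N n)

/-- The operator `e_{i,j}` on the `a`-th tensor factor of `V`, where `e_{i,j} v_k = δ_{j,k} v_i`. -/
def eSite {N n : ℕ} (a : Fin n) (i j : Fin N) : EndV N n where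
  toFun f w := if w a = i then f (Function.update w a j) else 0
  map_add' f g := by
    funext w
    by_cases hw : w a = i <;> simp [hw]
  map_smul' c f := by
    funext w
    by_cases hw : w a = i <;> simp [hw]

/-- The expansion `(u - c)^{-1} = ∑_{s ≥ 1} c^{s-1} u^{-s}`. -/
def invSub {K : Type} [Field K] (c : K) : K⟦X⟧ :=
  PowerSeries.mk fun s => if s = 0 then 0 else c ^ (s - 1)

/-- The `N × N` matrix of the operator `(u - z_a + h P^{(0,a)}) (u - z_a)^{-1}` on
`ℂ^N ⊗ V`; here `P^{(0,a)} = ∑_{i,j} E_{i,j} ⊗ e_{j,i}^{(a)}`. -/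
def siteMat (N : ℕ) {n : ℕ} (a : Fin n) : Matrix (Fin N) (Fin N) (EndV N n)⟦X⟧ :=
  Matrix.of fun i j =>
    (if i = j then 1 else 0) +
      PowerSeries.map (algebraMap (RatFn n) (EndV N n)) (PowerSeries.C h * invSub (z a)) *
        PowerSeries.C (eSite a j i)

/-- The order of the factors of `L^±(u)`: `n, …, 1` for `+` and `1, …, n` for `-`. -/
def siteOrder (n : ℕ) : PM → List (Fin n)
  | .plus => (List.finRange n).reverse
  | .minus => List.finRange n

/-- The `N × N` matrix with the entries `L^±_{i,j}(u) ∏_a (u - z_a)^{-1}`, expanded in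
`u^{-1}`. -/
def normL (N n : ℕ) (ε : PM) : Matrix (Fin N) (Fin N) (EndV N n)⟦X⟧ :=
  ((siteOrder n ε).map (siteMat N)).prod

/-! The proof that the entries of `normL` satisfy the Yangian relations. -/

section RTT

variable {B : Type} [Ring B]

theorem commute_of_coeff {A : Type} [Ring A] (f g : A⟦X⟧)
    (H : ∀ r s, Commute (PowerSeries.coeff r f) (PowerSeries.coeff s g)) : Commute f g := by
  ext n
  rw [PowerSeries.coeff_mul, PowerSeries.coeff_mul, ← Finset.Nat.sum_antidiagonal_swap]
  exact Finset.sum_congr rfl fun x _ => (H _ _).eq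

def IsRTT {N : ℕ} (d e : B) (T S : Matrix (Fin N) (Fin N) B) : Prop :=
  ∀ i j k l, d * (T i j * S k l - S k l * T i j) = e * (S k j * T i l - T k j * S i l)

theorem IsRTT.mul {N : ℕ} {d e : B} (hd : ∀ b, Commute d b) (he : ∀ b, Commute e b)
    {T S T' S' : Matrix (Fin N) (Fin N) B} (h1 : IsRTT d e T S) (h2 : IsRTT d e T' S')
    (c1 : ∀ i j k l, Commute (T i j) (S' k l)) (c2 : ∀ i j k l, Commute (T' i j) (S k l)) :
    IsRTT d e (T * T') (S * S') := by
  intro i j k l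
  have key : ∀ a b, d * ((T i a * T' a j) * (S k b * S' b l) - (S k b * S' b l) * (T i a * T' a j))
      = e * ((S k a * T i b) * (T' a j * S' b l)) - e * ((T k a * T' a j) * (S i b * S' b l))
        + (e * ((S k b * S' b j) * (T i a * T' a l)) -
          e * ((S k b * T i a) * (T' b j * S' a l))) := by
    intro a b
    have e1 : (T i a * T' a j) * (S k b * S' b l) = (T i a * S k b) * (T' a j * S' b l) := by
      rw [mul_assoc, ← mul_assoc (T' a j), (c2 a j k b).eq]; simp only [mul_assoc]
    have e2 : (S k b * S' b l) * (T i a * T' a j) = (S k b * T i a) * (S' b l * T' a j) := by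
      rw [mul_assoc, ← mul_assoc (S' b l), ← (c1 i a b l).eq]; simp only [mul_assoc]
    have e3 : (T k a * T' a j) * (S i b * S' b l) = (T k a * S i b) * (T' a j * S' b l) := by
      rw [mul_assoc, ← mul_assoc (T' a j), (c2 a j i b).eq]; simp only [mul_assoc]
    have e4 : (S k b * S' b j) * (T i a * T' a l) = (S k b * T i a) * (S' b j * T' a l) := by
      rw [mul_assoc, ← mul_assoc (S' b j), ← (c1 i a b j).eq]; simp only [mul_assoc]
    rw [e1, e2, e3, e4]
    have s1 : d * ((T i a * S k b) * (T' a j * S' b l) - (S k b * T i a) * (S' b l * T' a j))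
        = (d * (T i a * S k b - S k b * T i a)) * (T' a j * S' b l)
          + (S k b * T i a) * (d * (T' a j * S' b l - S' b l * T' a j)) := by
      rw [← mul_assoc (S k b * T i a) d, ← (hd (S k b * T i a)).eq]
      noncomm_ring
    rw [s1, h1 i a k b, h2 a j b l, ← mul_assoc (S k b * T i a) e, ← (he (S k b * T i a)).eq]
    noncomm_ring
  simp only [Matrix.mul_apply, Finset.sum_mul_sum]
  have sw : ∑ b, ∑ a, (S k b * S' b l) * (T i a * T' a j)
      = ∑ a, ∑ b, (S k b * S' b l) * (T i a * T' a j) := Finset.sum_comm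
  have sw2 : ∑ b, ∑ a, (S k b * S' b j) * (T i a * T' a l)
      = ∑ a, ∑ b, (S k b * S' b j) * (T i a * T' a l) := Finset.sum_comm
  have sw3 : ∑ a, ∑ b, e * ((S k a * T i b) * (T' a j * S' b l))
      = ∑ a, ∑ b, e * ((S k b * T i a) * (T' b j * S' a l)) := Finset.sum_comm
  rw [sw, sw2, ← Finset.sum_sub_distrib, Finset.mul_sum]
  simp only [← Finset.sum_sub_distrib, Finset.mul_sum, key]
  simp only [Finset.sum_add_distrib, Finset.sum_sub_distrib, sw3, mul_sub]
  abel

theorem isRTT_base {N : ℕ} {d e g g' : B} {E : Fin N → Fin N → B}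
    {T S : Matrix (Fin N) (Fin N) B} (hg : ∀ b, Commute g b) (hg' : ∀ b, Commute g' b)
    (hid : d * (g * g') = e * (g' - g))
    (hE : ∀ i j k l, E i j * E k l = if j = k then E i l else 0)
    (hT : ∀ i j, T i j = (if i = j then 1 else 0) + g * E j i)
    (hS : ∀ i j, S i j = (if i = j then 1 else 0) + g' * E j i) : IsRTT d e T S := by
  intro i j k l
  have p1 : ∀ x y, (g * x) * (g' * y) = (g * g') * (x * y) := by
    intro x y; rw [mul_assoc, ← mul_assoc x, ← (hg' x).eq]; simp only [mul_assoc]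
  have p2 : ∀ x y, (g' * x) * (g * y) = (g * g') * (x * y) := by
    intro x y; rw [mul_assoc, ← mul_assoc x, ← (hg x).eq, (hg g').eq]; simp only [mul_assoc]
  have L : T i j * S k l - S k l * T i j
      = (g * g') * ((if i = l then E j k else 0) - (if k = j then E l i else 0)) := by
    have h1 : (if i = l then E j k else 0) = E j i * E l k := (hE _ _ _ _).symm
    have h2 : (if k = j then E l i else 0) = E l k * E j i := (hE _ _ _ _).symm
    rw [mul_sub, h1, h2, ← p1, ← p2, hT, hS]
    split_ifs <;> noncomm_ring
  have R : S k j * T i l - T k j * S i l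
      = (g' - g) * ((if i = l then E j k else 0) - (if k = j then E l i else 0)) := by
    rw [hT, hS, hT, hS]
    simp only [add_mul, mul_add, p1, p2]
    split_ifs <;> noncomm_ring
  rw [L, R, ← mul_assoc, hid, mul_assoc]

end RTT

section Action

variable {N n : ℕ}

theorem eSite_mul (a : Fin n) (i j k l : Fin N) :
    (eSite a i j * eSite a k l : EndV N n) = if j = k then eSite a i l else 0 := by
  ext1 f
  split_ifs with hjk <;> (ext w; by_cases hw : w a = i <;> simp_all [eSite])

theorem eSite_commute {a b : Fin n} (hab : a ≠ b) (i j k l : Fin N) :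
    Commute (eSite a i j : EndV N n) (eSite b k l) := by
  change (eSite a i j * eSite b k l : EndV N n) = eSite b k l * eSite a i j
  refine LinearMap.ext fun f => funext fun w => ?_
  change (if w a = i then (if Function.update w a j b = k then _ else _) else _)
    = (if w b = k then (if Function.update w b l a = i then _ else _) else _)
  rw [Function.update_of_ne hab.symm, Function.update_of_ne hab, Function.update_comm hab]
  split_ifs <;> rfl

theorem invSub_spec {K : Type} [Field K] (c : K) :
    invSub c = PowerSeries.X + PowerSeries.C c * PowerSeries.X * invSub c := by
  ext s
  rw [mul_assoc]
  rcases s with _ | _ | s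
  · simp [invSub]
  · simp [invSub, PowerSeries.coeff_succ_X_mul]
  · simp [invSub, PowerSeries.coeff_succ_X_mul, PowerSeries.coeff_X, pow_succ']

/-- Coefficients embedded by `algebraMap` are central. -/
theorem map_central (g : (RatFn n)⟦X⟧) (f : (EndV N n)⟦X⟧) :
    Commute (PowerSeries.map (algebraMap (RatFn n) (EndV N n)) g) f :=
  commute_of_coeff _ _ fun r s => by
    rw [PowerSeries.coeff_map]
    exact Algebra.commutes _ _

theorem siteMat_coeff_commute {a b : Fin n} (hab : a ≠ b) (i j k l : Fin N) (r s : ℕ) :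
    Commute (PowerSeries.coeff r (siteMat N a i j)) (PowerSeries.coeff s (siteMat N b k l)) := by
  simp only [siteMat, Matrix.of_apply, map_add, PowerSeries.coeff_mul_C, PowerSeries.coeff_map]
  have hone : ∀ (q : ℕ) (p : Prop) [Decidable p] (x : EndV N n),
      Commute (PowerSeries.coeff q (if p then (1 : (EndV N n)⟦X⟧) else 0)) x := by
    intro q p _ x
    split_ifs
    · rw [PowerSeries.coeff_one]
      split_ifs
      · exact Commute.one_left x
      · exact Commute.zero_left x
    · rw [map_zero]; exact Commute.zero_left x
  refine Commute.add_left (hone _ _ _) (Commute.add_right (hone _ _ _).symm ?_)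
  refine Commute.mul_left (Algebra.commutes _ _) (Commute.mul_right ?_ (eSite_commute hab _ _ _ _))
  exact (Algebra.commutes _ _).symm

theorem prod_coeff_commute (l : List (Fin n)) (b : Fin n) (hb : b ∉ l) (i j k m : Fin N)
    (r s : ℕ) :
    Commute (PowerSeries.coeff r ((l.map (siteMat N)).prod i j))
      (PowerSeries.coeff s (siteMat N b k m)) := by
  induction l generalizing i j r with
  | nil =>
    rw [List.map_nil, List.prod_nil, Matrix.one_apply]
    split_ifs
    · rw [PowerSeries.coeff_one]
      split_ifs
      · exact Commute.one_left _
      · exact Commute.zero_left _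
    · rw [map_zero]; exact Commute.zero_left _
  | cons a l ih =>
    rw [List.mem_cons, not_or] at hb
    rw [List.map_cons, List.prod_cons, Matrix.mul_apply, map_sum]
    refine Commute.sum_left _ _ _ fun c _ => ?_
    rw [PowerSeries.coeff_mul]
    refine Commute.sum_left _ _ _ fun x _ => ?_
    exact Commute.mul_left (siteMat_coeff_commute (Ne.symm hb.1) _ _ _ _ _ _) (ih hb.2 _ _ _)

/-- A series in the first of two variables. -/
def inX {A : Type} [Ring A] : A⟦X⟧ →+* A⟦X⟧⟦X⟧ := PowerSeries.C

/-- A series in the second of two variables. -/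
def inY {A : Type} [Ring A] : A⟦X⟧ →+* A⟦X⟧⟦X⟧ := PowerSeries.map PowerSeries.C

theorem commute_inX_inY {A : Type} [Ring A] (f g : A⟦X⟧)
    (H : ∀ r s, Commute (PowerSeries.coeff r f) (PowerSeries.coeff s g)) :
    Commute (inX f) (inY g) := by
  refine commute_of_coeff _ _ fun r s => ?_
  simp only [inX, inY, PowerSeries.coeff_C, PowerSeries.coeff_map]
  split_ifs
  · refine commute_of_coeff _ _ fun r' s' => ?_
    simp only [PowerSeries.coeff_C]
    split_ifs
    · exact H _ _
    · exact Commute.zero_right _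
  · exact Commute.zero_left _

/-- Scalar two-variable series as operator-valued ones. -/
def scal (N n : ℕ) : (RatFn n)⟦X⟧⟦X⟧ →+* (EndV N n)⟦X⟧⟦X⟧ :=
  PowerSeries.map (PowerSeries.map (algebraMap (RatFn n) (EndV N n)))

theorem scal_central (g : (RatFn n)⟦X⟧⟦X⟧) (f : (EndV N n)⟦X⟧⟦X⟧) :
    Commute (scal N n g) f :=
  commute_of_coeff _ _ fun r s => by
    rw [scal, PowerSeries.coeff_map]
    exact map_central _ _

theorem inX_map (g : (RatFn n)⟦X⟧) :
    inX (PowerSeries.map (algebraMap (RatFn n) (EndV N n)) g) = scal N n (inX g) := by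
  simp [inX, scal]

theorem inY_map (g : (RatFn n)⟦X⟧) :
    inY (PowerSeries.map (algebraMap (RatFn n) (EndV N n)) g) = scal N n (inY g) := by
  ext r s
  simp [inY, scal, PowerSeries.coeff_C]

/-- The two-variable form of `(u - v)` times `u⁻¹ v⁻¹`. -/
def dd (n : ℕ) : (RatFn n)⟦X⟧⟦X⟧ := inY PowerSeries.X - inX PowerSeries.X

/-- The two-variable form of `h u⁻¹ v⁻¹`. -/
def ee (n : ℕ) : (RatFn n)⟦X⟧⟦X⟧ :=
  inX (PowerSeries.C h) * inX PowerSeries.X * inY PowerSeries.X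

theorem scalar_identity (a : Fin n) :
    dd n * (inX (PowerSeries.C h * invSub (z a)) * inY (PowerSeries.C h * invSub (z a)))
      = ee n * (inY (PowerSeries.C h * invSub (z a)) - inX (PowerSeries.C h * invSub (z a))) := by
  have hx := congrArg inX (invSub_spec (z a))
  have hy := congrArg inY (invSub_spec (z a))
  have hC : ∀ c : RatFn n, inY (PowerSeries.C c) = inX (PowerSeries.C c) := by
    intro c; simp [inX, inY]
  simp only [map_mul, map_add, hC] at hx hy ⊢
  rw [dd, ee]
  generalize inX (invSub (z a)) = p at *
  generalize inY (invSub (z a)) = q at *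
  linear_combination (inX (PowerSeries.C h)) ^ 2 *
    (inY PowerSeries.X * q * hx - inX PowerSeries.X * p * hy)

theorem siteMat_rtt (a : Fin n) :
    IsRTT (scal N n (dd n)) (scal N n (ee n)) ((siteMat N a).map inX) ((siteMat N a).map inY) := by
  refine isRTT_base (g := scal N n (inX (PowerSeries.C h * invSub (z a))))
    (g' := scal N n (inY (PowerSeries.C h * invSub (z a))))
    (E := fun i j => PowerSeries.C (PowerSeries.C (eSite a i j)))
    (scal_central _) (scal_central _) ?_ ?_ ?_ ?_
  · have hid := congrArg (scal N n) (scalar_identity a)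
    rwa [map_mul (scal N n), map_mul (scal N n), map_mul (scal N n), map_sub (scal N n)] at hid
  · intro i j k l
    simp only [← map_mul, eSite_mul]
    split_ifs <;> simp
  · intro i j
    rw [Matrix.map_apply, siteMat, Matrix.of_apply, map_add, map_mul inX, inX_map]
    congr 1
    split_ifs <;> simp
  · intro i j
    rw [Matrix.map_apply, siteMat, Matrix.of_apply, map_add, map_mul inY, inY_map]
    congr 1
    · split_ifs <;> simp
    · simp [inY]

theorem prod_rtt (l : List (Fin n)) (hl : l.Nodup) :
    IsRTT (scal N n (dd n)) (scal N n (ee n))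
      (((l.map (siteMat N)).prod).map inX) (((l.map (siteMat N)).prod).map inY) := by
  induction l with
  | nil =>
    intro i j k l
    simp only [List.map_nil, List.prod_nil, Matrix.map_apply, Matrix.one_apply]
    split_ifs <;> simp
  | cons a l ih =>
    rw [List.nodup_cons] at hl
    rw [List.map_cons, List.prod_cons, Matrix.map_mul, Matrix.map_mul]
    refine IsRTT.mul (scal_central _) (scal_central _) (siteMat_rtt a) (ih hl.2) ?_ ?_
    · intro i j k m
      exact commute_inX_inY _ _ fun r s => (prod_coeff_commute l a hl.1 _ _ _ _ _ _).symm
    · intro i j k m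
      exact commute_inX_inY _ _ fun r s => prod_coeff_commute l a hl.1 _ _ _ _ _ _

theorem coeff_inX_inY {A : Type} [Ring A] (f g : A⟦X⟧) (r s : ℕ) :
    PowerSeries.coeff r (PowerSeries.coeff s (inX f * inY g))
      = PowerSeries.coeff r f * PowerSeries.coeff s g := by
  simp [inX, inY, PowerSeries.coeff_C_mul, PowerSeries.coeff_mul_C]

theorem coeff_inY_inX {A : Type} [Ring A] (f g : A⟦X⟧) (r s : ℕ) :
    PowerSeries.coeff r (PowerSeries.coeff s (inY g * inX f))
      = PowerSeries.coeff s g * PowerSeries.coeff r f := by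
  simp [inX, inY, PowerSeries.coeff_C_mul, PowerSeries.coeff_mul_C]

theorem siteOrder_nodup (ε : PM) : (siteOrder n ε).Nodup := by
  cases ε
  · exact List.nodup_reverse.2 (List.nodup_finRange n)
  · exact List.nodup_finRange n

/-- The Yangian relations, with the parameter `h`, for the coefficients of `normL`. -/
theorem normL_rel (ε : PM) (i j k l : Fin N) (r s : ℕ) :
    let c : Fin N → Fin N → ℕ → EndV N n := fun i j s => PowerSeries.coeff s (normL N n ε i j)
    (c i j (r + 1) * c k l s - c k l s * c i j (r + 1)) -
        (c i j r * c k l (s + 1) - c k l (s + 1) * c i j r)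
      = (h : RatFn n) • (c k j s * c i l r - c k j r * c i l s) := by
  intro c
  have H := prod_rtt (N := N) (siteOrder n ε) (siteOrder_nodup ε) i j k l
  change scal N n (dd n) * (inX (normL N n ε i j) * inY (normL N n ε k l) -
    inY (normL N n ε k l) * inX (normL N n ε i j)) = scal N n (ee n) *
    (inY (normL N n ε k j) * inX (normL N n ε i l) -
      inX (normL N n ε k j) * inY (normL N n ε i l)) at H
  have hd : scal N n (dd n) = PowerSeries.X - PowerSeries.C PowerSeries.X := by
    simp [scal, dd, inX, inY]
  have he : scal N n (ee n) = PowerSeries.C (PowerSeries.C (algebraMap (RatFn n) (EndV N n) h)) *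
      (PowerSeries.C PowerSeries.X * PowerSeries.X) := by
    simp [scal, ee, inX, inY, mul_assoc]
  rw [hd, he] at H
  have H2 := congrArg (fun F => PowerSeries.coeff (r + 1) (PowerSeries.coeff (s + 1) F)) H
  simp only [sub_mul, mul_sub, map_sub, mul_assoc, PowerSeries.coeff_succ_X_mul,
    PowerSeries.coeff_C_mul, coeff_inX_inY, coeff_inY_inX] at H2
  rw [smul_sub, Algebra.smul_def, Algebra.smul_def, sub_sub_sub_comm]
  exact H2

theorem normL_coeff_zero (ε : PM) (i j : Fin N) :
    PowerSeries.coeff 0 (normL N n ε i j) = if i = j then 1 else 0 := by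
  unfold normL
  induction siteOrder n ε generalizing i j with
  | nil =>
    rw [List.map_nil, List.prod_nil, Matrix.one_apply]
    split_ifs <;> simp
  | cons a l ih =>
    rw [List.map_cons, List.prod_cons, Matrix.mul_apply, map_sum]
    have key : ∀ c, PowerSeries.constantCoeff (siteMat N a i c)
        = if i = c then (1 : EndV N n) else 0 := by
      intro c
      rw [← PowerSeries.coeff_zero_eq_constantCoeff_apply]
      simp only [siteMat, Matrix.of_apply, map_add, PowerSeries.coeff_mul_C, PowerSeries.coeff_map]
      split_ifs <;> simp [invSub]
    simp only [PowerSeries.coeff_zero_eq_constantCoeff_apply] at ih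
    simp [key, ih]

theorem h_ne_zero : (h : RatFn n) ≠ 0 := by
  unfold h
  rw [Ne, FaithfulSMul.algebraMap_eq_zero_iff]
  exact MvPolynomial.X_ne_zero _

/-- `T_{i,j}^{(s)} ↦ h^{-s} · [u^{-s}] (L^±_{i,j}(u) ∏_a (u-z_a)^{-1})` on the free algebra. -/
def phiFree (N n : ℕ) (ε : PM) : FreeAlgebra ℂ (Fin N × Fin N × ℕ) →ₐ[ℂ] EndV N n :=
  FreeAlgebra.lift ℂ fun t =>
    ((h : RatFn n)⁻¹ ^ (t.2.2 + 1)) • PowerSeries.coeff (t.2.2 + 1) (normL N n ε t.1 t.2.1)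

theorem phiFree_freeT (ε : PM) (i j : Fin N) (s : ℕ) :
    phiFree N n ε (freeT N i j s) =
      ((h : RatFn n)⁻¹ ^ s) • PowerSeries.coeff s (normL N n ε i j) := by
  cases s with
  | zero =>
    rw [normL_coeff_zero]
    simp only [freeT]
    split_ifs <;> simp
  | succ s => simp [freeT, phiFree]

theorem smul_rel {A K : Type} [Field K] [Ring A] [Algebra K A] {q : K} (hq : q ≠ 0) (r s : ℕ)
    {a a' b b' c c' d d' : A}
    (H : (a * b - b * a) - (a' * b' - b' * a') = q • (c * d - d' * c')) :
    ((q⁻¹ ^ (r + 1) • a) * (q⁻¹ ^ s • b) - (q⁻¹ ^ s • b) * (q⁻¹ ^ (r + 1) • a)) -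
        ((q⁻¹ ^ r • a') * (q⁻¹ ^ (s + 1) • b') - (q⁻¹ ^ (s + 1) • b') * (q⁻¹ ^ r • a'))
      = (q⁻¹ ^ s • c) * (q⁻¹ ^ r • d) - (q⁻¹ ^ r • d') * (q⁻¹ ^ s • c') := by
  have e1 : q⁻¹ ^ s * q⁻¹ ^ r = q⁻¹ ^ (r + 1) * q⁻¹ ^ s * q := by
    rw [pow_succ, mul_assoc, mul_assoc, mul_comm _ q, ← mul_assoc q⁻¹ q, inv_mul_cancel₀ hq,
      one_mul, mul_comm]
  have e2 : q⁻¹ ^ r * q⁻¹ ^ s = q⁻¹ ^ (r + 1) * q⁻¹ ^ s * q := by rw [mul_comm, e1]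
  have e3 : q⁻¹ ^ s * q⁻¹ ^ (r + 1) = q⁻¹ ^ (r + 1) * q⁻¹ ^ s := mul_comm _ _
  have e4 : q⁻¹ ^ r * q⁻¹ ^ (s + 1) = q⁻¹ ^ (r + 1) * q⁻¹ ^ s := by ring
  have e5 : q⁻¹ ^ (s + 1) * q⁻¹ ^ r = q⁻¹ ^ (r + 1) * q⁻¹ ^ s := by ring
  simp only [smul_mul_smul_comm]
  rw [e1, e2, e3, e4, e5]
  simp only [← smul_sub]
  rw [H, smul_smul]

theorem phiFree_rel (ε : PM) (i j k l : Fin N) (r s : ℕ) :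
    phiFree N n ε ((freeT N i j (r + 1) * freeT N k l s - freeT N k l s * freeT N i j (r + 1)) -
        (freeT N i j r * freeT N k l (s + 1) - freeT N k l (s + 1) * freeT N i j r))
      = phiFree N n ε (freeT N k j s * freeT N i l r - freeT N k j r * freeT N i l s) := by
  rw [map_sub, map_sub, map_sub, map_sub, map_mul, map_mul, map_mul, map_mul, map_mul, map_mul]
  simp only [phiFree_freeT]
  exact smul_rel h_ne_zero r s (normL_rel ε i j k l r s)

/-- The homomorphism `Y(gl_N) → End(V) ⊗ ℂ(z, h)`. -/
def phiY (N n : ℕ) (ε : PM) : Yangian N →ₐ[ℂ] EndV N n :=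
  RingQuot.liftAlgHom ℂ ⟨phiFree N n ε, by
    rintro _ _ ⟨i, j, k, l, r, s⟩
    exact phiFree_rel ε i j k l r s⟩

/-- The action `φ^±` on `V`-valued rational functions of `z₁, …, zₙ, h`: the element `h` acts by
multiplication and `T_{i,j}(u/h)` acts by `L^±_{i,j}(u) ∏_a (u-z_a)^{-1}`, see `phi_T`. Since
`h` is invertible in `ℂ(z, h)`, this is defined on all of `Y(gl_N) ⊗ ℂ[h]`, and the elements
`h^{s-1} T_{i,j}^{(s)}` act as in the action of the subalgebra they generate with `ℂ[h]`. -/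
def phi (N n : ℕ) (ε : PM) : YangianH N →+* EndV N n :=
  Polynomial.eval₂RingHom' (phiY N n ε).toRingHom (algebraMap (RatFn n) (EndV N n) h)
    fun _ => (Algebra.commutes _ _).symm

theorem phi_T (ε : PM) (i j : Fin N) :
    PowerSeries.map (phi N n ε) (divH (Tser N i j)) = normL N n ε i j := by
  ext1 s
  have : phiY N n ε (RingQuot.mkAlgHom ℂ (YangianRel N) (freeT N i j s))
      = phiFree N n ε (freeT N i j s) := by
    rw [phiY, RingQuot.liftAlgHom_mkAlgHom_apply]
  simp only [PowerSeries.coeff_map, divH, Tser, PowerSeries.coeff_mk, phi,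
    Polynomial.eval₂RingHom', RingHom.coe_mk, MonoidHom.coe_mk, OneHom.coe_mk,
    Polynomial.eval₂_monomial]
  change phiY N n ε _ * _ = _
  rw [this, phiFree_freeT, ← map_pow, ← Algebra.commutes, ← Algebra.smul_def, smul_smul,
    inv_pow, mul_inv_cancel₀ (pow_ne_zero _ h_ne_zero), one_smul]

end Action

/-- `A^±_p(u) = φ^±(A_p(u))`. -/
def opA (N n : ℕ) (ε : PM) {p : ℕ} (hp : p ≤ N) : (EndV N n)⟦X⟧ :=
  PowerSeries.map (phi N n ε) (serA N hp)

/-- `E^±_p(u) = φ^±(E_p(u))`. -/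
def opE (N n : ℕ) (ε : PM) {p : ℕ} (hp : p < N) : (EndV N n)⟦X⟧ :=
  PowerSeries.map (phi N n ε) (serE N hp)

/-- `F^±_p(u) = φ^±(F_p(u))`. -/
def opF (N n : ℕ) (ε : PM) {p : ℕ} (hp : p < N) : (EndV N n)⟦X⟧ :=
  PowerSeries.map (phi N n ε) (serF N hp)

end YangianXi

end

/-! The operators `s̃_i` are, up to a scalar, an R-matrix composed with the exchange of two
variables. By the Yang–Baxter relation they commute with the whole Yangian action (`phi_sGen`).
Every word is reached from a sorted one by adjacent transpositions, and the right-hand sides of the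
formulas are covariant under them (`sGen_moveSum`). So everything reduces to sorted words, where
`ξ_I` is the basis vector `v_I`. The sign `-` is the sign `+` for the reversed order of the tensor
factors (`isXi_iff`).

On `v_I` the quantum minors are computed by removing tensor factors one at a time, starting with the
one that acts first. Antisymmetry fuses the contributions of a factor at the shifted points `u, u -
h, …` into a single term linear in `h / (u - z_a)` (`altProd_mul_unitMat`). On a sorted word the
principal minor is then diagonal (`minor_diag`), and the minors occurring in `E_p`, `F_p` change
exactly one letter (`minor_move`).

Existence and uniqueness of `ξ` need no braid relations. Any vector obtained from a sorted basis
vector along some path to `I` is an eigenvector of all `A_p(u)`, with eigenvalues depending only on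
`I`. A combination of their coefficients has simple spectrum (`sepEig_injective`), and the `s̃_i`
preserve the sum of the coordinates, which is `1`; hence the vector does not depend on the path
(`Reached.unique`).

For `E_p` and `F_p` on a sorted word, the image (for `F_p`, the image under the minor alone) is
invariant under the `s̃_i` that exchange equal letters, and is supported on words with one letter
changed. Such a vector is determined by one coordinate (`eq_moveSum`), chosen where a single term of
the claimed sum contributes. For `E_p` the inverse of `A_p` acts first, on `v_I`; for `F_p` it acts
last, on the vectors with changed letter. -/

noncomputable section

namespace YangianXi

/-! ### Quantum minors in an abstract ring -/

section AltProd

variable {N : ℕ} {B : Type} [Ring B]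

/-- The antisymmetrised product `∑_σ (-1)^σ T₀(i₀, j_{σ 0}) T₁(i₁, j_{σ 1}) ⋯`. -/
def altProd {p : ℕ} (T : ℕ → Matrix (Fin N) (Fin N) B) (i j : Fin p → Fin N) : B :=
  ∑ σ : Equiv.Perm (Fin p),
    (Equiv.Perm.sign σ : ℤ) • (List.ofFn fun k : Fin p => T (k : ℕ) (i k) (j (σ k))).prod

theorem altProd_comp_perm {p : ℕ} (T : ℕ → Matrix (Fin N) (Fin N) B) (i j : Fin p → Fin N)
    (τ : Equiv.Perm (Fin p)) :
    altProd T i (j ∘ τ) = (Equiv.Perm.sign τ : ℤ) • altProd T i j := by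
  unfold altProd
  rw [Finset.smul_sum]
  symm
  rw [← Equiv.sum_comp (Equiv.mulLeft τ)]
  refine Finset.sum_congr rfl fun σ _ => ?_
  simp only [Equiv.coe_mulLeft, Equiv.Perm.sign_mul, Function.comp_apply, Equiv.Perm.mul_apply,
    smul_smul, ← Units.val_mul, ← mul_assoc, Int.units_mul_self, one_mul]

/-- Transposing two equal columns leaves the minor fixed and also negates it, so its double
vanishes. -/
theorem altProd_eq_zero [IsAddTorsionFree B] {p : ℕ} (T : ℕ → Matrix (Fin N) (Fin N) B)
    (i j : Fin p → Fin N) {a b : Fin p} (hab : a ≠ b) (hj : j a = j b) : altProd T i j = 0 := by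
  have h1 := altProd_comp_perm T i j (Equiv.swap a b)
  have h2 : j ∘ Equiv.swap a b = j := by
    funext k
    by_cases ha : k = a
    · simp [ha, hj]
    · by_cases hb : k = b
      · simp [hb, hj]
      · simp [Equiv.swap_apply_of_ne_of_ne ha hb]
  rw [h2, Equiv.Perm.sign_swap hab] at h1
  have h3 : (2 : ℕ) • altProd T i j = 0 := by
    rw [two_nsmul]
    nth_rewrite 1 [h1]
    simp
  exact (smul_eq_zero.1 h3).resolve_left two_ne_zero

/-- Laplace expansion along the first factor. Summing over all permutations instead of coset
representatives counts each term `p!` times and avoids ordering the complementary columns. -/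
theorem altProd_succ {p : ℕ} (T : ℕ → Matrix (Fin N) (Fin N) B) (i j : Fin (p + 1) → Fin N) :
    (p.factorial) • altProd T i j =
      ∑ σ : Equiv.Perm (Fin (p + 1)), (Equiv.Perm.sign σ : ℤ) •
        (T 0 (i 0) (j (σ 0)) *
          altProd (fun m => T (m + 1)) (fun k => i k.succ) (fun k => j (σ k.succ))) := by
  have key : ∀ τ : Equiv.Perm (Fin p), altProd T i j =
      ∑ σ : Equiv.Perm (Fin (p + 1)), (Equiv.Perm.sign σ : ℤ) • (T 0 (i 0) (j (σ 0)) *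
        ((Equiv.Perm.sign τ : ℤ) •
          (List.ofFn fun k : Fin p => T (k + 1) (i k.succ) (j (σ (τ k).succ))).prod)) := by
    intro τ
    unfold altProd
    rw [← Equiv.sum_comp (Equiv.mulRight (Equiv.Perm.decomposeFin.symm (0, τ)))]
    refine Finset.sum_congr rfl fun σ _ => ?_
    simp only [Equiv.coe_mulRight, Equiv.Perm.sign_mul, List.ofFn_succ, List.prod_cons,
      Equiv.Perm.mul_apply, Equiv.Perm.decomposeFin_symm_apply_zero,
      Equiv.Perm.decomposeFin_symm_apply_succ, Equiv.swap_self, Equiv.refl_apply, Fin.val_zero,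
      Fin.val_succ, Equiv.Perm.decomposeFin.symm_sign, if_true, one_mul, Units.val_mul,
      mul_smul_comm, smul_smul]
  have h2 : (p.factorial) • altProd T i j = ∑ _τ : Equiv.Perm (Fin p), altProd T i j := by
    rw [Finset.sum_const, Finset.card_univ, Fintype.card_perm, Fintype.card_fin]
  rw [h2, Finset.sum_congr rfl fun τ _ => key τ, Finset.sum_comm]
  refine Finset.sum_congr rfl fun σ _ => ?_
  rw [← Finset.smul_sum, ← Finset.mul_sum]
  rfl

end AltProd

/-! ### Fusion: multiplying every factor of a minor by one more tensor site -/

section Fusion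

variable {N : ℕ} {R B : Type} [CommRing R] [Ring B] [Algebra R B]

/-- The matrix `1 + y P^{(0)}` of one tensor factor with matrix units `E`. -/
def unitMat (y : R) (E : Fin N → Fin N → B) : Matrix (Fin N) (Fin N) B :=
  Matrix.of fun i j => (if i = j then 1 else 0) + y • E j i

/-- The permutation part of the site matrix exchanges the column index `d` of `T` with the row index
`e` of the matrix unit on its right. -/
theorem mul_unitMat_apply (T : Matrix (Fin N) (Fin N) B) (y : R) (E : Fin N → Fin N → B)
    (hE : ∀ i j k l, E i j * E k l = if j = k then E i l else 0) (A : B)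
    (hA : ∀ i j, Commute A (E i j)) (i d e c : Fin N) :
    (T * unitMat y E) i d * (A * E e c) =
      T i d * A * E e c + y • (T i e * A * E d c) := by
  have h1 : ∀ k, E d k * (A * E e c) = if k = e then A * E d c else 0 := by
    intro k
    rw [← mul_assoc, ← (hA d k).eq, mul_assoc, hE]
    split_ifs <;> simp
  simp only [Matrix.mul_apply, unitMat, Matrix.of_apply, mul_add, add_mul, Finset.sum_mul,
    Finset.sum_add_distrib]
  congr 1
  · simp [mul_assoc]
  · simp only [mul_smul_comm, smul_mul_assoc, mul_assoc, h1]
    simp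

theorem commute_altProd {p : ℕ} (T : ℕ → Matrix (Fin N) (Fin N) B) (i j : Fin p → Fin N) (b : B)
    (hb : ∀ m i j, Commute (T m i j) b) : Commute (altProd T i j) b := by
  refine Commute.sum_left _ _ _ fun σ _ => Commute.smul_left ?_ _
  refine Commute.list_prod_left _ _ fun x hx => ?_
  rw [List.mem_ofFn] at hx
  obtain ⟨k, rfl⟩ := hx
  exact hb _ _ _

/-- A priori the left side contains products of many `y m`. Antisymmetry and `hy` leave only a term
linear in `y 0`, in which one column is exchanged with the letter of the site. -/
theorem altProd_mul_unitMat [IsAddTorsionFree B] {p : ℕ} (T : ℕ → Matrix (Fin N) (Fin N) B)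
    (y : ℕ → R) (hy : ∀ m, y (m + 1) - y m = y m * y (m + 1)) (E : Fin N → Fin N → B)
    (hE : ∀ i j k l, E i j * E k l = if j = k then E i l else 0)
    (hT : ∀ m i j k l, Commute (T m i j) (E k l)) (i j : Fin p → Fin N) (c c' : Fin N) :
    altProd (fun m => T m * unitMat (y m) E) i j * E c c' =
      altProd T i j * E c c' +
        y 0 • ∑ l, altProd T i (Function.update j l c) * E (j l) c' := by
  induction p generalizing T y c with
  | zero => simp [altProd]
  | succ p ih =>
    have hf : p.factorial ≠ 0 := Nat.factorial_ne_zero p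
    refine smul_right_injective B hf ?_
    simp only
    rw [← smul_mul_assoc, altProd_succ, Finset.sum_mul]
    set A : (Fin p → Fin N) → B := altProd (fun m => T (m + 1)) (fun k => i k.succ) with hA
    have hAc : ∀ j i' k, Commute (A j) (E i' k) := fun j i' k =>
      commute_altProd _ _ _ _ fun m _ _ => hT _ _ _ _ _
    obtain ⟨W, hWdef⟩ : ∃ W : (Fin (p + 1) → Fin N) → B,
        ∀ j, W j = T 0 (i 0) (j 0) * A fun k => j k.succ := ⟨_, fun _ => rfl⟩
    have hW : ∀ j, p.factorial • altProd T i j =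
        ∑ σ : Equiv.Perm (Fin (p + 1)), (Equiv.Perm.sign σ : ℤ) • W (j ∘ σ) :=
      fun j => (altProd_succ T i j).trans (Finset.sum_congr rfl fun σ _ => by rw [hWdef]; rfl)
    -- Apply the induction hypothesis to the last `p` factors, then the first factor. The four terms
    -- record whether neither, only the first, only a later, or both stages exchange indices; a
    -- double exchange is written as a single one for `σ` times a transposition.
    have step : ∀ σ : Equiv.Perm (Fin (p + 1)),
        ((Equiv.Perm.sign σ : ℤ) • ((T 0 * unitMat (y 0) E) (i 0) (j (σ 0)) *
          altProd (fun m => T (m + 1) * unitMat (y (m + 1)) E) (fun k => i k.succ)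
            (fun k => j (σ k.succ)))) * E c c' =
        (Equiv.Perm.sign σ : ℤ) • (W (j ∘ σ) * E c c')
        + (Equiv.Perm.sign σ : ℤ) • y 0 • (W (Function.update (j ∘ σ) 0 c) * E (j (σ 0)) c')
        + (Equiv.Perm.sign σ : ℤ) • y 1 • (∑ l : Fin p,
            (W (Function.update (j ∘ σ) l.succ c) * E (j (σ l.succ)) c'))
        + ∑ l : Fin p, (y 0 * y 1) • (Equiv.Perm.sign σ : ℤ) •
            (W (Function.update (j ∘ (σ * Equiv.swap 0 l.succ : Equiv.Perm _)) l.succ c)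
              * E (j ((σ * Equiv.swap 0 l.succ : Equiv.Perm _) l.succ)) c') := by
      intro σ
      have hih := ih (fun m => T (m + 1)) (fun m => y (m + 1)) (fun m => hy _)
        (fun m i j k l => hT _ _ _ _ _) (fun k => i k.succ) (fun k => j (σ k.succ)) c
      change _ = A _ * _ + y 1 • ∑ l, A _ * _ at hih
      have e1 : ∀ l : Fin p, (fun k : Fin p => Function.update (j ∘ σ) l.succ c k.succ)
          = Function.update (fun k => j (σ k.succ)) l c := by
        intro l; funext k
        simp [Function.update_apply]
      have e2 : ∀ l : Fin p, (fun k : Fin p => Function.update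
          (j ∘ (σ * Equiv.swap 0 l.succ : Equiv.Perm _)) l.succ c k.succ)
          = Function.update (fun k => j (σ k.succ)) l c := by
        intro l; funext k
        by_cases hk : k = l
        · simp [hk]
        · have : (k.succ : Fin (p + 1)) ≠ l.succ := fun h => hk (Fin.succ_injective _ h)
          simp [hk, Equiv.swap_apply_of_ne_of_ne (Fin.succ_ne_zero k) this]
      rw [smul_mul_assoc, mul_assoc, hih, mul_add, mul_smul_comm, Finset.mul_sum]
      simp only [mul_unitMat_apply (T 0) (y 0) E hE _ (hAc _), hWdef, e1, e2]
      simp only [Finset.sum_add_distrib, smul_add, ← Finset.smul_sum,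
        Function.comp_apply, Function.update_self, Equiv.Perm.mul_apply, Equiv.swap_apply_right,
        Function.update_of_ne (Fin.succ_ne_zero _), Function.update_of_ne (Fin.succ_ne_zero _).symm,
        Equiv.swap_apply_left]
      rw [smul_comm (y 0 * y 1), mul_comm (y 0), mul_smul]
      simp only [add_assoc]
    rw [Finset.sum_congr rfl fun σ _ => step σ]
    simp only [Finset.sum_add_distrib]
    -- Absorbing the transposition into `σ` reverses the sign, so double exchanges contribute `-y 0
    -- * y 1` times the sum that appears with `y 1`.
    have fourth : ∑ σ : Equiv.Perm (Fin (p + 1)), ∑ l : Fin p,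
        (y 0 * y 1) • (Equiv.Perm.sign σ : ℤ) •
            (W (Function.update (j ∘ (σ * Equiv.swap 0 l.succ : Equiv.Perm _)) l.succ c)
              * E (j ((σ * Equiv.swap 0 l.succ : Equiv.Perm _) l.succ)) c')
        = - ∑ σ : Equiv.Perm (Fin (p + 1)), (Equiv.Perm.sign σ : ℤ) • (y 0 * y 1) • (∑ l : Fin p,
            (W (Function.update (j ∘ σ) l.succ c) * E (j (σ l.succ)) c')) := by
      simp only [Finset.smul_sum]
      rw [Finset.sum_comm, Finset.sum_comm (s := Finset.univ (α := Equiv.Perm (Fin (p + 1)))),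
        ← Finset.sum_neg_distrib]
      refine Finset.sum_congr rfl fun l _ => ?_
      rw [← Equiv.sum_comp (Equiv.mulRight (Equiv.swap 0 l.succ)), ← Finset.sum_neg_distrib]
      refine Finset.sum_congr rfl fun σ _ => ?_
      simp only [Equiv.coe_mulRight]
      rw [Equiv.Perm.sign_mul, Equiv.Perm.sign_swap (Fin.succ_ne_zero l).symm,
        mul_assoc, Equiv.swap_mul_self, mul_one, smul_comm]
      simp
    rw [fourth]
    -- Thus `y 1 - y 0 * y 1 = y 0`: exchanges at later positions get the same coefficient as at
    -- position `0`.
    have hy0 : ∀ b : B, y 1 • b = y 0 • b + (y 0 * y 1) • b := fun b => by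
      rw [← add_smul, ← hy 0]; ring_nf
    have comb : ∀ l, ∑ σ : Equiv.Perm (Fin (p + 1)), (Equiv.Perm.sign σ : ℤ) •
        (W (Function.update j l c ∘ σ) * E (j l) c')
        = p.factorial • (altProd T i (Function.update j l c) * E (j l) c') := by
      intro l
      rw [← smul_mul_assoc, hW, Finset.sum_mul]
      simp only [smul_mul_assoc]
    -- Position `0` and the later positions together run over all columns, after relabelling a
    -- position `l` as the column `σ l`.
    have tot : ∑ σ : Equiv.Perm (Fin (p + 1)), (Equiv.Perm.sign σ : ℤ) • y 0 •
        (W (Function.update (j ∘ σ) 0 c) * E (j (σ 0)) c')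
        + ∑ σ : Equiv.Perm (Fin (p + 1)), (Equiv.Perm.sign σ : ℤ) • y 0 • (∑ l : Fin p,
            (W (Function.update (j ∘ σ) l.succ c) * E (j (σ l.succ)) c'))
        = p.factorial • (y 0 • ∑ l, altProd T i (Function.update j l c) * E (j l) c') := by
      rw [smul_comm, Finset.smul_sum (r := p.factorial), ← Finset.sum_congr rfl fun l _ => comb l,
        Finset.sum_comm, ← Finset.sum_add_distrib, Finset.smul_sum]
      refine Finset.sum_congr rfl fun σ _ => ?_
      rw [← Finset.smul_sum, ← smul_add, ← smul_add, smul_comm (y 0)]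
      congr 2
      rw [← Equiv.sum_comp σ, Fin.sum_univ_succ]
      have hu : ∀ l, Function.update j (σ l) c ∘ σ = Function.update (j ∘ σ) l c :=
        fun l => Function.update_comp_eq_of_injective _ σ.injective _ _
      simp only [hu]
    rw [smul_add, ← tot, ← smul_mul_assoc (p.factorial), hW, Finset.sum_mul]
    simp only [smul_mul_assoc]
    simp only [hy0, smul_add, Finset.sum_add_distrib]
    abel

end Fusion

/-! ### Quantum minors of an ordered product of sites, acting on a fixed word -/

section Path

variable {N : ℕ} {R B ι : Type} [CommRing R] [Ring B] [Algebra R B]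

/-- Commuting families of matrix units `E a`, one for every site `a`, and parameters
`y a m = h / (u - m h - z_a)`. -/
structure IsSites (E : ι → Fin N → Fin N → B) (y : ι → ℕ → R) : Prop where
  mul : ∀ a i j k l, E a i j * E a k l = if j = k then E a i l else 0
  comm : ∀ a b, a ≠ b → ∀ i j k l, Commute (E a i j) (E b k l)
  step : ∀ a m, y a (m + 1) - y a m = y a m * y a (m + 1)

/-- The ordered product of the matrices of the sites in `l`, the first site being the
rightmost factor. -/
def transfer (E : ι → Fin N → Fin N → B) (y : ι → ℕ → R) (l : List ι) (m : ℕ) :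
    Matrix (Fin N) (Fin N) B :=
  (l.reverse.map fun a => unitMat (y a m) (E a)).prod

theorem transfer_nil (E : ι → Fin N → Fin N → B) (y : ι → ℕ → R) (m : ℕ) :
    transfer E y [] m = 1 := by simp [transfer]

theorem transfer_cons (E : ι → Fin N → Fin N → B) (y : ι → ℕ → R) (a : ι) (l : List ι) (m : ℕ) :
    transfer E y (a :: l) m = transfer E y l m * unitMat (y a m) (E a) := by simp [transfer]

variable {E : ι → Fin N → Fin N → B} {y : ι → ℕ → R}

theorem IsSites.commute_transfer (H : IsSites E y) {a : ι} {l : List ι} (ha : a ∉ l) (m : ℕ)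
    (i j k k' : Fin N) : Commute (transfer E y l m i j) (E a k k') := by
  induction l generalizing i j with
  | nil =>
    rw [transfer_nil, Matrix.one_apply]
    split_ifs
    · exact Commute.one_left _
    · exact Commute.zero_left _
  | cons b l ih =>
    rw [List.mem_cons, not_or] at ha
    rw [transfer_cons, Matrix.mul_apply]
    refine Commute.sum_left _ _ _ fun c _ => Commute.mul_left (ih ha.2 _ _) ?_
    rw [unitMat, Matrix.of_apply]
    refine Commute.add_left ?_ (Commute.smul_left (H.comm _ _ (Ne.symm ha.1) _ _ _ _) _)
    split_ifs
    · exact Commute.one_left _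
    · exact Commute.zero_left _

/-- The quantum minors of the transfer matrix. -/
def minor (E : ι → Fin N → Fin N → B) (y : ι → ℕ → R) {p : ℕ} (l : List ι)
    (i j : Fin p → Fin N) : B :=
  altProd (transfer E y l) i j

/-- The fusion identity with `P` in the role of a vector whose letter at the site `a` is `c`. The
head of the list is the rightmost factor, hence acts first. -/
theorem IsSites.minor_cons_mul [IsAddTorsionFree B] (H : IsSites E y) {p : ℕ} {a : ι}
    {l : List ι} (ha : a ∉ l) (i j : Fin p → Fin N) {c : Fin N} {P : B} (hP : E a c c * P = P) :
    minor E y (a :: l) i j * P = minor E y l i j * P +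
      y a 0 • ∑ s, minor E y l i (Function.update j s c) * (E a (j s) c * P) := by
  have h1 := altProd_mul_unitMat (transfer E y l) (y a) (H.step a) (E a) (H.mul a)
    (fun m i j k k' => H.commute_transfer ha m i j k k') i j c c
  have h2 : (fun m => transfer E y l m * unitMat (y a m) (E a)) = transfer E y (a :: l) :=
    funext fun m => (transfer_cons E y a l m).symm
  rw [h2] at h1
  have h3 := congrArg (· * P) h1
  simpa only [add_mul, mul_assoc, hP, smul_mul_assoc, Finset.sum_mul, minor] using h3

theorem one_list_prod {p : ℕ} (i j : Fin p → Fin N) :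
    (List.ofFn fun k : Fin p => (1 : Matrix (Fin N) (Fin N) B) (i k) (j k)).prod =
      if i = j then 1 else 0 := by
  split_ifs with hij
  · subst hij
    refine List.prod_eq_one fun x hx => ?_
    rw [List.mem_ofFn] at hx
    obtain ⟨k, rfl⟩ := hx
    simp
  · obtain ⟨k, hk⟩ := Function.ne_iff.1 hij
    exact List.prod_eq_zero ((List.mem_ofFn' _ _).2 ⟨k, by simp [Matrix.one_apply_ne hk]⟩)

theorem minor_nil {p : ℕ} (i j : Fin p → Fin N) :
    minor E y [] i j = ∑ σ : Equiv.Perm (Fin p),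
      (Equiv.Perm.sign σ : ℤ) • (if i = j ∘ σ then 1 else 0 : B) := by
  unfold minor altProd
  refine Finset.sum_congr rfl fun σ _ => ?_
  simp only [transfer_nil]
  rw [← one_list_prod]
  rfl

theorem minor_nil_self {p : ℕ} {i : Fin p → Fin N} (hi : Function.Injective i) :
    minor E y [] i i = 1 := by
  rw [minor_nil, Finset.sum_eq_single 1]
  · simp
  · intro σ _ hσ
    rw [if_neg, smul_zero]
    intro h
    exact hσ (Equiv.ext fun k => (hi (congrFun h k)).symm)
  · simp

theorem minor_nil_eq_zero {p : ℕ} {i j : Fin p → Fin N} {r : Fin p} (hj : ∀ s, j s ≠ i r) :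
    minor E y [] i j = 0 := by
  rw [minor_nil]
  refine Finset.sum_eq_zero fun σ _ => ?_
  rw [if_neg, smul_zero]
  intro h
  exact hj _ (congrFun h r).symm

/-- The element `P` has the letter `w a` at every site `a` of `l`. -/
def Fixed (E : ι → Fin N → Fin N → B) (w : ι → Fin N) (l : List ι) (P : B) : Prop :=
  ∀ a ∈ l, E a (w a) (w a) * P = P

theorem IsSites.fixed_mul (H : IsSites E y) {w : ι → Fin N} {a : ι} {l : List ι} (ha : a ∉ l)
    {P : B} (hP : Fixed E w l P) (d c : Fin N) : Fixed E w l (E a d c * P) := by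
  intro b hb
  rw [← mul_assoc, ← (H.comm a b (fun h => ha (h ▸ hb)) d c _ _).eq, mul_assoc, hP b hb]

/-- Processing a site can only replace a column by the letter of that site. A row letter absent from
the columns and from all sites is therefore still absent when no site is left, where the minor is
that of the identity matrix. -/
theorem IsSites.minor_vanish [IsAddTorsionFree B] (H : IsSites E y) {p : ℕ} {w : ι → Fin N}
    {l : List ι} (hl : l.Nodup) {i j : Fin p → Fin N} {r : Fin p} (hj : ∀ s, j s ≠ i r)
    (hw : ∀ a ∈ l, w a ≠ i r) {P : B} (hP : Fixed E w l P) : minor E y l i j * P = 0 := by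
  induction l generalizing j P with
  | nil => rw [minor_nil_eq_zero hj, zero_mul]
  | cons a l ih =>
    rw [List.nodup_cons] at hl
    have hPl : Fixed E w l P := fun b hb => hP b (List.mem_cons_of_mem _ hb)
    have hwl : ∀ b ∈ l, w b ≠ i r := fun b hb => hw b (List.mem_cons_of_mem _ hb)
    rw [H.minor_cons_mul hl.1 i j (hP a List.mem_cons_self), ih hl.2 hj hwl hPl, zero_add,
      Finset.sum_eq_zero, smul_zero]
    intro s _
    refine ih hl.2 (fun t => ?_) hwl (H.fixed_mul hl.1 hPl _ _)
    rw [Function.update_apply]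
    split_ifs
    · exact hw a List.mem_cons_self
    · exact hj t

/-- A letter of the column set is transported diagonally. -/
theorem IsSites.minor_cons_of_mem [IsAddTorsionFree B] (H : IsSites E y) {p : ℕ}
    {w : ι → Fin N} {a : ι} {l : List ι} (ha : a ∉ l) {i j : Fin p → Fin N} {r : Fin p}
    (hr : j r = w a) {P : B} (hP : Fixed E w (a :: l) P) :
    minor E y (a :: l) i j * P = (1 + y a 0) • (minor E y l i j * P) := by
  rw [H.minor_cons_mul ha i j (hP a List.mem_cons_self), Finset.sum_eq_single r, add_smul,
    one_smul, ← hr, Function.update_eq_self, hr, hP a List.mem_cons_self]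
  · intro s _ hs
    rw [minor, altProd_eq_zero _ _ _ hs, zero_mul]
    simp [Function.update_of_ne hs.symm, hr]
  · simp

/-- By `hs`, sites with letters in the row set come first, and each gives a factor `1 + y a 0`. At
any other site an exchange would lose a row letter that no later site can restore. -/
theorem IsSites.minor_diag [IsAddTorsionFree B] (H : IsSites E y) {p : ℕ} {w : ι → Fin N}
    {l : List ι} (hl : l.Nodup) {i : Fin p → Fin N} (hi : Function.Injective i)
    (hs : l.Pairwise fun a b => (∃ r, i r = w b) → ∃ r, i r = w a) {P : B}
    (hP : Fixed E w l P) :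
    minor E y l i i * P = (l.map fun a => if ∃ r, i r = w a then 1 + y a 0 else 1).prod • P := by
  induction l generalizing P with
  | nil => simp [minor_nil_self hi]
  | cons a l ih =>
    rw [List.nodup_cons] at hl
    rw [List.pairwise_cons] at hs
    have hPl : Fixed E w l P := fun b hb => hP b (List.mem_cons_of_mem _ hb)
    rw [List.map_cons, List.prod_cons]
    split_ifs with h
    · obtain ⟨r, hr⟩ := h
      rw [H.minor_cons_of_mem hl.1 hr hP, ih hl.2 hs.2 hPl, mul_smul]
    · rw [H.minor_cons_mul hl.1 i i (hP a List.mem_cons_self), ih hl.2 hs.2 hPl,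
        Finset.sum_eq_zero, smul_zero, add_zero, one_mul]
      intro s _
      refine H.minor_vanish hl.2 (r := s) (w := w) (fun t => ?_) (fun b hb hbs => ?_)
        (H.fixed_mul hl.1 hPl _ _)
      · rw [Function.update_apply]
        split_ifs with hts
        · exact fun hh => h ⟨s, hh.symm⟩
        · exact fun hh => hts (hi hh)
      · exact h (hs.1 b hb ⟨s, hbs.symm⟩)

/-- The columns lack the letter `i r`, which has to be picked up at some site `m` in exchange for
`d`. Smaller letters belong to the columns and act diagonally. Sites with letter `i r` contribute
nothing before `m` and a factor `1 + y a 0` after it, because only then is `i r` a column. Larger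
letters come too late. -/
theorem IsSites.minor_move [IsAddTorsionFree B] [DecidableEq ι] (H : IsSites E y) {p : ℕ}
    {w : ι → Fin N} {pos : ι → ℕ} {l : List ι} (hl : l.Pairwise fun a b => pos a < pos b)
    (hs : l.Pairwise fun a b => w a ≤ w b)
    {i : Fin p → Fin N} (hi : Function.Injective i) (r : Fin p) {d : Fin N} (hd : ∀ s, i s ≠ d)
    (hir : ∀ s, s ≠ r → i s < i r) (hj : ∀ b, b < i r → ∃ s, Function.update i r d s = b) {P : B}
    (hP : Fixed E w l P) :
    minor E y l i (Function.update i r d) * P =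
      ∑ m ∈ l.toFinset with w m = i r,
        (y m 0 * (l.map fun a => if w a < i r then 1 + y a 0 else 1).prod *
          (l.map fun a => if w a = i r ∧ pos m < pos a then 1 + y a 0 else 1).prod) •
            (E m d (i r) * P) := by
  have hmiss : ∀ s, Function.update i r d s ≠ i r := by
    intro s
    rw [Function.update_apply]
    split_ifs with hsr
    · exact (hd r).symm
    · exact fun h => hsr (hi h)
  induction l generalizing P with
  | nil => simp [minor_nil_eq_zero hmiss]
  | cons a l ih =>
    have hal : a ∉ l := fun h => lt_irrefl _ ((List.pairwise_cons.1 hl).1 a h)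
    have hnd : l.Nodup := (List.pairwise_cons.1 hl).2.imp fun h1 h2 => by simp [h2] at h1
    have hPl : Fixed E w l P := fun b hb => hP b (List.mem_cons_of_mem _ hb)
    have ih' := ih (List.pairwise_cons.1 hl).2 (List.pairwise_cons.1 hs).2 hPl
    rw [List.pairwise_cons] at hl hs
    rcases lt_trichotomy (w a) (i r) with hlt | heq | hgt
    · obtain ⟨s, hs'⟩ := hj _ hlt
      rw [H.minor_cons_of_mem hal hs' hP, ih', List.toFinset_cons, Finset.filter_insert,
        if_neg hlt.ne, Finset.smul_sum]
      refine Finset.sum_congr rfl fun m hm => ?_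
      rw [List.map_cons, List.prod_cons, if_pos hlt, List.map_cons, List.prod_cons,
        if_neg (fun h => hlt.ne h.1), smul_smul]
      congr 1
      ring
    · have hge : ∀ b ∈ l, ¬ w b < i r := fun b hb => not_lt.2 (heq ▸ hs.1 b hb)
      -- The term without exchange leaves the pick-up to later sites. Exchanging the column `r`
      -- restores the columns to `i`, and `minor_diag` takes over.
      rw [H.minor_cons_mul hal i _ (hP a List.mem_cons_self), ih', Finset.sum_eq_single r,
        Function.update_self, Function.update_idem, heq, Function.update_eq_self,
        H.minor_diag hnd hi (w := w) _ (H.fixed_mul hal hPl _ _), List.toFinset_cons,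
        Finset.filter_insert, if_pos heq, Finset.sum_insert, add_comm]
      · have hpd : (l.map fun b => if w b < i r then 1 + y b 0 else 1).prod = 1 :=
          List.prod_eq_one fun x hx => by
            obtain ⟨b, hb, rfl⟩ := List.mem_map.1 hx
            rw [if_neg (hge b hb)]
        simp only [List.map_cons, List.prod_cons, hpd, heq, lt_irrefl, if_false, mul_one, and_false,
          one_mul, true_and]
        congr 1
        · rw [smul_smul]
          congr 3
          refine List.map_congr_left fun b hb => ?_
          refine if_congr ?_ rfl rfl
          constructor
          · rintro ⟨s, hsb⟩
            refine ⟨?_, hl.1 b hb⟩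
            by_cases hsr : s = r
            · rw [← hsb, hsr]
            · exact absurd (hsb ▸ hir s hsr) (hge b hb)
          · rintro ⟨h, -⟩
            exact ⟨r, h.symm⟩
        · refine Finset.sum_congr rfl fun m hm => ?_
          rw [Finset.mem_filter, List.mem_toFinset] at hm
          rw [if_neg (hl.1 m hm.1).not_gt, one_mul]
      · simp [hal]
      -- All remaining letters are at least `i r`, the largest row letter, so those in the row set
      -- equal `i r` and come first.
      · refine (List.pairwise_iff_forall_sublist.2 fun {b c} hbc => ?_)
        have hbc' : w b ≤ w c := List.pairwise_iff_forall_sublist.1 hs.2 hbc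
        rintro ⟨s, hsc⟩
        have hb : b ∈ l := hbc.subset List.mem_cons_self
        have hcr : w c ≤ i r := by
          rw [← hsc]
          by_cases hsr : s = r
          · rw [hsr]
          · exact (hir s hsr).le
        exact ⟨r, le_antisymm (not_lt.1 (hge b hb)) (hbc'.trans hcr)⟩
      -- Exchanging another column loses `i s < i r`, which is smaller than every remaining letter.
      · intro s _ hsr
        refine H.minor_vanish hnd (r := s) (w := w) (fun t => ?_) (fun b hb hbs => ?_)
          (H.fixed_mul hal hPl _ _)
        · rw [Function.update_apply]
          split_ifs with hts
          · exact heq ▸ (hir s hsr).ne'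
          · rw [Function.update_apply]
            split_ifs with htr
            · exact (hd s).symm
            · exact fun h => hts (hi h)
        · exact hge b hb (hbs ▸ hir s hsr)
      · simp
    · rw [H.minor_vanish (w := w) (List.nodup_cons.2 ⟨hal, hnd⟩) hmiss _ hP, Finset.sum_eq_zero]
      · intro m hm
        rw [Finset.mem_filter, List.mem_toFinset, List.mem_cons] at hm
        rcases hm with ⟨rfl | hm, hmr⟩
        · exact absurd hmr hgt.ne'
        · exact absurd (hs.1 m hm) (hmr ▸ hgt.not_ge)
      · intro b hb
        rcases List.mem_cons.1 hb with rfl | hb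
        · exact hgt.ne'
        · exact (hgt.trans_le (hs.1 b hb)).ne'

end Path

/-! ### The substitution `u ↦ u - c` as a ring homomorphism of series in `u⁻¹` -/

section Shift

variable {K : Type} [Field K] {A : Type} [Ring A] [Algebra K A]

/-- The geometric recursion `invSub_spec` becomes Pascal's rule. Truncated subtraction covers `s =
0` as well, since `(r - 1).choose r = 0` for `r > 0`. -/
theorem coeff_invSub_pow (c : K) (s r : ℕ) :
    PowerSeries.coeff r (invSub c ^ s) =
      if s ≤ r then ((r - 1).choose (r - s) : K) * c ^ (r - s) else 0 := by
  induction s generalizing r with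
  | zero =>
    rcases r with _ | r
    · simp
    · simp [PowerSeries.coeff_one]
  | succ s ih =>
    induction r with
    | zero => simp [pow_succ, invSub]
    | succ r ihr =>
      have hg : invSub c ^ (s + 1) =
          PowerSeries.X * (invSub c ^ s + PowerSeries.C c * invSub c ^ (s + 1)) := by
        have := invSub_spec c
        rw [pow_succ]
        linear_combination (invSub c ^ s) * this
      rw [hg, PowerSeries.coeff_succ_X_mul, map_add, PowerSeries.coeff_C_mul, ihr, ih]
      rcases lt_trichotomy s r with h | h | h
      · obtain ⟨k, rfl⟩ := Nat.exists_eq_add_of_lt h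
        have h1 : s + k + 1 - s = k + 1 := by omega
        have h2 : s + k + 1 - (s + 1) = k := by omega
        have h3 : s + k + 1 + 1 - (s + 1) = k + 1 := by omega
        have h4 : s + k + 1 - 1 = s + k := by omega
        have h5 : s + k + 1 + 1 - 1 = s + k + 1 := by omega
        rw [if_pos (by omega), if_pos (by omega), if_pos (by omega), h1, h2, h3, h4, h5,
          Nat.choose_succ_succ]
        push_cast
        ring
      · subst h
        simp
      · rw [if_neg (by omega), if_neg (by omega), if_neg (by omega)]
        simp

/-- The substitution `u ↦ u - c` in a series in `u⁻¹`, as a function. -/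
def shiftFun (c : K) (f : A⟦X⟧) : A⟦X⟧ :=
  PowerSeries.mk fun r =>
    ∑ s ∈ Finset.range (r + 1), PowerSeries.coeff r (invSub c ^ s) • PowerSeries.coeff s f

theorem coeff_shiftFun (c : K) (f : A⟦X⟧) {r M : ℕ} (h : r < M) :
    PowerSeries.coeff r (shiftFun c f) =
      ∑ s ∈ Finset.range M, PowerSeries.coeff r (invSub c ^ s) • PowerSeries.coeff s f := by
  rw [shiftFun, PowerSeries.coeff_mk]
  refine Finset.sum_subset (Finset.range_subset_range.2 h) fun s _ hs => ?_
  rw [Finset.mem_range, not_lt] at hs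
  rw [coeff_invSub_pow, if_neg (by omega), zero_smul]

/-- The substitution `u ↦ u - c` in a series in `u⁻¹`. -/
def shiftHom (c : K) : A⟦X⟧ →+* A⟦X⟧ where
  toFun := shiftFun c
  map_zero' := by ext r; simp [shiftFun]
  map_add' f g := by ext r; simp [shiftFun, Finset.sum_add_distrib]
  map_one' := by
    ext r
    rw [shiftFun, PowerSeries.coeff_mk, Finset.sum_eq_single 0]
    · rw [pow_zero, PowerSeries.coeff_one, PowerSeries.coeff_one, PowerSeries.coeff_one]
      simp
    · intro s _ hs
      rw [PowerSeries.coeff_one, if_neg hs, smul_zero]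
    · simp
  map_mul' f g := by
    ext r
    rw [PowerSeries.coeff_mul]
    have h1 : ∀ x ∈ Finset.HasAntidiagonal.antidiagonal r,
        PowerSeries.coeff x.1 (shiftFun c f) * PowerSeries.coeff x.2 (shiftFun c g)
        = ∑ q ∈ Finset.range (r + 1) ×ˢ Finset.range (r + 1),
          (PowerSeries.coeff x.1 (invSub c ^ q.1) * PowerSeries.coeff x.2 (invSub c ^ q.2)) •
            (PowerSeries.coeff q.1 f * PowerSeries.coeff q.2 g) := by
      intro x hx
      rw [Finset.HasAntidiagonal.mem_antidiagonal] at hx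
      rw [coeff_shiftFun c f (show x.1 < r + 1 by omega),
        coeff_shiftFun c g (show x.2 < r + 1 by omega), Finset.sum_mul_sum, Finset.sum_product]
      simp only [smul_mul_smul_comm]
    rw [Finset.sum_congr rfl h1, Finset.sum_comm]
    simp only [← Finset.sum_smul, ← PowerSeries.coeff_mul, ← pow_add]
    rw [shiftFun, PowerSeries.coeff_mk]
    simp only [PowerSeries.coeff_mul, Finset.smul_sum]
    -- `(u - c)^{-s}` starts at `u^{-s}`, so pairs with `q.1 + q.2 > r` do not reach the coefficient
    -- of `u^{-r}`.
    rw [Finset.sum_sigma', ← Finset.sum_filter_of_ne (p := fun q : ℕ × ℕ => q.1 + q.2 ≤ r)]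
    · refine Finset.sum_nbij' (fun x => x.2) (fun q => ⟨q.1 + q.2, q⟩) ?_ ?_ ?_ ?_ ?_
      · rintro ⟨s, a, b⟩ hx
        simp at hx ⊢
        omega
      · rintro ⟨a, b⟩ hx
        simp at hx ⊢
        omega
      · rintro ⟨s, a, b⟩ hx
        simp at hx
        obtain ⟨-, rfl⟩ := hx
        rfl
      · intros; rfl
      · rintro ⟨s, a, b⟩ hx
        simp at hx
        obtain ⟨-, rfl⟩ := hx
        rfl
    · rintro ⟨a, b⟩ _ hne
      by_contra hlt
      apply hne
      rw [coeff_invSub_pow, if_neg hlt, zero_smul]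

theorem coeff_shiftHom (c : K) (f : A⟦X⟧) (r : ℕ) :
    PowerSeries.coeff r (shiftHom c f) =
      ∑ s ∈ Finset.range (r + 1),
        (((r - 1).choose (r - s) : K) * c ^ (r - s)) • PowerSeries.coeff s f := by
  change PowerSeries.coeff r (shiftFun c f) = _
  rw [shiftFun, PowerSeries.coeff_mk]
  refine Finset.sum_congr rfl fun s hs => ?_
  rw [Finset.mem_range] at hs
  rw [coeff_invSub_pow, if_pos (by omega)]

theorem shiftHom_C (c : K) (a : A) : shiftHom c (PowerSeries.C a) = PowerSeries.C a := by
  ext r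
  rw [coeff_shiftHom, Finset.sum_eq_single 0]
  · rcases r with _ | r <;> simp [PowerSeries.coeff_C]
  · intro s _ hs
    rw [PowerSeries.coeff_C, if_neg hs, smul_zero]
  · simp

theorem shiftHom_map (c : K) (f : K⟦X⟧) :
    shiftHom c (PowerSeries.map (algebraMap K A) f) =
      PowerSeries.map (algebraMap K A) (shiftHom c f) := by
  ext r
  rw [PowerSeries.coeff_map, coeff_shiftHom, coeff_shiftHom, map_sum]
  refine Finset.sum_congr rfl fun s _ => ?_
  rw [PowerSeries.coeff_map, Algebra.smul_def, ← map_mul, smul_eq_mul]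

theorem shiftHom_invSub (c x : K) : shiftHom c (invSub x) = invSub (x + c) := by
  ext r
  rw [coeff_shiftHom]
  rcases r with _ | r
  · simp [invSub]
  · rw [Finset.sum_range_succ']
    have h0 : PowerSeries.coeff 0 (invSub x) = 0 := by simp [invSub]
    have h1 : ∀ (y : K) t, PowerSeries.coeff (t + 1) (invSub y) = y ^ t := by
      intro y t; simp [invSub]
    rw [h0, smul_zero, add_zero, h1, add_pow]
    refine Finset.sum_congr rfl fun s hs => ?_
    rw [Finset.mem_range] at hs
    rw [h1, Nat.add_sub_cancel, Nat.add_sub_add_right, Nat.choose_symm (by omega), smul_eq_mul]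
    ring

/-- Partial fractions. This one identity gives both the fusion relation of `ySer` and the scalar
part of the Yang–Baxter relation. -/
theorem invSub_sub (c x : K) :
    invSub (x + c) - invSub x = PowerSeries.C c * (invSub x * invSub (x + c)) := by
  have h1 := invSub_spec x
  have h2 := invSub_spec (x + c)
  refine mul_left_cancel₀ (PowerSeries.X_ne_zero (R := K)) ?_
  rw [map_add] at h2
  linear_combination invSub x * h2 - invSub (x + c) * h1

end Shift

/-! ### The quantum minors of the Yangian act as minors of the transfer matrix -/

section Identify

variable {N n : ℕ}

instance : IsAddTorsionFree (EndV N n)⟦X⟧ where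
  nsmul_right_injective k hk f g hfg := by
    refine PowerSeries.ext fun s => LinearMap.ext fun v => funext fun w => ?_
    have h1 := congrArg (fun F => (PowerSeries.coeff s F : EndV N n) v w) hfg
    simp only [map_nsmul, LinearMap.smul_apply, Pi.smul_apply] at h1
    exact nsmul_right_injective hk h1

/-- Scalar series act on operator valued ones. -/
instance algebraSeries : Algebra (RatFn n)⟦X⟧ (EndV N n)⟦X⟧ :=
  (PowerSeries.map (algebraMap (RatFn n) (EndV N n))).toAlgebra' fun g f => map_central g f

theorem algebraMap_series (g : (RatFn n)⟦X⟧) :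
    algebraMap (RatFn n)⟦X⟧ (EndV N n)⟦X⟧ g = PowerSeries.map (algebraMap _ _) g := rfl

/-- The matrix units of the tensor factors, as constant series. -/
def unitSer (N : ℕ) {n : ℕ} (a : Fin n) (i j : Fin N) : (EndV N n)⟦X⟧ :=
  PowerSeries.C (eSite a i j)

/-- The series `h / (u - z_a - m h)`. -/
def ySer {n : ℕ} (a : Fin n) (m : ℕ) : (RatFn n)⟦X⟧ :=
  PowerSeries.C h * invSub (z a + (m : RatFn n) * h)

theorem isSites : IsSites (unitSer N (n := n)) ySer where
  mul a i j k l := by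
    simp only [unitSer, ← map_mul, eSite_mul]
    split_ifs <;> simp
  comm a b hab i j k l := (eSite_commute hab i j k l).map PowerSeries.C
  step a m := by
    have h1 := invSub_sub (h : RatFn n) (z a + (m : RatFn n) * h)
    have h2 : z a + (m : RatFn n) * h + h = z a + ((m + 1 : ℕ) : RatFn n) * h := by push_cast; ring
    rw [h2] at h1
    unfold ySer
    linear_combination (PowerSeries.C h) * h1

theorem siteMat_map_shiftHom (a : Fin n) (m : ℕ) :
    (siteMat N a).map (shiftHom ((m : RatFn n) * h)) = unitMat (ySer a m) (unitSer N a) := by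
  ext1 i j
  rw [Matrix.map_apply, siteMat, Matrix.of_apply, unitMat, Matrix.of_apply, map_add, map_mul,
    shiftHom_C, shiftHom_map, map_mul, shiftHom_C, shiftHom_invSub, Algebra.smul_def,
    algebraMap_series]
  congr 1
  · split_ifs <;> simp

theorem normL_map_shiftHom (ε : PM) (m : ℕ) :
    (normL N n ε).map (shiftHom ((m : RatFn n) * h)) =
      transfer (unitSer N) ySer (siteOrder n ε).reverse m := by
  have h1 : ∀ T : Matrix (Fin N) (Fin N) (EndV N n)⟦X⟧, T.map (shiftHom ((m : RatFn n) * h)) =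
    (shiftHom ((m : RatFn n) * h)).mapMatrix T := fun _ => rfl
  rw [normL, transfer, List.reverse_reverse, h1, map_list_prod, List.map_map]
  congr 2
  funext a
  exact siteMat_map_shiftHom a m

/-- `f ↦ f(u/h)` as a ring homomorphism. -/
def divHHom (N : ℕ) : (Yangian N)⟦X⟧ →+* (YangianH N)⟦X⟧ where
  toFun := divH
  map_zero' := by ext1 s; simp [divH]
  map_add' f g := by ext1 s; simp [divH]
  map_one' := by
    ext1 s
    rw [divH, PowerSeries.coeff_mk, PowerSeries.coeff_one, PowerSeries.coeff_one]
    split_ifs with hs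
    · rw [hs]; rfl
    · simp
  map_mul' f g := by
    ext1 s
    simp only [divH, PowerSeries.coeff_mk, PowerSeries.coeff_mul, map_sum]
    refine Finset.sum_congr rfl fun x hx => ?_
    rw [Polynomial.monomial_mul_monomial, Finset.HasAntidiagonal.mem_antidiagonal.1 hx]

/-- The action of `f(u/h)` for a series `f(u)` over the Yangian. -/
def serAct (N n : ℕ) (ε : PM) : (Yangian N)⟦X⟧ →+* (EndV N n)⟦X⟧ :=
  (PowerSeries.map (phi N n ε)).comp (divHHom N)

theorem phi_monomial (ε : PM) (s : ℕ) (x : Yangian N) :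
    phi N n ε (Polynomial.monomial s x) = (h : RatFn n) ^ s • phiY N n ε x := by
  simp only [phi, Polynomial.eval₂RingHom', RingHom.coe_mk, MonoidHom.coe_mk, OneHom.coe_mk,
    Polynomial.eval₂_monomial]
  rw [← map_pow, ← Algebra.commutes, ← Algebra.smul_def]
  rfl

theorem coeff_serAct (ε : PM) (f : (Yangian N)⟦X⟧) (s : ℕ) :
    PowerSeries.coeff s (serAct N n ε f) =
      (h : RatFn n) ^ s • phiY N n ε (PowerSeries.coeff s f) := by
  change PowerSeries.coeff s (PowerSeries.map (phi N n ε) (divH f)) = _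
  rw [PowerSeries.coeff_map, divH, PowerSeries.coeff_mk, phi_monomial]

/-- Replacing `u` by `u/h` turns the shift by `k` into the shift by `k h`. -/
theorem serAct_shift (ε : PM) (k : ℕ) (f : (Yangian N)⟦X⟧) :
    serAct N n ε (shift k f) = shiftHom ((k : RatFn n) * h) (serAct N n ε f) := by
  ext1 r
  rw [coeff_serAct, coeff_shiftHom, shift, PowerSeries.coeff_mk, map_sum, Finset.smul_sum]
  refine Finset.sum_congr rfl fun s hs => ?_
  have hsr : r = r - s + s := by rw [Finset.mem_range] at hs; omega
  rw [coeff_serAct, map_nsmul, smul_smul, ← Nat.cast_smul_eq_nsmul (RatFn n), smul_smul]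
  congr 1
  push_cast
  rw [mul_pow]
  nth_rewrite 1 [hsr]
  ring

/-- Transports all computations with abstract sites to the action. The list is reversed because
`transfer` puts its first site on the right. -/
theorem serAct_qminor (ε : PM) {p : ℕ} (i j : Fin p → Fin N) :
    serAct N n ε (qminor N i j) = minor (unitSer N) ySer (siteOrder n ε).reverse i j := by
  rw [qminor, map_sum, minor, altProd]
  refine Finset.sum_congr rfl fun σ _ => ?_
  rw [map_zsmul, map_list_prod, List.map_ofFn]
  congr 3
  funext k
  rw [Function.comp_apply, serAct_shift, ← normL_map_shiftHom, Matrix.map_apply]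
  congr 1
  exact phi_T ε _ _

end Identify

/-! ### Exchanging two variables in a rational function -/

section SwapVars

variable {n : ℕ}

theorem swapVars_algebraMap (a b : Fin n) (q : MvPolynomial (Option (Fin n)) ℂ) :
    swapVars a b (algebraMap _ (RatFn n) q) =
      algebraMap _ (RatFn n) (MvPolynomial.rename (Equiv.optionCongr (Equiv.swap a b)) q) :=
  IsFractionRing.ringEquivOfRingEquiv_algebraMap _ _

@[simp]
theorem swapVars_z (a b c : Fin n) : swapVars a b (z c) = z (Equiv.swap a b c) := by
  rw [z, swapVars_algebraMap, MvPolynomial.rename_X]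
  rfl

@[simp]
theorem swapVars_h (a b : Fin n) : swapVars a b h = h := by
  rw [h, swapVars_algebraMap, MvPolynomial.rename_X]
  rfl

theorem swapVars_complex (a b : Fin n) (c : ℂ) :
    swapVars a b (algebraMap ℂ (RatFn n) c) = algebraMap ℂ (RatFn n) c := by
  rw [IsScalarTower.algebraMap_apply ℂ (MvPolynomial (Option (Fin n)) ℂ) (RatFn n),
    swapVars_algebraMap, MvPolynomial.algebraMap_eq, MvPolynomial.rename_C]

theorem swapVars_comm (a b : Fin n) : swapVars a b = swapVars b a := by
  rw [swapVars, swapVars, Equiv.swap_comm]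

theorem z_sub_z_ne_zero {a b : Fin n} (hab : a ≠ b) : z a - z b ≠ 0 := by
  rw [z, z, ← map_sub, Ne, FaithfulSMul.algebraMap_eq_zero_iff, sub_eq_zero]
  intro h1
  exact hab (Option.some_injective _ (MvPolynomial.X_injective h1))

theorem z_sub_z_sub_h_ne_zero (a b : Fin n) : z a - z b - h ≠ 0 := by
  rw [z, z, h, ← map_sub, ← map_sub, Ne, FaithfulSMul.algebraMap_eq_zero_iff]
  intro h1
  have h2 := congrArg (MvPolynomial.aeval fun o : Option (Fin n) => o.elim (1 : ℂ) 0) h1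
  simp at h2

end SwapVars

/-! ### The operators `s̃` for an arbitrary pair of sites, and R-matrix intertwiners -/

section SGen

variable {N n : ℕ}

/-- The operator `f ↦ ((z_a - z_b) P^{(a,b)} - η) / (z_a - z_b - η) · f(z_a ↔ z_b)`. -/
def sGen (η : RatFn n) (a b : Fin n) (f : VFun N n) : VFun N n := fun w =>
  ((z a - z b) * swapVars a b (f (w ∘ Equiv.swap a b)) - η * swapVars a b (f w)) /
    (z a - z b - η)

/-- Changing the sign of the parameter amounts to exchanging the two sites. This reduces the sign
`-` to the reversed order, and lets the argument for `E_p` serve for `F_p`. -/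
theorem sGen_neg (η : RatFn n) (a b : Fin n) (f : VFun N n) :
    sGen (-η) a b f = sGen η b a f := by
  funext w
  rw [sGen, sGen, swapVars_comm b a, Equiv.swap_comm b a, ← neg_div_neg_eq]
  congr 1 <;> ring

theorem sGen_add (η : RatFn n) (a b : Fin n) (f g : VFun N n) :
    sGen η a b (f + g) = sGen η a b f + sGen η a b g := by
  funext w
  simp only [sGen, Pi.add_apply, map_add]
  rw [← add_div]
  congr 1
  ring

theorem sGen_smul (η : RatFn n) (a b : Fin n) (c : RatFn n) (f : VFun N n) :
    sGen η a b (c • f) = swapVars a b c • sGen η a b f := by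
  funext w
  simp only [sGen, Pi.smul_apply, smul_eq_mul, map_mul]
  rw [← mul_div_assoc]
  congr 1
  ring

theorem sGen_zero (η : RatFn n) (a b : Fin n) : sGen η a b (0 : VFun N n) = 0 := by
  funext w
  simp [sGen]

theorem sGen_sum {ι : Type*} (η : RatFn n) (a b : Fin n) (s : Finset ι) (f : ι → VFun N n) :
    sGen η a b (∑ x ∈ s, f x) = ∑ x ∈ s, sGen η a b (f x) := by
  classical
  induction s using Finset.induction_on with
  | empty => simp [sGen_zero]
  | insert x s hx ih => rw [Finset.sum_insert hx, Finset.sum_insert hx, sGen_add, ih]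

theorem sGen_sub (η : RatFn n) (a b : Fin n) (f g : VFun N n) :
    sGen η a b (f - g) = sGen η a b f - sGen η a b g := by
  have h1 := sGen_add η a b (f - g) g
  rw [sub_add_cancel] at h1
  rw [h1, add_sub_cancel_right]

/-- The transposition of two tensor factors. -/
def permOp (N : ℕ) {n : ℕ} (a b : Fin n) : EndV N n where
  toFun f w := f (w ∘ Equiv.swap a b)
  map_add' _ _ := rfl
  map_smul' _ _ := rfl

/-- The operator `(z_a - z_b) P^{(a,b)} - η`. -/
def rOp (N : ℕ) {n : ℕ} (η : RatFn n) (a b : Fin n) : EndV N n :=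
  (z a - z b) • permOp N a b - η • 1

theorem sGen_eq (η : RatFn n) (a b : Fin n) (f : VFun N n) :
    sGen η a b f = (z a - z b - η)⁻¹ • rOp N η a b fun w => swapVars a b (f w) := by
  funext w
  simp only [sGen, rOp, permOp, LinearMap.sub_apply, LinearMap.smul_apply, Pi.smul_apply,
    Pi.sub_apply, Module.End.one_apply, smul_eq_mul, LinearMap.coe_mk, AddHom.coe_mk]
  rw [div_eq_inv_mul]

/-- Conjugation of operators by the exchange of two variables. -/
def conjOp (N : ℕ) {n : ℕ} (a b : Fin n) : EndV N n →+* EndV N n where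
  toFun X :=
    { toFun := fun f w => swapVars a b (X (fun w' => (swapVars a b).symm (f w')) w)
      map_add' := fun f g => by
        funext w
        have : (fun w' => (swapVars a b).symm ((f + g) w')) =
          (fun w' => (swapVars a b).symm (f w')) + fun w' => (swapVars a b).symm (g w') := by
          funext w'; simp
        rw [this, map_add]
        simp
      map_smul' := fun c f => by
        funext w
        have : (fun w' => (swapVars a b).symm ((c • f) w')) =
          (swapVars a b).symm c • fun w' => (swapVars a b).symm (f w') := by
          funext w'; simp
        rw [this, map_smul]
        simp }
  map_zero' := LinearMap.ext fun f => funext fun w => by simp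
  map_add' X Y := LinearMap.ext fun f => funext fun w => by simp
  map_one' := LinearMap.ext fun f => funext fun w => by simp
  map_mul' X Y := LinearMap.ext fun f => funext fun w => by simp

theorem conjOp_apply (a b : Fin n) (X : EndV N n) (f : VFun N n) :
    conjOp N a b X (fun w => swapVars a b (f w)) = fun w => swapVars a b (X f w) := by
  funext w
  simp [conjOp]

theorem conjOp_algebraMap (a b : Fin n) (c : RatFn n) :
    conjOp N a b (algebraMap _ _ c) = algebraMap _ _ (swapVars a b c) := by
  refine LinearMap.ext fun f => funext fun w => ?_
  simp [conjOp, Module.algebraMap_end_apply]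

theorem conjOp_eSite (a b c : Fin n) (i j : Fin N) :
    conjOp N a b (eSite c i j) = eSite c i j := by
  refine LinearMap.ext fun f => funext fun w => ?_
  by_cases hw : w c = i <;> simp [conjOp, eSite, hw]

theorem map_swapVars_invSub (a b : Fin n) (x : RatFn n) :
    PowerSeries.map (swapVars a b : RatFn n →+* RatFn n) (invSub x) = invSub (swapVars a b x) := by
  ext s
  by_cases hs : s = 0 <;> simp [invSub, hs]

/-- The site matrix at the point `x`. -/
def siteAt (N : ℕ) {n : ℕ} (x : RatFn n) (a : Fin n) : Matrix (Fin N) (Fin N) (EndV N n)⟦X⟧ :=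
  unitMat (PowerSeries.C h * invSub x) (unitSer N a)

theorem siteAt_map_conjOp (a b c : Fin n) (x : RatFn n) :
    (siteAt N x c).map (PowerSeries.map (conjOp N a b)) = siteAt N (swapVars a b x) c := by
  ext1 i j
  simp only [Matrix.map_apply, siteAt, unitMat, Matrix.of_apply, Algebra.smul_def,
    algebraMap_series, map_add, map_mul]
  have h1 : ∀ g : (RatFn n)⟦X⟧, PowerSeries.map (conjOp N a b)
      (PowerSeries.map (algebraMap (RatFn n) (EndV N n)) g) =
      PowerSeries.map (algebraMap (RatFn n) (EndV N n))
        (PowerSeries.map (swapVars a b : RatFn n →+* RatFn n) g) := by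
    intro g
    ext1 s
    simp only [PowerSeries.coeff_map, conjOp_algebraMap]
    rfl
  have h2 : PowerSeries.map (swapVars a b : RatFn n →+* RatFn n) (PowerSeries.C h) =
      PowerSeries.C h := by
    rw [PowerSeries.map_C]
    exact congrArg _ (swapVars_h a b)
  have h3 : PowerSeries.map (conjOp N a b) (unitSer N c j i) = unitSer N c j i := by
    rw [unitSer, PowerSeries.map_C, conjOp_eSite]
  rw [h1, h1, h2, map_swapVars_invSub, h3]
  congr 1
  split_ifs <;> simp

section Intertwine

variable {B : Type} [Ring B]

/-- All entries of `M` and `M'` are intertwined by `ρ`. -/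
def Intertwines (ρ : B) (M M' : Matrix (Fin N) (Fin N) B) : Prop :=
  ∀ i j, M i j * ρ = ρ * M' i j

theorem Intertwines.mul {ρ : B} {M M' L L' : Matrix (Fin N) (Fin N) B}
    (h1 : Intertwines ρ M M') (h2 : Intertwines ρ L L') : Intertwines ρ (M * L) (M' * L') := by
  intro i j
  simp only [Matrix.mul_apply, Finset.sum_mul, Finset.mul_sum]
  refine Finset.sum_congr rfl fun k _ => ?_
  rw [mul_assoc, h2, ← mul_assoc, h1, mul_assoc]

theorem intertwines_list {ι : Type} {ρ : B} (M M' : ι → Matrix (Fin N) (Fin N) B) (l : List ι)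
    (H : ∀ c ∈ l, Intertwines ρ (M c) (M' c)) :
    Intertwines ρ (l.map M).prod (l.map M').prod := by
  induction l with
  | nil =>
    intro i j
    simp only [List.map_nil, List.prod_nil, Matrix.one_apply]
    split_ifs <;> simp
  | cons c l ih =>
    rw [List.map_cons, List.prod_cons, List.map_cons, List.prod_cons]
    exact (H c List.mem_cons_self).mul (ih fun d hd => H d (List.mem_cons_of_mem _ hd))

/-- The Yang–Baxter relation for two neighbouring sites. -/
theorem intertwines_pair {R : Type} [CommRing R] [Algebra R B] {d η ya yb : R}
    (hy : d * (ya * yb) = η * (ya - yb)) {P : B} {E F : Fin N → Fin N → B}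
    (hPE : ∀ i j, P * E i j = F i j * P) (hPF : ∀ i j, P * F i j = E i j * P)
    (h1 : ∀ i j, ∑ k, F k i * E j k * P = E j i) (h2 : ∀ i j, ∑ k, E k i * F j k * P = F j i) :
    Intertwines (d • P - η • 1) (unitMat yb F * unitMat ya E) (unitMat ya F * unitMat yb E) := by
  intro i j
  have ent : ∀ (u v : R), (unitMat u F * unitMat v E) i j =
      (if i = j then 1 else 0) + v • E j i + u • F j i + (u * v) • ∑ k, F k i * E j k := by
    intro u v
    simp only [Matrix.mul_apply, unitMat, Matrix.of_apply, add_mul, mul_add,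
      Finset.sum_add_distrib, Finset.smul_sum]
    simp only [ite_mul, one_mul, zero_mul, mul_ite, mul_one, mul_zero, Finset.sum_ite_eq,
      Finset.sum_ite_eq', Finset.mem_univ, if_true, smul_mul_smul_comm]
    abel
  rw [ent, ent]
  have hP1 : P * (if i = j then 1 else 0) = (if i = j then 1 else 0) * P := by
    split_ifs <;> simp
  have hP2 : P * ∑ k, F k i * E j k = F j i := by
    rw [← h2, Finset.mul_sum]
    refine Finset.sum_congr rfl fun k _ => ?_
    rw [← mul_assoc, hPF, mul_assoc, hPE, mul_assoc]
  have hP3 : (∑ k, F k i * E j k) * P = E j i := by rw [Finset.sum_mul, h1]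
  simp only [mul_sub, sub_mul, add_mul, mul_add, smul_mul_assoc, mul_smul_comm, mul_one, one_mul,
    hP1, hP2, hP3, hPE, hPF, smul_smul, smul_add]
  -- The terms linear in `P` cancel by `hPE` and `hPF`; what survives is `E j i - F j i` with two
  -- scalar coefficients that `hy` identifies.
  have key : (d * (ya * yb)) • E j i - (d * (ya * yb)) • F j i =
      (η * (ya - yb)) • E j i - (η * (ya - yb)) • F j i := by rw [hy]
  rw [← sub_eq_zero] at key ⊢
  rw [← key]
  module

end Intertwine

end SGen

/-! ### The Yangian action commutes with `s̃` -/

section Covariance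

variable {N n : ℕ}

theorem permOp_eSite (a b c : Fin n) (i j : Fin N) :
    permOp N a b * eSite c i j = eSite (Equiv.swap a b c) i j * permOp N a b := by
  refine LinearMap.ext fun f => funext fun w => ?_
  change (if w (Equiv.swap a b c) = i then f (Function.update (w ∘ Equiv.swap a b) c j) else 0) =
    if w (Equiv.swap a b c) = i then
      f (Function.update w (Equiv.swap a b c) j ∘ Equiv.swap a b) else 0
  have : Function.update w (Equiv.swap a b c) j ∘ Equiv.swap a b =
      Function.update (w ∘ Equiv.swap a b) c j :=
    Function.update_comp_eq_of_injective _ (Equiv.swap a b).injective _ _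
  rw [this]

theorem permOp_comm (a b : Fin n) : permOp N a b = permOp N b a := by
  refine LinearMap.ext fun f => funext fun w => ?_
  change f (w ∘ Equiv.swap a b) = f (w ∘ Equiv.swap b a)
  rw [Equiv.swap_comm]

/-- Entries of the identity `P^{(0,b)} P^{(0,a)} P^{(a,b)} = P^{(0,a)}`. -/
theorem sum_eSite_mul_permOp {a b : Fin n} (hab : a ≠ b) (i j : Fin N) :
    ∑ k, eSite b k i * eSite a j k * permOp N a b = (eSite a j i : EndV N n) := by
  refine LinearMap.ext fun f => funext fun w => ?_
  rw [LinearMap.sum_apply, Finset.sum_apply]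
  have h1 : ∀ k, (eSite b k i * eSite a j k * permOp N a b : EndV N n) f w =
      if w b = k then (if w a = j then f (Function.update w a i) else 0) else 0 := by
    intro k
    change (if w b = k then (if Function.update w b i a = j then
      f (Function.update (Function.update w b i) a k ∘ Equiv.swap a b) else 0) else 0) = _
    rw [Function.update_of_ne hab]
    split_ifs with h1 h2
    · congr 1
      funext c
      rcases eq_or_ne c a with rfl | hca
      · simp [Function.update_of_ne hab.symm]
      · rcases eq_or_ne c b with rfl | hcb
        · simp [Function.update_of_ne hab.symm, h1]
        · simp [Equiv.swap_apply_of_ne_of_ne hca hcb, hca, hcb]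
    · rfl
    · rfl
  simp only [h1]
  rw [Finset.sum_ite_eq]
  simp [eSite]

/-- The sites `a` and `b` are consecutive, `a` before `b`, in the order `e`. -/
def Adj (e : Fin n ≃ Fin n) (a b : Fin n) : Prop :=
  ∃ (k : ℕ) (hk : k + 1 < n), a = e ⟨k, Nat.lt_of_succ_lt hk⟩ ∧ b = e ⟨k + 1, hk⟩

theorem Adj.ne {e : Fin n ≃ Fin n} {a b : Fin n} (H : Adj e a b) : a ≠ b := by
  obtain ⟨k, hk, rfl, rfl⟩ := H
  intro h1
  have := e.injective h1
  simp at this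

/-- The order of the sites: increasing for `+`, decreasing for `-`. -/
def siteEquiv (n : ℕ) : PM → (Fin n ≃ Fin n)
  | .plus => Equiv.refl _
  | .minus => Fin.revPerm

theorem siteOrder_reverse (ε : PM) :
    (siteOrder n ε).reverse = (List.finRange n).map (siteEquiv n ε) := by
  cases ε
  · simp [siteOrder, siteEquiv]
  · simp [siteOrder, siteEquiv, List.finRange_reverse, Fin.revPerm]

theorem finRange_split {k : ℕ} (hk : k + 1 < n) : ∃ l1 l2 : List (Fin n),
    List.finRange n = l1 ++ ⟨k, Nat.lt_of_succ_lt hk⟩ :: ⟨k + 1, hk⟩ :: l2 := by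
  refine ⟨(List.finRange n).take k, (List.finRange n).drop (k + 2), ?_⟩
  conv_lhs => rw [← List.take_append_drop k (List.finRange n)]
  rw [List.drop_eq_getElem_cons (by simp; omega), List.drop_eq_getElem_cons (by simp; omega)]
  simp

theorem Adj.split {ε : PM} {a b : Fin n} (H : Adj (siteEquiv n ε) a b) :
    ∃ l1 l2 : List (Fin n), siteOrder n ε = l1 ++ b :: a :: l2 := by
  obtain ⟨k, hk, rfl, rfl⟩ := H
  obtain ⟨l1, l2, h1⟩ := finRange_split hk
  have h2 := congrArg List.reverse (siteOrder_reverse (n := n) ε)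
  rw [List.reverse_reverse, h1] at h2
  exact ⟨(l2.map (siteEquiv n ε)).reverse, (l1.map (siteEquiv n ε)).reverse, by rw [h2]; simp⟩

theorem intertwines_siteAt {a b c : Fin n} (hca : c ≠ a) (hcb : c ≠ b) (η x : RatFn n) :
    Intertwines (PowerSeries.C (rOp N η a b)) (siteAt N x c) (siteAt N x c) := by
  intro i j
  have h1 : Commute (rOp N η a b) (eSite c j i) := by
    unfold rOp
    refine Commute.sub_left (Commute.smul_left ?_ _) (Commute.smul_left (Commute.one_left _) _)
    have := permOp_eSite a b c j i
    rwa [Equiv.swap_apply_of_ne_of_ne hca hcb] at this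
  have h2 : Commute (PowerSeries.C (rOp N η a b)) (siteAt N x c i j) := by
    rw [siteAt, unitMat, Matrix.of_apply]
    refine Commute.add_right ?_ (Commute.smul_right (h1.map PowerSeries.C) _)
    split_ifs
    · exact Commute.one_right _
    · exact Commute.zero_right _
  exact h2.eq.symm

theorem intertwines_siteAt_pair {a b : Fin n} (hab : a ≠ b) :
    Intertwines (PowerSeries.C (rOp N h a b)) (siteAt N (z b) b * siteAt N (z a) a)
      (siteAt N (z a) b * siteAt N (z b) a) := by
  have hr : PowerSeries.C (rOp N h a b) =
      (PowerSeries.C (z a - z b) : (RatFn n)⟦X⟧) • PowerSeries.C (permOp N a b) -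
        (PowerSeries.C (h : RatFn n)) • (1 : (EndV N n)⟦X⟧) := by
    simp only [rOp, Algebra.smul_def, algebraMap_series, PowerSeries.map_C, mul_one, map_sub,
      map_mul]
  rw [hr]
  refine intertwines_pair ?_ ?_ ?_ ?_ ?_
  · have h1 := invSub_sub (z a - z b) (z b)
    rw [add_sub_cancel] at h1
    linear_combination (-(PowerSeries.C h) ^ 2) * h1
  · intro i j
    rw [unitSer, unitSer, ← map_mul, ← map_mul, permOp_eSite, Equiv.swap_apply_left]
  · intro i j
    rw [unitSer, unitSer, ← map_mul, ← map_mul, permOp_eSite, Equiv.swap_apply_right]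
  · intro i j
    simp only [unitSer, ← map_mul, ← map_sum]
    rw [sum_eSite_mul_permOp hab]
  · intro i j
    simp only [unitSer, ← map_mul, ← map_sum]
    have := sum_eSite_mul_permOp (N := N) hab.symm i j
    rw [permOp_comm] at this
    rw [this]

theorem normL_eq_siteAt (ε : PM) :
    normL N n ε = ((siteOrder n ε).map fun c => siteAt N (z c) c).prod := by
  rw [normL]
  congr 2

/-- Only the two neighbouring factors of `a` and `b` fail to commute with the R-matrix, and they are
handled by the Yang–Baxter relation. Conjugation by the exchange of variables interchanges `z_a` and
`z_b` in them. -/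
theorem intertwines_normL {ε : PM} {a b : Fin n} (H : Adj (siteEquiv n ε) a b) :
    Intertwines (PowerSeries.C (rOp N h a b)) (normL N n ε)
      ((normL N n ε).map (PowerSeries.map (conjOp N a b))) := by
  have hab := H.ne
  obtain ⟨l1, l2, hl⟩ := H.split
  have hnd := siteOrder_nodup (n := n) ε
  have h1 : (normL N n ε).map (PowerSeries.map (conjOp N a b)) =
      ((siteOrder n ε).map fun c => siteAt N (z (Equiv.swap a b c)) c).prod := by
    have h2 : ∀ T : Matrix (Fin N) (Fin N) (EndV N n)⟦X⟧,
      T.map (PowerSeries.map (conjOp N a b)) =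
      (PowerSeries.map (conjOp N a b)).mapMatrix T := fun _ => rfl
    rw [normL_eq_siteAt, h2, map_list_prod, List.map_map]
    congr 2
    funext c
    rw [Function.comp_apply, ← h2, siteAt_map_conjOp, swapVars_z]
  rw [h1, normL_eq_siteAt, hl]
  rw [hl, List.nodup_append] at hnd
  obtain ⟨-, hnd2, hdis⟩ := hnd
  rw [List.nodup_cons, List.nodup_cons, List.mem_cons, not_or] at hnd2
  have hgen : ∀ c, c ≠ a → c ≠ b → Intertwines (PowerSeries.C (rOp N h a b))
      (siteAt N (z c) c) (siteAt N (z (Equiv.swap a b c)) c) := by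
    intro c hca hcb
    rw [Equiv.swap_apply_of_ne_of_ne hca hcb]
    exact intertwines_siteAt hca hcb _ _
  simp only [List.map_append, List.prod_append, List.map_cons, List.prod_cons]
  refine Intertwines.mul (intertwines_list _ _ _ fun c hc => hgen c ?_ ?_) ?_
  · rintro rfl
    exact hdis _ hc _ (List.mem_cons_of_mem _ List.mem_cons_self) rfl
  · rintro rfl
    exact hdis _ hc _ List.mem_cons_self rfl
  rw [← mul_assoc, ← mul_assoc, Equiv.swap_apply_left, Equiv.swap_apply_right]
  refine Intertwines.mul (intertwines_siteAt_pair hab)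
    (intertwines_list _ _ _ fun c hc => hgen c ?_ ?_)
  · rintro rfl
    exact hnd2.2.1 hc
  · rintro rfl
    exact hnd2.1.2 hc

theorem normL_sGen {ε : PM} {a b : Fin n} (H : Adj (siteEquiv n ε) a b) (i j : Fin N) (s : ℕ)
    (f : VFun N n) :
    PowerSeries.coeff s (normL N n ε i j) (sGen h a b f) =
      sGen h a b (PowerSeries.coeff s (normL N n ε i j) f) := by
  have h1 := congrArg (PowerSeries.coeff s) (intertwines_normL (N := N) H i j)
  rw [PowerSeries.coeff_mul_C, PowerSeries.coeff_C_mul, Matrix.map_apply,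
    PowerSeries.coeff_map] at h1
  rw [sGen_eq, sGen_eq, map_smul, ← conjOp_apply, ← Module.End.mul_apply, h1,
    Module.End.mul_apply]

/-- `s̃` is only semilinear, but complex scalars and powers of `h` are fixed by the exchange of
variables, so commutation passes from the coefficients of `L` to all of the Yangian. -/
theorem phiY_sGen {ε : PM} {a b : Fin n} (H : Adj (siteEquiv n ε) a b) (x : Yangian N)
    (f : VFun N n) : phiY N n ε x (sGen h a b f) = sGen h a b (phiY N n ε x f) := by
  obtain ⟨q, rfl⟩ := RingQuot.mkAlgHom_surjective ℂ (YangianRel N) x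
  have h0 : ∀ q, phiY N n ε (RingQuot.mkAlgHom ℂ (YangianRel N) q) = phiFree N n ε q :=
    fun q => by rw [phiY, RingQuot.liftAlgHom_mkAlgHom_apply]
  rw [h0]
  induction q using FreeAlgebra.induction generalizing f with
  | grade0 c =>
    rw [AlgHom.commutes, IsScalarTower.algebraMap_apply ℂ (RatFn n) (EndV N n),
      Module.algebraMap_end_apply, Module.algebraMap_end_apply, sGen_smul, swapVars_complex]
  | grade1 t =>
    have h1 : phiFree N n ε (FreeAlgebra.ι ℂ t) =
        ((h : RatFn n)⁻¹ ^ (t.2.2 + 1)) •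
          PowerSeries.coeff (t.2.2 + 1) (normL N n ε t.1 t.2.1) := by simp [phiFree]
    rw [h1, LinearMap.smul_apply, LinearMap.smul_apply, normL_sGen H, sGen_smul, map_pow, map_inv₀,
      swapVars_h]
  | mul p q hp hq =>
    rw [map_mul, Module.End.mul_apply, hq f, hp, Module.End.mul_apply]
  | add p q hp hq =>
    rw [map_add, LinearMap.add_apply, LinearMap.add_apply, hp, hq, sGen_add]

/-- The action of the Yangian commutes with the operators `s̃_i`. -/
theorem phi_sGen {ε : PM} {a b : Fin n} (H : Adj (siteEquiv n ε) a b) (x : YangianH N)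
    (f : VFun N n) : phi N n ε x (sGen h a b f) = sGen h a b (phi N n ε x f) := by
  induction x using Polynomial.induction_on' generalizing f with
  | add p q hp hq =>
    rw [map_add, LinearMap.add_apply, LinearMap.add_apply, hp, hq, sGen_add]
  | monomial s y =>
    rw [phi_monomial, LinearMap.smul_apply, LinearMap.smul_apply, phiY_sGen H, sGen_smul, map_pow,
      swapVars_h]

end Covariance

/-! ### Families `ξ` for an order of the sites, and sums over one changed letter -/

section Families

variable {N n : ℕ}

/-- The defining properties of the vectors `ξ_I` for the order `e` of the sites. -/
structure IsXiFor (e : Fin n ≃ Fin n) (ξ : Word N n → VFun N n) : Prop where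
  extremal : ∀ I : Word N n, Monotone (I ∘ e) → ξ I = basisVec I
  swap : ∀ a b, Adj e a b → ∀ I : Word N n, ξ (I ∘ Equiv.swap a b) = sGen h a b (ξ I)

theorem sTilde_plus (i : ℕ) (hi : i + 1 < n) (f : VFun N n) :
    sTilde .plus i hi f = sGen h ⟨i, Nat.lt_of_succ_lt hi⟩ ⟨i + 1, hi⟩ f := by
  funext w
  simp only [sTilde, sGen, PM.sgn, one_mul]

theorem sTilde_minus (i : ℕ) (hi : i + 1 < n) (f : VFun N n) :
    sTilde .minus i hi f = sGen h ⟨i + 1, hi⟩ ⟨i, Nat.lt_of_succ_lt hi⟩ f := by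
  rw [← sGen_neg]
  funext w
  simp only [sTilde, sGen, PM.sgn, neg_mul, one_mul]

theorem adj_rev (i : ℕ) (hi : i + 1 < n) :
    Adj (Fin.revPerm (n := n)) ⟨i + 1, hi⟩ ⟨i, Nat.lt_of_succ_lt hi⟩ := by
  refine ⟨n - (i + 2), by omega, ?_, ?_⟩ <;>
  · apply Fin.ext
    simp only [Fin.revPerm_apply, Fin.val_rev]
    omega

theorem Adj.exists_of_rev {a b : Fin n} (H : Adj (Fin.revPerm (n := n)) a b) :
    ∃ (i : ℕ) (hi : i + 1 < n), a = ⟨i + 1, hi⟩ ∧ b = ⟨i, Nat.lt_of_succ_lt hi⟩ := by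
  obtain ⟨k, hk, rfl, rfl⟩ := H
  refine ⟨n - (k + 2), by omega, Fin.ext ?_, Fin.ext ?_⟩
  · simp only [Fin.revPerm_apply, Fin.val_rev]
    omega
  · simp only [Fin.revPerm_apply, Fin.val_rev]

/-- For the sign `-` the sites are read backwards: weakly decreasing words become sorted, and
`sGen_neg` absorbs the sign of `h`. From here on both signs are treated at once. -/
theorem isXi_iff (ε : PM) (ξ : Word N n → VFun N n) :
    IsXi ε ξ ↔ IsXiFor (siteEquiv n ε) ξ := by
  cases ε
  · constructor
    · intro H
      refine ⟨fun I hI => H.extremal I hI, ?_⟩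
      rintro a b ⟨k, hk, rfl, rfl⟩ I
      exact (H.swap k hk I).trans (sTilde_plus k hk _)
    · intro H
      exact ⟨fun I hI => H.extremal I hI, fun i hi I =>
        (H.swap _ _ ⟨i, hi, rfl, rfl⟩ I).trans (sTilde_plus i hi _).symm⟩
  · constructor
    · intro H
      refine ⟨fun I hI => H.extremal I fun i j hij => ?_, ?_⟩
      · have := hI (Fin.rev_le_rev.2 hij)
        simpa [siteEquiv] using this
      · intro a b hab I
        obtain ⟨i, hi, rfl, rfl⟩ := hab.exists_of_rev
        rw [← sTilde_minus, ← H.swap i hi, Equiv.swap_comm]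
    · intro H
      refine ⟨fun I hI => H.extremal I fun i j hij => hI (Fin.rev_le_rev.2 hij), fun i hi I => ?_⟩
      rw [sTilde_minus, Equiv.swap_comm]
      exact H.swap _ _ (adj_rev i hi) I

/-- Every word is obtained from a sorted one by transpositions of consecutive sites. -/
theorem word_induction (e : Fin n ≃ Fin n) {motive : Word N n → Prop}
    (base : ∀ I : Word N n, Monotone (I ∘ e) → motive I)
    (step : ∀ a b (I : Word N n), Adj e a b → motive I → motive (I ∘ Equiv.swap a b))
    (I : Word N n) : motive I := by
  rcases n with _ | n
  · exact base I fun i => i.elim0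
  have key : ∀ τ : Equiv.Perm (Fin (n + 1)), ∀ J : Word N (n + 1), motive J →
      motive (J ∘ (e.symm.trans (τ.trans e))) := by
    intro τ
    -- Adjacent transpositions generate the symmetric group as a monoid; conjugating by `e` turns
    -- them into transpositions of consecutive sites.
    have hτ : τ ∈ Submonoid.closure (Set.range fun i : Fin n =>
        Equiv.swap i.castSucc i.succ) := by
      rw [Equiv.Perm.mclosure_swap_castSucc_succ]
      trivial
    induction hτ using Submonoid.closure_induction with
    | mem x hx =>
      obtain ⟨i, rfl⟩ := hx
      intro J hJ
      simp only
      rw [← Equiv.trans_assoc, Equiv.symm_trans_swap_trans]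
      exact step _ _ J ⟨i, by omega, rfl, rfl⟩ hJ
    | one =>
      intro J hJ
      have : e.symm.trans (Equiv.trans (1 : Equiv.Perm (Fin (n + 1))) e) = Equiv.refl _ := by
        ext x; simp
      rw [this]
      exact hJ
    | mul x y _ _ hx hy =>
      intro J hJ
      have h1 := hy _ (hx J hJ)
      have : (J ∘ (e.symm.trans (x.trans e))) ∘ (e.symm.trans (y.trans e)) =
          J ∘ (e.symm.trans (Equiv.trans (x * y) e)) := by
        funext k; simp
      rwa [this] at h1
  have h1 := key (Tuple.sort (I ∘ e))⁻¹ ((I ∘ e) ∘ Tuple.sort (I ∘ e) ∘ e.symm) (base _ (by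
    have := Tuple.monotone_sort (I ∘ e)
    intro i j hij
    simpa using this hij))
  convert h1 using 1
  funext k
  simp

theorem comp_swap_of_eq {I : Word N n} {a b : Fin n} (hI : I a = I b) :
    I ∘ Equiv.swap a b = I := by
  funext k
  rcases eq_or_ne k a with rfl | ha
  · simp [hI]
  · rcases eq_or_ne k b with rfl | hb
    · simp [hI]
    · simp [Equiv.swap_apply_of_ne_of_ne ha hb]

theorem update_comp_swap (I : Word N n) (a b i : Fin n) (d : Fin N) :
    Function.update I i d ∘ Equiv.swap a b =
      Function.update (I ∘ Equiv.swap a b) (Equiv.swap a b i) d := by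
  have h1 := Function.update_comp_eq_of_injective I (Equiv.swap a b).injective
    (Equiv.swap a b i) d
  rwa [Equiv.swap_apply_self] at h1

/-- `∑_i c_i ξ_{I'} ∏_k (z_i - z_k + η) / (z_i - z_k)`, the sum over the sites `i` with letter `p`
in `I`, the product over the other such sites, `I'` obtained by changing the letter of `i` to
`d`. -/
def moveSum (c : Fin n → RatFn n) (η : RatFn n) (p d : Fin N) (ξ : Word N n → VFun N n)
    (I : Word N n) : VFun N n :=
  ∑ i : Fin n with I i = p,
    (c i * ∏ k : Fin n with I k = p ∧ k ≠ i, (z i - z k + η) / (z i - z k)) •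
      ξ (Function.update I i d)

/-- With `c' = c` this says that the claimed formulas propagate along `s̃`, so that they need
checking on sorted words only. -/
theorem sGen_moveSum {c c' : Fin n → RatFn n} {η η' : RatFn n} {a b : Fin n}
    {ξ : Word N n → VFun N n}
    (hswap : ∀ I : Word N n, ξ (I ∘ Equiv.swap a b) = sGen η' a b (ξ I))
    (hη : swapVars a b η = η) (hc : ∀ i, swapVars a b (c i) = c' (Equiv.swap a b i))
    (p d : Fin N) (I : Word N n) :
    sGen η' a b (moveSum c η p d ξ I) = moveSum c' η p d ξ (I ∘ Equiv.swap a b) := by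
  rw [moveSum, moveSum, sGen_sum]
  refine Finset.sum_equiv (Equiv.swap a b) (by simp) fun i _ => ?_
  rw [sGen_smul, ← hswap, update_comp_swap, map_mul, hc, map_prod]
  congr 2
  refine Finset.prod_equiv (Equiv.swap a b) (by simp) fun k _ => ?_
  simp [hη]

/-- A vector which is invariant under the transpositions of the sites with the letter `p` and is
supported on the words obtained from `I` by changing one letter `p` to `d` is determined by one
of its coordinates. -/
theorem eq_moveSum {e : Fin n ≃ Fin n} {η : RatFn n} {ξ : Word N n → VFun N n}
    (hswap : ∀ a b, Adj e a b → ∀ I : Word N n, ξ (I ∘ Equiv.swap a b) = sGen η a b (ξ I))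
    (hη : ∀ a b, swapVars a b η = η) (hne : ∀ a b, z a - z b - η ≠ 0)
    {I : Word N n} {p d : Fin N} (hdp : d ≠ p)
    (hconv : ∀ j k l, j ≤ k → k ≤ l → I (e j) = p → I (e l) = p → I (e k) = p)
    {q t : Fin n} (hq : I (e q) = p) (ht : I (e t) = p)
    (hqt : ∀ k, I (e k) = p → q ≤ k ∧ k ≤ t)
    (hbase : ξ (Function.update I (e q) d) = basisVec (Function.update I (e q) d))
    {G : VFun N n}
    (hGinv : ∀ a b, Adj e a b → I a = p → I b = p → sGen η a b G = G)
    (hGsupp : ∀ w, G w ≠ 0 → ∃ m, I m = p ∧ w = Function.update I m d)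
    {c : Fin n → RatFn n}
    (hc : ∀ a b, Adj e a b → I a = p → I b = p →
      ∀ i, swapVars a b (c i) = c (Equiv.swap a b i))
    (hval : G (Function.update I (e t) d) = c (e t)) : G = moveSum c η p d ξ I := by
  have hJinj : ∀ {i j : Fin n}, I i = p → Function.update I i d = Function.update I j d →
      i = j := by
    intro i j hi hij
    by_contra hne'
    have h1 := congrFun hij i
    rw [Function.update_self, Function.update_of_ne hne', hi] at h1
    exact hdp h1
  have hJswap : ∀ {a b : Fin n}, I a = p → I b = p →
      Function.update I a d ∘ Equiv.swap a b = Function.update I b d := by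
    intro a b ha hb
    rw [update_comp_swap, Equiv.swap_apply_left, comp_swap_of_eq (ha.trans hb.symm)]
  -- Start from the basis vector with `d` at the first site `q` and push `d` to the right by `s̃`.
  -- The result is triangular: `d` sits at the position `k` or earlier, and each step multiplies the
  -- diagonal coefficient by `(z_a - z_b) / (z_a - z_b - η)`, with variables exchanged accordingly
  -- in the earlier factors.
  have chain : ∀ k : ℕ, (q : ℕ) ≤ k → ∀ hk : k < n, I (e ⟨k, hk⟩) = p →
      (∀ w, ξ (Function.update I (e ⟨k, hk⟩) d) w ≠ 0 →
        ∃ r, r ≤ ⟨k, hk⟩ ∧ I (e r) = p ∧ w = Function.update I (e r) d) ∧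
      ξ (Function.update I (e ⟨k, hk⟩) d) (Function.update I (e ⟨k, hk⟩) d) =
        ∏ r : Fin n with I (e r) = p ∧ r < ⟨k, hk⟩,
          (z (e r) - z (e ⟨k, hk⟩)) / (z (e r) - z (e ⟨k, hk⟩) - η) := by
    intro k hqk
    induction k, hqk using Nat.le_induction with
    | base =>
      intro hk hIk
      have hqe : (⟨q, hk⟩ : Fin n) = q := rfl
      rw [hqe, hbase]
      constructor
      · intro w hw
        refine ⟨q, le_rfl, hq, ?_⟩
        by_contra hne'
        exact hw (by rw [basisVec, Pi.single_eq_of_ne hne'])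
      · rw [basisVec, Pi.single_eq_same, Finset.filter_false_of_mem, Finset.prod_empty]
        rintro r - ⟨h1, h2⟩
        exact absurd h2 (hqt r h1).1.not_gt
    | succ k hqk ih =>
      intro hk hIk
      have hk' : k < n := Nat.lt_of_succ_lt hk
      set a : Fin n := ⟨k, hk'⟩ with ha
      set b : Fin n := ⟨k + 1, hk⟩ with hb
      have hab : a < b := Nat.lt_succ_self k
      have hIa : I (e a) = p := hconv q a b hqk hab.le hq hIk
      obtain ⟨ih1, ih2⟩ := ih hk' hIa
      have hadj : Adj e (e a) (e b) := ⟨k, hk, rfl, rfl⟩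
      have hs := hswap _ _ hadj (Function.update I (e a) d)
      rw [hJswap hIa hIk] at hs
      have hzero : ξ (Function.update I (e a) d) (Function.update I (e b) d) = 0 := by
        by_contra hne'
        obtain ⟨r, hr, hIr, h1⟩ := ih1 _ hne'
        have := e.injective (hJinj hIk h1)
        exact absurd hr (this ▸ hab.not_ge)
      rw [hs]
      constructor
      · intro w hw
        have h2 : ξ (Function.update I (e a) d) (w ∘ Equiv.swap (e a) (e b)) ≠ 0 ∨
            ξ (Function.update I (e a) d) w ≠ 0 := by
          by_contra hcon
          push Not at hcon
          exact hw (by simp [sGen, hcon.1, hcon.2])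
        rcases h2 with h2 | h2
        · obtain ⟨r, hr, hIr, h1⟩ := ih1 _ h2
          have h3 : w = Function.update I (e r) d ∘ Equiv.swap (e a) (e b) := by
            rw [← h1]
            funext x
            simp
          rw [update_comp_swap, comp_swap_of_eq (hIa.trans hIk.symm)] at h3
          rcases hr.eq_or_lt with rfl | hr
          · rw [Equiv.swap_apply_left] at h3
            exact ⟨b, le_rfl, hIk, h3⟩
          · rw [Equiv.swap_apply_of_ne_of_ne (fun h => hr.ne (e.injective h))
              (fun h => (hr.trans hab).ne (e.injective h))] at h3
            exact ⟨r, (hr.trans hab).le, hIr, h3⟩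
        · obtain ⟨r, hr, hIr, h1⟩ := ih1 _ h2
          exact ⟨r, hr.trans hab.le, hIr, h1⟩
      · have h4 : Function.update I (e b) d ∘ Equiv.swap (e a) (e b) =
            Function.update I (e a) d := by
          rw [Equiv.swap_comm, hJswap hIk hIa]
        have hfil : (Finset.univ.filter fun r : Fin n => I (e r) = p ∧ r < b) =
            insert a (Finset.univ.filter fun r : Fin n => I (e r) = p ∧ r < a) := by
          ext r
          simp only [Finset.mem_filter, Finset.mem_univ, true_and, Finset.mem_insert]
          constructor
          · rintro ⟨h5, h6⟩
            rcases (Nat.lt_succ_iff.1 h6 : (r : ℕ) ≤ k).eq_or_lt with h7 | h7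
            · exact Or.inl (Fin.ext h7)
            · exact Or.inr ⟨h5, h7⟩
          · rintro (rfl | ⟨h5, h6⟩)
            · exact ⟨hIa, hab⟩
            · exact ⟨h5, h6.trans hab⟩
        rw [sGen, h4, hzero, ih2, hfil, Finset.prod_insert (by simp), map_zero, mul_zero, sub_zero,
          map_prod, mul_div_right_comm]
        congr 1
        refine Finset.prod_congr rfl fun r hr => ?_
        rw [Finset.mem_filter] at hr
        have h8 : r < a := hr.2.2
        simp only [map_div₀, map_sub, swapVars_z, hη, ← ha, Equiv.swap_apply_left]
        rw [Equiv.swap_apply_of_ne_of_ne (fun h => h8.ne (e.injective h))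
              (fun h => (h8.trans hab).ne (e.injective h))]
  have chain1 : ∀ i w, I i = p → ξ (Function.update I i d) w ≠ 0 →
      ∃ r, r ≤ e.symm i ∧ I (e r) = p ∧ w = Function.update I (e r) d := by
    intro i w hi hw
    have hi' : I (e (e.symm i)) = p := by rwa [e.apply_symm_apply]
    have h1 := (chain (e.symm i) (hqt _ hi').1 (e.symm i).2 hi').1 w
    rw [Fin.eta, e.apply_symm_apply] at h1
    exact h1 hw
  set M := moveSum c η p d ξ I with hM
  -- By triangularity only the term `i = e t` reaches the word with `d` at the last site `t`, and
  -- its product of fractions is inverse to the diagonal coefficient from `chain`.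
  have hMval : M (Function.update I (e t) d) = c (e t) := by
    rw [hM, moveSum, Finset.sum_apply, Finset.sum_eq_single (e t)]
    · rw [Pi.smul_apply, smul_eq_mul, (chain t (hqt t ht).1 t.2 ht).2, mul_assoc]
      have hre : ∏ k : Fin n with I k = p ∧ k ≠ e t, (z (e t) - z k + η) / (z (e t) - z k) =
          ∏ r : Fin n with I (e r) = p ∧ r < t,
            (z (e t) - z (e r) + η) / (z (e t) - z (e r)) := by
        symm
        refine Finset.prod_equiv e (fun r => ?_) fun _ _ => rfl
        simp only [Finset.mem_filter, Finset.mem_univ, true_and, ne_eq, e.injective.eq_iff]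
        constructor
        · rintro ⟨h1, h2⟩
          exact ⟨h1, h2.ne⟩
        · rintro ⟨h1, h2⟩
          exact ⟨h1, lt_of_le_of_ne (hqt r h1).2 h2⟩
      rw [hre, Fin.eta, ← Finset.prod_mul_distrib, Finset.prod_eq_one, mul_one]
      intro r hr
      rw [Finset.mem_filter] at hr
      have h1 : z (e r) - z (e t) ≠ 0 := z_sub_z_ne_zero fun h => hr.2.2.ne (e.injective h)
      have h2 := hne (e r) (e t)
      have h3 : z (e t) - z (e r) ≠ 0 := z_sub_z_ne_zero fun h => hr.2.2.ne' (e.injective h)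
      rw [div_mul_div_comm, div_eq_one_iff_eq (mul_ne_zero h3 h2)]
      ring
    · intro i hi hit
      rw [Finset.mem_filter] at hi
      rw [Pi.smul_apply, smul_eq_mul]
      by_cases hz : ξ (Function.update I i d) (Function.update I (e t) d) = 0
      · rw [hz, mul_zero]
      · obtain ⟨r, hr, hIr, h1⟩ := chain1 i _ hi.2 hz
        have h2 := e.injective (hJinj ht h1)
        have h3 := (hqt (e.symm i) (by rw [e.apply_symm_apply]; exact hi.2)).2
        have h4 : e.symm i = t := le_antisymm h3 (h2 ▸ hr)
        exact absurd (by rw [← h4, e.apply_symm_apply]) hit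
    · intro hnot
      simp [ht] at hnot
  have hDsupp : ∀ w, (G - M) w ≠ 0 → ∃ m, I m = p ∧ w = Function.update I m d := by
    intro w hw
    by_cases hG : G w = 0
    · have hMw : M w ≠ 0 := by
        intro h0
        exact hw (by rw [Pi.sub_apply, hG, h0, sub_zero])
      rw [hM, moveSum, Finset.sum_apply] at hMw
      obtain ⟨i, hi, hiw⟩ := Finset.exists_ne_zero_of_sum_ne_zero hMw
      rw [Finset.mem_filter] at hi
      rw [Pi.smul_apply, smul_eq_mul] at hiw
      obtain ⟨r, -, hIr, h1⟩ := chain1 i w hi.2 (right_ne_zero_of_mul hiw)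
      exact ⟨e r, hIr, h1⟩
    · exact hGsupp w hG
  have hDinv : ∀ a b, Adj e a b → I a = p → I b = p → sGen η a b (G - M) = G - M := by
    intro a b hab ha hb
    rw [sGen_sub, hGinv a b hab ha hb, hM,
      sGen_moveSum (hswap a b hab) (hη a b) (hc a b hab ha hb), comp_swap_of_eq (ha.trans hb.symm)]
  have hDt : (G - M) (Function.update I (e t) d) = 0 := by
    rw [Pi.sub_apply, hval, hMval, sub_self]
  -- Downward induction from `t`: the invariance of `G - M`, read at the word with `d` at position
  -- `k + 1`, expresses a vanishing coordinate as a nonzero multiple of the exchanged coordinate at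
  -- `k`.
  have hD : ∀ j k : ℕ, ∀ hk : k < n, k + j = t → I (e ⟨k, hk⟩) = p →
      (G - M) (Function.update I (e ⟨k, hk⟩) d) = 0 := by
    intro j
    induction j with
    | zero =>
      intro k hk hkt hIk
      have : (⟨k, hk⟩ : Fin n) = t := Fin.ext hkt
      rw [this]
      exact hDt
    | succ j ih =>
      intro k hk hkt hIk
      have hk1 : k + 1 < n := by omega
      have hIb : I (e ⟨k + 1, hk1⟩) = p :=
        hconv ⟨k, hk⟩ _ t (Nat.le_succ k) (by rw [Fin.le_def]; simp only; omega) hIk ht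
      have h1 := ih (k + 1) hk1 (by omega) hIb
      have hadj : Adj e (e ⟨k, hk⟩) (e ⟨k + 1, hk1⟩) := ⟨k, hk1, rfl, rfl⟩
      have h2 := congrFun (hDinv _ _ hadj hIk hIb) (Function.update I (e ⟨k + 1, hk1⟩) d)
      rw [sGen, h1, Equiv.swap_comm, hJswap hIb hIk, map_zero, mul_zero, sub_zero,
        div_eq_zero_iff] at h2
      have h3 := h2.resolve_right (hne _ _)
      rw [mul_eq_zero] at h3
      have h4 := h3.resolve_left (z_sub_z_ne_zero hadj.ne)
      exact (map_eq_zero_iff _ (RingEquiv.injective _)).1 h4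
  have hfin : G - M = 0 := by
    funext w
    by_contra hw
    obtain ⟨m, hm, rfl⟩ := hDsupp w hw
    have hm' : I (e (e.symm m)) = p := by rwa [e.apply_symm_apply]
    have h1 := hD (t - e.symm m) (e.symm m) (e.symm m).2
      (Nat.add_sub_cancel' (hqt _ hm').2) hm'
    rw [Fin.eta, e.apply_symm_apply] at h1
    exact hw h1
  exact sub_eq_zero.1 hfin

end Families

/-! ### Vectors as rank-one operators -/

section Columns

variable {N n : ℕ}

/-- The operator of rank one with the column `f` at the basis vector `v_w`. -/
def col (w : Word N n) (f : VFun N n) : EndV N n :=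
  (LinearMap.proj w : VFun N n →ₗ[RatFn n] RatFn n).smulRight f

theorem col_apply (w : Word N n) (f v : VFun N n) : col w f v = v w • f := rfl

theorem mul_col (w : Word N n) (X : EndV N n) (f : VFun N n) : X * col w f = col w (X f) := by
  refine LinearMap.ext fun v => ?_
  rw [Module.End.mul_apply, col_apply, col_apply, map_smul]

theorem coeff_smul_C (g : (RatFn n)⟦X⟧) (Y : EndV N n) (s : ℕ) :
    PowerSeries.coeff s (g • PowerSeries.C Y) = PowerSeries.coeff s g • Y := by
  rw [Algebra.smul_def, algebraMap_series, PowerSeries.coeff_mul_C, PowerSeries.coeff_map,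
    Algebra.smul_def]

/-- The minor computations are identities in a ring, with a right factor `P` in place of a vector.
Taking `P` to be a rank-one operator translates them to vectors and back. -/
theorem mul_col_eq_sum_iff {κ : Type} (w : Word N n) (X : (EndV N n)⟦X⟧) (f : VFun N n)
    (S : Finset κ) (g : κ → (RatFn n)⟦X⟧) (f' : κ → VFun N n) :
    X * PowerSeries.C (col w f) = ∑ m ∈ S, g m • PowerSeries.C (col w (f' m)) ↔
      ∀ s, PowerSeries.coeff s X f = ∑ m ∈ S, PowerSeries.coeff s (g m) • f' m := by
  constructor
  · intro H s
    have h1 := congrArg (fun Y => (PowerSeries.coeff s Y : EndV N n) (basisVec w)) H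
    have hb : ∀ v : VFun N n, col w v (basisVec w) = v := by
      intro v
      rw [col_apply, basisVec, Pi.single_eq_same, one_smul]
    simpa only [PowerSeries.coeff_mul_C, mul_col, map_sum, coeff_smul_C, LinearMap.sum_apply,
      LinearMap.smul_apply, hb] using h1
  · intro H
    ext1 s
    refine LinearMap.ext fun v => ?_
    simp only [PowerSeries.coeff_mul_C, mul_col, map_sum, coeff_smul_C, LinearMap.sum_apply,
      LinearMap.smul_apply, col_apply, H, Finset.smul_sum]
    exact Finset.sum_congr rfl fun m _ => smul_comm _ _ _

theorem mul_col_eq_iff (w : Word N n) (X : (EndV N n)⟦X⟧) (f f' : VFun N n) (g : (RatFn n)⟦X⟧) :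
    X * PowerSeries.C (col w f) = g • PowerSeries.C (col w f') ↔
      ∀ s, PowerSeries.coeff s X f = PowerSeries.coeff s g • f' := by
  have := mul_col_eq_sum_iff w X f {()} (fun _ => g) (fun _ => f')
  simpa only [Finset.sum_singleton] using this

theorem eSite_basisVec (a : Fin n) (I : Word N n) (d : Fin N) :
    eSite a d (I a) (basisVec I) = basisVec (Function.update I a d) := by
  funext w
  change (if w a = d then basisVec I (Function.update w a (I a)) else 0) = _
  simp only [basisVec, Pi.single_apply]
  by_cases hw : w = Function.update I a d
  · subst hw
    simp
  · rw [if_neg hw]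
    split_ifs with h1 h2
    · refine absurd ?_ hw
      rw [← h2, ← h1]
      simp
    · rfl
    · rfl

/-- The sites in the order in which they are processed. -/
def sites (n : ℕ) (ε : PM) : List (Fin n) := (List.finRange n).map (siteEquiv n ε)

theorem sites_nodup (ε : PM) : (sites n ε).Nodup :=
  (List.nodup_finRange n).map (siteEquiv n ε).injective

theorem sites_toFinset (ε : PM) : (sites n ε).toFinset = Finset.univ := by
  ext a
  simpa [sites] using (siteEquiv n ε).surjective a

theorem prod_map_sites {M : Type} [CommMonoid M] (ε : PM) (g : Fin n → M) :
    ((sites n ε).map g).prod = ∏ i, g i := by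
  rw [sites, List.map_map, ← Equiv.prod_comp (siteEquiv n ε) g, Fin.prod_univ_def]
  rfl

theorem sites_pairwise (ε : PM) {r : Fin n → Fin n → Prop}
    (hr : ∀ i j, i < j → r (siteEquiv n ε i) (siteEquiv n ε j)) : (sites n ε).Pairwise r :=
  List.Pairwise.map _ (fun i j h => hr i j h) (List.pairwise_lt_finRange n)

theorem fixed_col (w I : Word N n) (l : List (Fin n)) :
    Fixed (unitSer N) I l (PowerSeries.C (col w (basisVec I))) := by
  intro a _
  rw [unitSer, ← map_mul, mul_col, eSite_basisVec, Function.update_eq_self]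

theorem ySer_zero (i : Fin n) : ySer i 0 = PowerSeries.C h * invSub (z i) := by
  simp [ySer]

end Columns

/-! ### The action of `A_p(u)`, and existence and uniqueness of `ξ` -/

section Eigenvalues

variable {N n : ℕ}

/-- The eigenvalue of `A_p(u)` on `ξ_I`. -/
def eigA (p : ℕ) (I : Word N n) : (RatFn n)⟦X⟧ :=
  ∏ i, if (I i : ℕ) < p then 1 + ySer i 0 else 1

theorem eigA_eq {p : ℕ} (I : Word N n) :
    eigA p I = ∏ a ∈ Finset.univ.filter (fun a : Fin N => (a : ℕ) < p), ∏ i : Fin n with I i = a,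
      (1 + PowerSeries.C h * invSub (z i)) := by
  rw [Finset.prod_fiberwise_eq_prod_filter, eigA, Finset.prod_filter]
  simp only [Finset.mem_filter, Finset.mem_univ, true_and, ySer_zero]

theorem coeff_swapVars_ySer (a b i : Fin n) (s : ℕ) :
    swapVars a b (PowerSeries.coeff s (ySer i 0)) =
      PowerSeries.coeff s (ySer (Equiv.swap a b i) 0) := by
  rw [ySer_zero, ySer_zero, PowerSeries.coeff_C_mul, PowerSeries.coeff_C_mul, map_mul, swapVars_h]
  by_cases hs : s = 0 <;> simp [invSub, hs]

theorem map_swapVars_ySer (a b i : Fin n) :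
    PowerSeries.map (swapVars a b : RatFn n →+* RatFn n) (ySer i 0) =
      ySer (Equiv.swap a b i) 0 := by
  ext s
  rw [PowerSeries.coeff_map, ← coeff_swapVars_ySer]
  rfl

theorem map_swapVars_eigA (a b : Fin n) (p : ℕ) (I : Word N n) :
    PowerSeries.map (swapVars a b : RatFn n →+* RatFn n) (eigA p I) =
      eigA p (I ∘ Equiv.swap a b) := by
  rw [eigA, eigA, map_prod]
  refine Fintype.prod_equiv (Equiv.swap a b) _ _ fun i => ?_
  simp only [Function.comp_apply, Equiv.swap_apply_self]
  split_ifs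
  · rw [map_add, map_one, map_swapVars_ySer]
  · rw [map_one]

/-- The vectors obtained from the sorted basis vectors by the operators `s̃_i`. -/
inductive Reached (e : Fin n ≃ Fin n) : Word N n → VFun N n → Prop
  | base (I : Word N n) (hI : Monotone (I ∘ e)) : Reached e I (basisVec I)
  | step (a b : Fin n) (I : Word N n) (f : VFun N n) (hab : Adj e a b) (hf : Reached e I f) :
      Reached e (I ∘ Equiv.swap a b) (sGen h a b f)

theorem IsXiFor.reached {e : Fin n ≃ Fin n} {ξ : Word N n → VFun N n} (H : IsXiFor e ξ)
    (I : Word N n) : Reached e I (ξ I) := by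
  induction I using word_induction e with
  | base I hI => rw [H.extremal I hI]; exact Reached.base I hI
  | step a b I hab hI => rw [H.swap a b hab]; exact Reached.step a b I _ hab hI

theorem exists_reached (e : Fin n ≃ Fin n) (I : Word N n) : ∃ f, Reached e I f := by
  induction I using word_induction e with
  | base I hI => exact ⟨_, Reached.base I hI⟩
  | step a b I hab hI =>
    obtain ⟨f, hf⟩ := hI
    exact ⟨_, Reached.step a b I f hab hf⟩

/-- Permuting tensor factors preserves the sum of the coordinates, and `(z_a - z_b - h) / (z_a - z_b
- h) = 1`. This normalisation makes the vectors nonzero and fixes the scalar in an eigenline. -/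
theorem Reached.sum_eq_one {e : Fin n ≃ Fin n} {I : Word N n} {f : VFun N n}
    (H : Reached e I f) : ∑ w, f w = 1 := by
  induction H with
  | base I hI => simp [basisVec]
  | step a b I f hab hf ih =>
    have h1 : ∑ w : Word N n, swapVars a b (f (w ∘ Equiv.swap a b)) = 1 := by
      rw [← map_sum]
      have h2 := Equiv.sum_comp ((Equiv.swap a b).arrowCongr (Equiv.refl (Fin N))) f
      rw [ih] at h2
      rw [← map_one (swapVars a b), ← h2]
      rfl
    have h3 : ∑ w : Word N n, swapVars a b (f w) = 1 := by rw [← map_sum, ih, map_one]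
    simp only [sGen]
    rw [← Finset.sum_div, Finset.sum_sub_distrib, ← Finset.mul_sum, ← Finset.mul_sum, h1, h3,
      mul_one, mul_one, div_self (z_sub_z_sub_h_ne_zero a b)]

theorem idxI_val {p : ℕ} (hp : p ≤ N) (r : Fin p) : (idxI hp r : ℕ) = r := rfl

theorem idxI_injective {p : ℕ} (hp : p ≤ N) : Function.Injective (idxI hp) :=
  Fin.castLE_injective hp

theorem exists_idxI_iff {p : ℕ} (hp : p ≤ N) (b : Fin N) :
    (∃ r, idxI hp r = b) ↔ (b : ℕ) < p := by
  constructor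
  · rintro ⟨r, rfl⟩
    exact r.2
  · intro hb
    exact ⟨⟨b, hb⟩, rfl⟩

theorem opA_eq_minor (ε : PM) {p : ℕ} (hp : p ≤ N) :
    opA N n ε hp = minor (unitSer N) ySer (sites n ε) (idxI hp) (idxI hp) := by
  rw [sites, ← siteOrder_reverse, ← serAct_qminor]
  rfl

theorem opA_extremal {ε : PM} {p : ℕ} (hp : p ≤ N) {I : Word N n}
    (hI : Monotone (I ∘ siteEquiv n ε)) (w : Word N n) :
    opA N n ε hp * PowerSeries.C (col w (basisVec I)) =
      eigA p I • PowerSeries.C (col w (basisVec I)) := by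
  rw [opA_eq_minor, isSites.minor_diag (w := I) (sites_nodup ε) (idxI_injective hp) ?_
    (fixed_col _ _ _), prod_map_sites, eigA]
  · simp only [exists_idxI_iff]
  · refine sites_pairwise ε fun i j hij => ?_
    rw [exists_idxI_iff, exists_idxI_iff]
    exact fun h => lt_of_le_of_lt (hI hij.le) h

/-- `A_p(u)` commutes with `s̃`, and the exchange of variables in the eigenvalue matches the
permutation of the word. -/
theorem Reached.opA {ε : PM} {I : Word N n} {f : VFun N n} (H : Reached (siteEquiv n ε) I f)
    {p : ℕ} (hp : p ≤ N) (s : ℕ) :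
    PowerSeries.coeff s (opA N n ε hp) f = PowerSeries.coeff s (eigA p I) • f := by
  induction H with
  | base I hI => exact (mul_col_eq_iff I _ _ _ _).1 (opA_extremal hp hI I) s
  | step a b I f hab hf ih =>
    rw [YangianXi.opA, PowerSeries.coeff_map] at ih ⊢
    rw [phi_sGen hab, ih, sGen_smul, ← map_swapVars_eigA, PowerSeries.coeff_map]
    rfl

/-- The coefficient of `u⁻²` is the first to see the `z_i`; the exact values of `k` and `l` are
irrelevant. -/
theorem coeff_prod_ySer (S : Finset (Fin n)) : ∃ k l : ℕ,
    PowerSeries.coeff 0 (∏ i ∈ S, (1 + ySer i 0)) = (1 : RatFn n) ∧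
    PowerSeries.coeff 1 (∏ i ∈ S, (1 + ySer i 0)) = (k : RatFn n) * h ∧
    PowerSeries.coeff 2 (∏ i ∈ S, (1 + ySer i 0)) = h * (∑ i ∈ S, z i + (l : RatFn n) * h) := by
  induction S using Finset.induction_on with
  | empty => exact ⟨0, 0, by simp [PowerSeries.coeff_one]⟩
  | insert a S ha ih =>
    obtain ⟨k, l, h0, h1, h2⟩ := ih
    have y0 : PowerSeries.coeff 0 (ySer a 0) = 0 := by
      rw [ySer_zero, PowerSeries.coeff_C_mul]; simp [invSub]
    have y1 : PowerSeries.coeff 1 (ySer a 0) = h := by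
      rw [ySer_zero, PowerSeries.coeff_C_mul]; simp [invSub]
    have y2 : PowerSeries.coeff 2 (ySer a 0) = h * z a := by
      rw [ySer_zero, PowerSeries.coeff_C_mul]; simp [invSub]
    refine ⟨k + 1, l + k, ?_, ?_, ?_⟩
    · rw [Finset.prod_insert ha, add_mul, one_mul, map_add, h0, PowerSeries.coeff_mul]
      simp [y0]
    · rw [Finset.prod_insert ha, add_mul, one_mul, map_add, h1, PowerSeries.coeff_mul,
        Finset.Nat.sum_antidiagonal_eq_sum_range_succ_mk]
      simp only [Finset.sum_range_succ, Finset.sum_range_zero, y0, y1, h0, Nat.sub_self]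
      push_cast
      ring
    · rw [Finset.prod_insert ha, add_mul, one_mul, map_add, h2, PowerSeries.coeff_mul,
        Finset.Nat.sum_antidiagonal_eq_sum_range_succ_mk, Finset.sum_insert ha]
      simp only [Finset.sum_range_succ, Finset.sum_range_zero, y0, y1, y2, h0, Nat.sub_self,
        Nat.add_one_sub_one, Nat.reduceSub, h1]
      push_cast
      ring

/-- An operator with simple spectrum on the vectors `ξ_I`. -/
def sepOp (N n : ℕ) (ε : PM) : EndV N n :=
  ∑ p : Fin N, PowerSeries.coeff 2 (opA N n ε (p := p + 1) p.2)

/-- The eigenvalues of `sepOp`. -/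
def sepEig (I : Word N n) : RatFn n :=
  ∑ p : Fin N, PowerSeries.coeff 2 (eigA (p + 1) I)

theorem exists_sepEig_eq (I : Word N n) : ∃ l : ℕ, sepEig I =
    h * (∑ p : Fin N, ∑ i, (if I i ≤ p then z i else 0) + (l : RatFn n) * h) := by
  have h1 : ∀ p : Fin N, ∃ l : ℕ, PowerSeries.coeff 2 (eigA (p + 1) I) =
      h * (∑ i, (if I i ≤ p then z i else 0) + (l : RatFn n) * h) := by
    intro p
    obtain ⟨k, l, -, -, h2⟩ := coeff_prod_ySer (Finset.univ.filter fun i : Fin n => I i ≤ p)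
    refine ⟨l, ?_⟩
    rw [← Finset.sum_filter, ← h2, eigA, Finset.prod_filter]
    simp only [Nat.lt_succ_iff, Fin.val_fin_le]
  choose l hl using h1
  refine ⟨∑ p, l p, ?_⟩
  rw [sepEig, Finset.sum_congr rfl fun p _ => hl p, ← Finset.mul_sum, Finset.sum_add_distrib,
    ← Finset.sum_mul]
  push_cast
  rfl

/-- After division by `h` the eigenvalue is a linear form in which `z_i` has the coefficient `N - I
i`, counting the `p` with `I i ≤ p`; this recovers the word. -/
theorem sepEig_injective : Function.Injective (sepEig : Word N n → RatFn n) := by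
  intro I J hIJ
  obtain ⟨l, hl⟩ := exists_sepEig_eq I
  obtain ⟨m, hm⟩ := exists_sepEig_eq J
  rw [hl, hm] at hIJ
  have h1 := mul_left_cancel₀ h_ne_zero hIJ
  have h2 : ∀ (K : Word N n) (l : ℕ),
      ∑ p : Fin N, ∑ i, (if K i ≤ p then z i else 0) + (l : RatFn n) * h =
      algebraMap (MvPolynomial (Option (Fin n)) ℂ) (RatFn n)
        (∑ p : Fin N, ∑ i, (if K i ≤ p then MvPolynomial.X (some i) else 0) +
          (l : MvPolynomial (Option (Fin n)) ℂ) * MvPolynomial.X none) := by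
    intro K l
    simp only [map_add, map_sum, map_mul, map_natCast]
    congr 1
    refine Finset.sum_congr rfl fun p _ => Finset.sum_congr rfl fun i _ => ?_
    split_ifs
    · rfl
    · rw [map_zero]
  rw [h2, h2] at h1
  have h3 := FaithfulSMul.algebraMap_injective _ _ h1
  funext i
  -- Setting `z_i = 1` and all other variables, including `h`, to `0` extracts that coefficient.
  have h4 := congrArg (MvPolynomial.aeval (Pi.single (some i) (1 : ℂ))) h3
  have h5 : ∀ K : Word N n, ∑ p : Fin N, ∑ j, (if K j ≤ p then
      (Pi.single (some i) (1 : ℂ) : Option (Fin n) → ℂ) (some j) else 0) = ((N - K i : ℕ) : ℂ) := by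
    intro K
    have h6 : ∀ p : Fin N, ∑ j, (if K j ≤ p then
        (Pi.single (some i) (1 : ℂ) : Option (Fin n) → ℂ) (some j) else 0) =
        if K i ≤ p then 1 else 0 := by
      intro p
      rw [Finset.sum_eq_single i]
      · simp
      · intro j _ hj
        simp [hj]
      · simp
    rw [Finset.sum_congr rfl fun p _ => h6 p, Finset.sum_boole]
    congr 1
    rw [← Fin.card_Ici]
    congr 1
    ext p
    simp
  simp only [map_add, map_sum, map_mul, map_natCast, MvPolynomial.aeval_X, apply_ite, map_zero,
    h5] at h4
  simp only [Pi.single_apply, reduceCtorEq, if_false, mul_zero, add_zero, Nat.cast_inj] at h4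
  have hI := (I i).2
  have hJ := (J i).2
  exact Fin.ext (by omega)

theorem Reached.sepOp {ε : PM} {I : Word N n} {f : VFun N n} (H : Reached (siteEquiv n ε) I f) :
    sepOp N n ε f = sepEig I • f := by
  rw [YangianXi.sepOp, sepEig, LinearMap.sum_apply, Finset.sum_smul]
  exact Finset.sum_congr rfl fun p _ => H.opA _ _

/-- There are as many words as the dimension, so vectors reached for the various words form an
eigenbasis of `sepOp` with distinct eigenvalues. The difference of `f` and `g` lies in the eigenline
of `I` and has coordinate sum `0`, while the spanning vector has sum `1`. -/
theorem Reached.unique {ε : PM} {I : Word N n} {f g : VFun N n}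
    (hf : Reached (siteEquiv n ε) I f) (hg : Reached (siteEquiv n ε) I g) : f = g := by
  choose η hη using exists_reached (N := N) (siteEquiv n ε)
  have hη0 : ∀ J, η J ≠ 0 := fun J h0 => by
    have := (hη J).sum_eq_one
    simp [h0] at this
  have hli : LinearIndependent (RatFn n) η :=
    Module.End.eigenvectors_linearIndependent' (YangianXi.sepOp N n ε) sepEig sepEig_injective η
      fun J => ⟨Module.End.mem_eigenspace_iff.2 (hη J).sepOp, hη0 J⟩
  let b := basisOfLinearIndependentOfCardEqFinrank' η hli (by simp)
  have hb : ∀ J, b J = η J := fun J => by simp [b]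
  set d := f - g with hd
  have h1 : YangianXi.sepOp N n ε d = sepEig I • d := by
    rw [hd, map_sub, hf.sepOp, hg.sepOp, smul_sub]
  have h2 : ∀ J, J ≠ I → b.repr d J = 0 := by
    intro J hJ
    have h3 : ∀ v, b.repr (YangianXi.sepOp N n ε v) J = sepEig J * b.repr v J := by
      intro v
      conv_lhs => rw [← b.sum_repr v]
      have hZ : ∀ K, YangianXi.sepOp N n ε (b K) = sepEig K • b K := fun K => by
        rw [hb, (hη K).sepOp]
      simp only [map_sum, map_smul, hZ, b.repr_self]
      simp [Finsupp.single_apply, mul_comm]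
    have h4 := h3 d
    rw [h1, map_smul, Finsupp.smul_apply, smul_eq_mul] at h4
    by_contra hne
    exact hJ (sepEig_injective (mul_right_cancel₀ hne h4)).symm
  have h5 : d = b.repr d I • η I := by
    conv_lhs => rw [← b.sum_repr d]
    rw [Finset.sum_eq_single I (fun J _ hJ => by rw [h2 J hJ, zero_smul]) (by simp), hb]
  have h6 : ∑ w, d w = 0 := by
    simp [hd, Finset.sum_sub_distrib, hf.sum_eq_one, hg.sum_eq_one]
  rw [h5] at h6
  simp only [Pi.smul_apply, smul_eq_mul, ← Finset.mul_sum, (hη I).sum_eq_one, mul_one] at h6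
  rw [h6, zero_smul] at h5
  exact sub_eq_zero.1 h5

/-- Choose any reached vector for each word; path independence turns the choice into a family
satisfying all the relations. -/
theorem existsUnique_isXi (ε : PM) : ∃! ξ : Word N n → VFun N n, IsXi ε ξ := by
  choose η hη using exists_reached (N := N) (siteEquiv n ε)
  refine ⟨η, (isXi_iff ε η).2 ⟨fun I hI => ?_, fun a b hab I => ?_⟩, fun ξ hξ => ?_⟩
  · exact (hη I).unique (Reached.base I hI)
  · exact (hη _).unique (Reached.step a b I _ hab (hη I))
  · funext I
    exact (((isXi_iff ε ξ).1 hξ).reached I).unique (hη I)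

end Eigenvalues

/-! ### The minors in `E_p`, `F_p` on sorted basis vectors, and the inverse of `A_p` -/

section Minors

variable {N n : ℕ}

theorem idxJ_last {p : ℕ} (hp0 : 1 ≤ p) (hp : p < N) :
    idxJ hp ⟨p - 1, Nat.sub_lt hp0 one_pos⟩ = ⟨p, hp⟩ := by
  have h1 : ¬ (p - 1 + 1 < p) := by omega
  simp [idxJ, h1]

theorem idxI_last {p : ℕ} (hp0 : 1 ≤ p) (hp : p < N) :
    idxI hp.le ⟨p - 1, Nat.sub_lt hp0 one_pos⟩ = ⟨p - 1, lt_of_le_of_lt (Nat.sub_le p 1) hp⟩ := rfl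

theorem idxJ_of_ne {p : ℕ} (hp0 : 1 ≤ p) (hp : p < N) {s : Fin p}
    (hs : s ≠ ⟨p - 1, Nat.sub_lt hp0 one_pos⟩) : idxJ hp s = idxI hp.le s := by
  have h1 : (s : ℕ) ≠ p - 1 := fun h => hs (Fin.ext h)
  have h2 : (s : ℕ) + 1 < p := by have := s.2; omega
  rw [idxJ, if_pos h2]
  rfl

theorem update_idxI {p : ℕ} (hp0 : 1 ≤ p) (hp : p < N) :
    Function.update (idxI hp.le) ⟨p - 1, Nat.sub_lt hp0 one_pos⟩ ⟨p, hp⟩ = idxJ hp := by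
  funext s
  by_cases hs : s = ⟨p - 1, Nat.sub_lt hp0 one_pos⟩
  · rw [hs, Function.update_self, idxJ_last hp0]
  · rw [Function.update_of_ne hs, idxJ_of_ne hp0 hp hs]

theorem update_idxJ {p : ℕ} (hp0 : 1 ≤ p) (hp : p < N) :
    Function.update (idxJ hp) ⟨p - 1, Nat.sub_lt hp0 one_pos⟩
      ⟨p - 1, lt_of_le_of_lt (Nat.sub_le p 1) hp⟩ = idxI hp.le := by
  rw [← update_idxI hp0, Function.update_idem, ← idxI_last hp0 hp, Function.update_eq_self]

theorem idxJ_injective {p : ℕ} (hp0 : 1 ≤ p) (hp : p < N) : Function.Injective (idxJ hp) := by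
  intro s t hst
  have key : ∀ s : Fin p, s ≠ ⟨p - 1, Nat.sub_lt hp0 one_pos⟩ → (idxJ hp s : ℕ) < p :=
    fun s hs => by rw [idxJ_of_ne hp0 hp hs]; exact s.2
  by_cases hs : s = ⟨p - 1, Nat.sub_lt hp0 one_pos⟩ <;>
    by_cases ht : t = ⟨p - 1, Nat.sub_lt hp0 one_pos⟩
  · rw [hs, ht]
  · have h1 := key t ht
    rw [← hst, hs, idxJ_last hp0] at h1
    exact absurd h1 (lt_irrefl _)
  · have h1 := key s hs
    rw [hst, ht, idxJ_last hp0] at h1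
    exact absurd h1 (lt_irrefl _)
  · rw [idxJ_of_ne hp0 hp hs, idxJ_of_ne hp0 hp ht] at hst
    exact idxI_injective _ hst

/-- The coefficient of the word with the letter `c` of the site `m` changed, in the action of an
off-diagonal quantum minor on a sorted basis vector. -/
def moveCoef (ε : PM) (I : Word N n) (c : Fin N) (m : Fin n) : (RatFn n)⟦X⟧ :=
  ySer m 0 * (∏ a, if I a < c then 1 + ySer a 0 else 1) *
    ∏ a, if I a = c ∧ (siteEquiv n ε).symm m < (siteEquiv n ε).symm a then 1 + ySer a 0 else 1

theorem minor_extremal {ε : PM} {p : ℕ} {i : Fin p → Fin N} (hi : Function.Injective i)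
    (r : Fin p) {c d : Fin N} (hc : i r = c) (hd : ∀ s, i s ≠ d) (hir : ∀ s, s ≠ r → i s < c)
    (hj : ∀ b, b < c → ∃ s, Function.update i r d s = b)
    {I : Word N n} (hI : Monotone (I ∘ siteEquiv n ε)) (w : Word N n) :
    minor (unitSer N) ySer (sites n ε) i (Function.update i r d) *
        PowerSeries.C (col w (basisVec I)) =
      ∑ m : Fin n with I m = c,
        moveCoef ε I c m • PowerSeries.C (col w (basisVec (Function.update I m d))) := by
  subst hc
  rw [isSites.minor_move (w := I) (pos := fun a => ((siteEquiv n ε).symm a : ℕ))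
    (sites_pairwise ε fun i j hij => by simpa using hij)
    (sites_pairwise ε fun i j hij => hI hij.le) hi r hd hir hj (fixed_col _ _ _),
    sites_toFinset]
  refine Finset.sum_congr rfl fun m hm => ?_
  rw [Finset.mem_filter] at hm
  rw [prod_map_sites, prod_map_sites, unitSer, ← map_mul, mul_col, ← hm.2, eSite_basisVec]
  rfl

/-- The constant term of `T_{i,j}(u)` is `δ_{i,j}`, so the minor reduces to the one of an empty
product of sites; the data over `Empty` are placeholders. -/
theorem constantCoeff_qminor {p : ℕ} {i : Fin p → Fin N} (hi : Function.Injective i) :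
    PowerSeries.constantCoeff (qminor N i i) = 1 := by
  rw [← minor_nil_self (R := ℂ) (B := Yangian N) (ι := Empty) (E := fun _ _ _ => 0)
    (y := fun _ _ => 0) hi, qminor, minor, altProd, map_sum]
  refine Finset.sum_congr rfl fun σ _ => ?_
  rw [map_zsmul, map_list_prod, List.map_ofFn]
  congr 3
  funext k
  rw [Function.comp_apply, transfer_nil, ← PowerSeries.coeff_zero_eq_constantCoeff_apply, shift,
    PowerSeries.coeff_mk, Matrix.one_apply]
  simp only [zero_add, Finset.range_one, Finset.sum_singleton, Nat.sub_self, Nat.choose_self,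
    pow_zero, mul_one, one_smul, Tser, PowerSeries.coeff_mk, freeT]
  split_ifs <;> simp

theorem constantCoeff_eigA (p : ℕ) (I : Word N n) :
    PowerSeries.constantCoeff (eigA p I) = 1 := by
  rw [eigA, map_prod]
  refine Finset.prod_eq_one fun i _ => ?_
  split_ifs
  · rw [map_add, map_one, ySer_zero, map_mul]
    simp [invSub]
  · simp

theorem eigA_mul_inv (p : ℕ) (I : Word N n) : eigA p I * (eigA p I)⁻¹ = 1 :=
  PowerSeries.mul_inv_cancel _ (by rw [constantCoeff_eigA]; exact one_ne_zero)

/-- The inverse of `A_p(u)` in the action. -/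
def invA (N n : ℕ) (ε : PM) {p : ℕ} (hp : p ≤ N) : (EndV N n)⟦X⟧ :=
  serAct N n ε (serInv (qminor N (idxI hp) (idxI hp)))

theorem invA_mul_opA (ε : PM) {p : ℕ} (hp : p ≤ N) : invA N n ε hp * opA N n ε hp = 1 := by
  change serAct N n ε _ * serAct N n ε _ = 1
  rw [← map_mul, serInv, PowerSeries.invOfUnit_mul, map_one]
  exact constantCoeff_qminor (idxI_injective hp)

theorem Reached.invA {ε : PM} {I : Word N n} {f : VFun N n} (H : Reached (siteEquiv n ε) I f)
    {p : ℕ} (hp : p ≤ N) (w : Word N n) :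
    invA N n ε hp * PowerSeries.C (col w f) = (eigA p I)⁻¹ • PowerSeries.C (col w f) := by
  have h1 := (mul_col_eq_iff w _ f f _).2 (H.opA hp)
  have h2 := congrArg (fun Y => (eigA p I)⁻¹ • (YangianXi.invA N n ε hp * Y)) h1
  simp only [← mul_assoc, invA_mul_opA, one_mul, mul_smul_comm, smul_smul] at h2
  rw [mul_comm, eigA_mul_inv, one_smul] at h2
  exact h2.symm

theorem hInvDivH_zero (ε : PM) (f : (Yangian N)⟦X⟧) :
    PowerSeries.coeff 0 (PowerSeries.map (phi N n ε) (hInvDivH f)) = 0 := by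
  simp [hInvDivH]

theorem hInvDivH_succ (ε : PM) (f : (Yangian N)⟦X⟧) (s : ℕ) :
    (h : RatFn n) • PowerSeries.coeff (s + 1) (PowerSeries.map (phi N n ε) (hInvDivH f)) =
      PowerSeries.coeff (s + 1) (serAct N n ε f) := by
  rw [PowerSeries.coeff_map, hInvDivH, PowerSeries.coeff_mk, if_neg (Nat.succ_ne_zero s),
    coeff_serAct, phi_monomial, smul_smul, Nat.add_sub_cancel, ← pow_succ']

/-- If `f(u/h)` acts on `v` by `h ∑ g_m v_m` then `h⁻¹ f(u/h)` acts by `∑ g_m v_m`. -/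
theorem coeff_hInvDivH {κ : Type} (ε : PM) (f : (Yangian N)⟦X⟧) (v : VFun N n)
    (w0 : Word N n) (S : Finset κ) (g : κ → (RatFn n)⟦X⟧)
    (hg : ∀ m, PowerSeries.coeff 0 (g m) = 0) (f' : κ → VFun N n)
    (H : serAct N n ε f * PowerSeries.C (col w0 v) =
      ∑ m ∈ S, (PowerSeries.C h * g m) • PowerSeries.C (col w0 (f' m))) (s : ℕ) :
    PowerSeries.coeff s (PowerSeries.map (phi N n ε) (hInvDivH f)) v =
      ∑ m ∈ S, PowerSeries.coeff s (g m) • f' m := by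
  rcases s with _ | s
  · rw [hInvDivH_zero, LinearMap.zero_apply]
    simp [hg]
  · have h1 := (mul_col_eq_sum_iff w0 _ v S _ f').1 H (s + 1)
    rw [← hInvDivH_succ, LinearMap.smul_apply] at h1
    simp only [PowerSeries.coeff_C_mul, mul_smul, ← Finset.smul_sum] at h1
    exact smul_right_injective _ h_ne_zero h1

theorem exists_bounds (e : Fin n ≃ Fin n) (I : Word N n) (p : Fin N) {i : Fin n} (hi : I i = p) :
    ∃ q t, I (e q) = p ∧ I (e t) = p ∧ ∀ k, I (e k) = p → q ≤ k ∧ k ≤ t := by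
  have hne : (Finset.univ.filter fun k => I (e k) = p).Nonempty :=
    ⟨e.symm i, by simp [hi]⟩
  have h1 := Finset.min'_mem _ hne
  have h2 := Finset.max'_mem _ hne
  rw [Finset.mem_filter] at h1 h2
  refine ⟨_, _, h1.2, h2.2, fun k hk => ?_⟩
  have hk' : k ∈ Finset.univ.filter fun k => I (e k) = p := by simp [hk]
  exact ⟨Finset.min'_le _ _ hk', Finset.le_max' _ _ hk'⟩

theorem update_injective_of_ne {I : Word N n} {p d : Fin N} (hdp : d ≠ p) {i j : Fin n}
    (hi : I i = p) (hij : Function.update I i d = Function.update I j d) : i = j := by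
  by_contra hne
  have h1 := congrFun hij i
  rw [Function.update_self, Function.update_of_ne hne, hi] at h1
  exact hdp h1

theorem exists_of_sum_basisVec {I : Word N n} {p d : Fin N} {g : Fin n → RatFn n}
    {w : Word N n} (hw : (∑ m : Fin n with I m = p,
      g m • basisVec (Function.update I m d) : VFun N n) w ≠ 0) :
    ∃ m, I m = p ∧ w = Function.update I m d := by
  rw [Finset.sum_apply] at hw
  obtain ⟨m, hm, hmw⟩ := Finset.exists_ne_zero_of_sum_ne_zero hw
  rw [Finset.mem_filter] at hm
  refine ⟨m, hm.2, ?_⟩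
  by_contra hne
  exact hmw (by rw [Pi.smul_apply, basisVec, Pi.single_eq_of_ne hne, smul_zero])

theorem sum_basisVec_apply {I : Word N n} {p d : Fin N} (hdp : d ≠ p) (g : Fin n → RatFn n)
    {t : Fin n} (ht : I t = p) :
    (∑ m : Fin n with I m = p, g m • basisVec (Function.update I m d) : VFun N n)
      (Function.update I t d) = g t := by
  rw [Finset.sum_apply, Finset.sum_eq_single t]
  · rw [Pi.smul_apply, basisVec, Pi.single_eq_same, smul_eq_mul, mul_one]
  · intro m _ hmt
    rw [Pi.smul_apply, basisVec, Pi.single_eq_of_ne, smul_zero]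
    exact fun h => hmt (update_injective_of_ne hdp ht h).symm
  · intro hnot
    simp [ht] at hnot

end Minors

/-! ### The action of `E_p(u)` and `F_p(u)` -/

section Main

variable {N n : ℕ} {ε : PM} {ξ : Word N n → VFun N n}

theorem IsXiFor.sGen_of_eq (H : IsXiFor (siteEquiv n ε) ξ) {a b : Fin n}
    (hab : Adj (siteEquiv n ε) a b) {I : Word N n} (hI : I a = I b) :
    sGen h a b (ξ I) = ξ I := by
  rw [← H.swap a b hab, comp_swap_of_eq hI]

theorem coeff_swapVars_invSub (a b i : Fin n) (s : ℕ) :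
    swapVars a b (PowerSeries.coeff s (invSub (z i))) =
      PowerSeries.coeff s (invSub (z (Equiv.swap a b i))) := by
  by_cases hs : s = 0 <;> simp [invSub, hs]

/-- The action of `E_p(u)` on a sorted basis vector. -/
theorem opE_basisVec {p : ℕ} (hp0 : 1 ≤ p) (hp : p < N) {I : Word N n}
    (hI : Monotone (I ∘ siteEquiv n ε)) (s : ℕ) :
    PowerSeries.coeff s (opE N n ε hp) (basisVec I) =
      ∑ m : Fin n with I m = ⟨p, hp⟩, PowerSeries.coeff s (invSub (z m) *
        ∏ a, if I a = ⟨p, hp⟩ ∧ (siteEquiv n ε).symm m < (siteEquiv n ε).symm a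
          then 1 + ySer a 0 else 1) •
        basisVec (Function.update I m ⟨p - 1, lt_of_le_of_lt (Nat.sub_le p 1) hp⟩) := by
  refine coeff_hInvDivH ε _ _ I _ _ (fun m => by simp [invSub]) _ ?_ s
  rw [map_mul, mul_assoc]
  change _ * (invA N n ε hp.le * _) = _
  have h1 := minor_extremal (ε := ε) (idxJ_injective hp0 hp) _ (idxJ_last hp0 hp)
    (d := ⟨p - 1, lt_of_le_of_lt (Nat.sub_le p 1) hp⟩) (fun s hs => ?_) (fun s hs => ?_)
    (fun b hb => ?_) hI I
  · rw [(Reached.base I hI).invA, mul_smul_comm, serAct_qminor, siteOrder_reverse]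
    rw [update_idxJ hp0] at h1
    change _ • (minor (unitSer N) ySer (sites n ε) _ _ * _) = _
    rw [h1, Finset.smul_sum]
    refine Finset.sum_congr rfl fun m _ => ?_
    rw [smul_smul, moveCoef, ySer_zero]
    congr 1
    have h2 := eigA_mul_inv p I
    -- The letters below `p` contribute exactly the eigenvalue that the inverse of `A_p` removes.
    have h3 : (∏ a, if I a < ⟨p, hp⟩ then 1 + ySer a 0 else 1) = eigA p I := rfl
    rw [h3]
    linear_combination (PowerSeries.C h * invSub (z m) * ∏ a, if I a = ⟨p, hp⟩ ∧
      (siteEquiv n ε).symm m < (siteEquiv n ε).symm a then 1 + ySer a 0 else 1) * h2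
  · by_cases hs' : s = ⟨p - 1, Nat.sub_lt hp0 one_pos⟩
    · rw [hs', idxJ_last hp0] at hs
      have := congrArg Fin.val hs
      simp only at this
      omega
    · rw [idxJ_of_ne hp0 hp hs'] at hs
      have := congrArg Fin.val hs
      exact hs' (Fin.ext this)
  · rw [idxJ_of_ne hp0 hp hs]
    exact s.2
  · rw [update_idxJ hp0]
    exact (exists_idxI_iff hp.le b).2 hb

theorem IsXiFor.opE_extremal (H : IsXiFor (siteEquiv n ε) ξ) {p : ℕ} (hp0 : 1 ≤ p) (hp : p < N)
    {I : Word N n} (hI : Monotone (I ∘ siteEquiv n ε)) (s : ℕ) :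
    PowerSeries.coeff s (opE N n ε hp) (ξ I) =
      moveSum (fun i => PowerSeries.coeff s (invSub (z i))) h ⟨p, hp⟩
        ⟨p - 1, lt_of_le_of_lt (Nat.sub_le p 1) hp⟩ ξ I := by
  have hexp := opE_basisVec (ε := ε) hp0 hp hI s
  rw [← H.extremal I hI] at hexp
  set c : Fin N := ⟨p, hp⟩ with hc
  set d : Fin N := ⟨p - 1, lt_of_le_of_lt (Nat.sub_le p 1) hp⟩ with hd
  have hdc : d < c := by rw [hc, hd, Fin.mk_lt_mk]; omega
  by_cases hex : ∃ i, I i = c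
  · obtain ⟨i, hi⟩ := hex
    obtain ⟨q, t, hq, ht, hqt⟩ := exists_bounds (siteEquiv n ε) I c hi
    refine eq_moveSum H.swap (swapVars_h) z_sub_z_sub_h_ne_zero hdc.ne
      (fun j k l hjk hkl hj hl => le_antisymm (hl ▸ hI hkl) (hj ▸ hI hjk)) hq ht hqt
      (H.extremal _ ?_) (fun a b hab ha hb => ?_) (fun w hw => ?_)
      (fun a b _ _ _ i => coeff_swapVars_invSub a b i s) ?_
    -- Lowering the first `c` of a sorted word to `d = c - 1` keeps the word sorted, so this `ξ` is
    -- a basis vector.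
    · intro j k hjk
      simp only [Function.comp_apply, Function.update_apply, EmbeddingLike.apply_eq_iff_eq]
      split_ifs with h1 h2 h2
      · exact le_rfl
      · exact hdc.le.trans (by rw [← hq, ← h1]; exact hI hjk)
      · have h3 : I (siteEquiv n ε j) ≤ c := by rw [← hq, ← h2]; exact hI hjk
        have h4 : I (siteEquiv n ε j) ≠ c := fun h4 => h1 (le_antisymm (h2 ▸ hjk) (hqt j h4).1)
        have h5 := lt_of_le_of_ne h3 h4
        rw [Fin.lt_def] at h5
        rw [Fin.le_def]
        exact Nat.le_sub_one_of_lt h5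
      · exact hI hjk
    · rw [opE, PowerSeries.coeff_map, ← phi_sGen hab, H.sGen_of_eq hab (ha.trans hb.symm)]
    · rw [hexp] at hw
      exact exists_of_sum_basisVec hw
    -- No site with letter `c` comes after the last one, so the product in its coefficient is empty.
    · rw [hexp, sum_basisVec_apply hdc.ne _ ht, Finset.prod_eq_one, mul_one]
      intro a _
      rw [if_neg]
      rintro ⟨h1, h2⟩
      rw [Equiv.symm_apply_apply] at h2
      exact absurd h2 (hqt _ (by rwa [Equiv.apply_symm_apply])).2.not_gt
  · have hempty : (Finset.univ.filter fun i => I i = c) = ∅ :=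
      Finset.filter_eq_empty_iff.2 fun i _ hi => hex ⟨i, hi⟩
    rw [hexp, moveSum, hempty, Finset.sum_empty, Finset.sum_empty]

theorem IsXiFor.opE_apply (H : IsXiFor (siteEquiv n ε) ξ) {p : ℕ} (hp0 : 1 ≤ p) (hp : p < N)
    (I : Word N n) (s : ℕ) :
    PowerSeries.coeff s (opE N n ε hp) (ξ I) =
      moveSum (fun i => PowerSeries.coeff s (invSub (z i))) h ⟨p, hp⟩
        ⟨p - 1, lt_of_le_of_lt (Nat.sub_le p 1) hp⟩ ξ I := by
  induction I using word_induction (siteEquiv n ε) with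
  | base I hI => exact H.opE_extremal hp0 hp hI s
  | step a b I hab ih =>
    rw [← sGen_moveSum (H.swap a b hab) (swapVars_h a b)
      (fun i => coeff_swapVars_invSub a b i s), ← ih, H.swap a b hab, opE, PowerSeries.coeff_map,
      phi_sGen hab]

theorem adj_rev_trans {e : Fin n ≃ Fin n} {a b : Fin n}
    (hab : Adj (Fin.revPerm.trans e) a b) : Adj e b a := by
  obtain ⟨k, hk, rfl, rfl⟩ := hab
  refine ⟨n - (k + 2), by omega, congrArg e (Fin.ext ?_), congrArg e (Fin.ext ?_)⟩
  · simp only [Fin.revPerm_apply, Fin.val_rev]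
  · simp only [Fin.revPerm_apply, Fin.val_rev]
    omega

theorem minor_IJ_basisVec {p : ℕ} (hp0 : 1 ≤ p) (hp : p < N) {I : Word N n}
    (hI : Monotone (I ∘ siteEquiv n ε)) (s : ℕ) :
    PowerSeries.coeff s (serAct N n ε (qminor N (idxI hp.le) (idxJ hp))) (basisVec I) =
      ∑ m : Fin n with I m = ⟨p - 1, lt_of_le_of_lt (Nat.sub_le p 1) hp⟩,
        PowerSeries.coeff s (moveCoef ε I ⟨p - 1, lt_of_le_of_lt (Nat.sub_le p 1) hp⟩ m) •
          basisVec (Function.update I m ⟨p, hp⟩) := by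
  refine (mul_col_eq_sum_iff I _ _ _ _ _).1 ?_ s
  have h1 := minor_extremal (ε := ε) (idxI_injective hp.le)
    ⟨p - 1, Nat.sub_lt hp0 one_pos⟩ (idxI_last hp0 hp)
    (d := ⟨p, hp⟩) (fun s hs => ?_) (fun s hs => ?_) (fun b hb => ?_) hI I
  · rw [update_idxI hp0] at h1
    rw [serAct_qminor, siteOrder_reverse]
    exact h1
  · have := congrArg Fin.val hs
    rw [idxI_val] at this
    exact absurd this s.2.ne
  · have h2 : (s : ℕ) ≠ p - 1 := fun h => hs (Fin.ext h)
    rw [Fin.lt_def, idxI_val]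
    have := s.2
    simp only
    omega
  · rw [update_idxI hp0]
    rw [Fin.lt_def] at hb
    simp only at hb
    refine ⟨⟨b, by omega⟩, ?_⟩
    rw [idxJ_of_ne hp0 hp]
    · rfl
    · intro h2
      exact hb.ne (congrArg Fin.val h2)

/-- A letter is now raised, and the word stays sorted when the last `c` is changed. Hence
`eq_moveSum` is applied with the sites reversed and with `-h`. The coefficient contains the
eigenvalue of `A_p` on the changed word, which makes it covariant in `j`. -/
theorem IsXiFor.minor_IJ_extremal (H : IsXiFor (siteEquiv n ε) ξ) {p : ℕ} (hp0 : 1 ≤ p)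
    (hp : p < N) {I : Word N n} (hI : Monotone (I ∘ siteEquiv n ε)) (s : ℕ) :
    PowerSeries.coeff s (serAct N n ε (qminor N (idxI hp.le) (idxJ hp))) (ξ I) =
      moveSum (fun j => PowerSeries.coeff s
          (ySer j 0 * eigA p (Function.update I j ⟨p, hp⟩))) (-h)
        ⟨p - 1, lt_of_le_of_lt (Nat.sub_le p 1) hp⟩ ⟨p, hp⟩ ξ I := by
  have hexp := minor_IJ_basisVec (ε := ε) hp0 hp hI s
  rw [← H.extremal I hI] at hexp
  set c : Fin N := ⟨p - 1, lt_of_le_of_lt (Nat.sub_le p 1) hp⟩ with hc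
  set d : Fin N := ⟨p, hp⟩ with hd
  have hcd : c < d := by rw [hc, hd, Fin.mk_lt_mk]; omega
  by_cases hex : ∃ i, I i = c
  · obtain ⟨i, hi⟩ := hex
    have hanti : ∀ {j k}, j ≤ k → I (Fin.revPerm.trans (siteEquiv n ε) k) ≤
        I (Fin.revPerm.trans (siteEquiv n ε) j) := fun hjk => hI (Fin.rev_le_rev.2 hjk)
    obtain ⟨q, t, hq, ht, hqt⟩ := exists_bounds (Fin.revPerm.trans (siteEquiv n ε)) I c hi
    refine eq_moveSum (e := Fin.revPerm.trans (siteEquiv n ε)) (fun a b hab J => ?_)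
      (fun a b => by rw [map_neg, swapVars_h]) (fun a b => ?_) hcd.ne'
      (fun j k l hjk hkl hj hl => le_antisymm (hj ▸ hanti hjk) (hl ▸ hanti hkl)) hq ht hqt
      (H.extremal _ ?_) (fun a b hab ha hb => ?_) (fun w hw => ?_)
      (fun a b hab ha hb i => ?_) ?_
    · rw [sGen_neg, Equiv.swap_comm]
      exact H.swap _ _ (adj_rev_trans hab) J
    · have h1 := neg_ne_zero.2 (z_sub_z_sub_h_ne_zero b a)
      have h2 : z a - z b - -h = -(z b - z a - h) := by ring
      rwa [h2]
    · intro j k hjk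
      have hqe : ∀ j, siteEquiv n ε j = Fin.revPerm.trans (siteEquiv n ε) q ↔ j = q.rev := by
        intro j
        rw [Equiv.trans_apply, Fin.revPerm_apply, EmbeddingLike.apply_eq_iff_eq]
      have hq' : I (siteEquiv n ε q.rev) = c := hq
      simp only [Function.comp_apply, Function.update_apply, hqe]
      split_ifs with h1 h2 h2
      · exact le_rfl
      · have h3 : c ≤ I (siteEquiv n ε k) := by rw [← hq', ← h1]; exact hI hjk
        have h4 : I (siteEquiv n ε k) ≠ c := by
          intro h4
          have h5 := (hqt k.rev (by simpa using h4)).1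
          rw [← Fin.rev_le_rev, Fin.rev_rev, ← h1] at h5
          exact h2 ((le_antisymm h5 hjk).trans h1)
        have h5 := lt_of_le_of_ne h3 h4.symm
        rw [Fin.lt_def] at h5
        rw [Fin.le_def]
        simp only [hc, hd] at h5 ⊢
        omega
      · refine le_trans ?_ hcd.le
        rw [← hq', ← h2]
        exact hI hjk
      · exact hI hjk
    · rw [sGen_neg]
      change sGen h b a (PowerSeries.coeff s (PowerSeries.map (phi N n ε) (divH _)) _) =
        PowerSeries.coeff s (PowerSeries.map (phi N n ε) (divH _)) _
      rw [PowerSeries.coeff_map, ← phi_sGen (adj_rev_trans hab),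
        H.sGen_of_eq (adj_rev_trans hab) (hb.trans ha.symm)]
    · rw [hexp] at hw
      exact exists_of_sum_basisVec hw
    · have h1 : PowerSeries.map (swapVars a b : RatFn n →+* RatFn n)
          (ySer i 0 * eigA p (Function.update I i d)) = ySer (Equiv.swap a b i) 0 *
            eigA p (Function.update I (Equiv.swap a b i) d) := by
        rw [map_mul, map_swapVars_eigA, map_swapVars_ySer, update_comp_swap,
          comp_swap_of_eq (ha.trans hb.symm)]
      rw [← h1, PowerSeries.coeff_map]
      rfl
    -- In the reversed order `t` is the first site with letter `c`, so every other `c` comes after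
    -- it. Together with the smaller letters they give the eigenvalue of the word in which `t` has
    -- been raised.
    · rw [hexp, sum_basisVec_apply hcd.ne' _ ht, moveCoef, mul_assoc, eigA,
        ← Finset.prod_mul_distrib]
      congr 2
      refine Finset.prod_congr rfl fun a _ => ?_
      by_cases hat : a = Fin.revPerm.trans (siteEquiv n ε) t
      · have h1 : ¬ I a < c := by rw [hat, ht]; exact lt_irrefl c
        rw [if_neg h1, if_neg (by rintro ⟨-, h2⟩; rw [hat] at h2; exact lt_irrefl _ h2), one_mul,
          hat, Function.update_self, if_neg (lt_irrefl p)]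
      · rw [Function.update_of_ne hat]
        rcases lt_trichotomy (I a) c with h1 | h1 | h1
        · rw [if_pos h1, if_neg (fun h2 => h1.ne h2.1), if_pos, mul_one]
          exact (Fin.lt_def.1 h1).trans (Nat.sub_lt hp0 one_pos)
        · rw [if_neg h1.not_lt, if_pos, one_mul, if_pos]
          · rw [h1]
            exact Nat.sub_lt hp0 one_pos
          · refine ⟨h1, ?_⟩
            obtain ⟨k, rfl⟩ := (Fin.revPerm.trans (siteEquiv n ε)).surjective a
            have h2 : k < t := lt_of_le_of_ne (hqt k h1).2 fun h => hat (by rw [h])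
            simpa using h2
        · rw [if_neg h1.not_gt, if_neg (fun h2 => h1.ne' h2.1), if_neg, mul_one]
          have := Fin.lt_def.1 h1
          simp only [hc] at this
          omega
  · have hempty : (Finset.univ.filter fun i => I i = c) = ∅ :=
      Finset.filter_eq_empty_iff.2 fun i _ hi => hex ⟨i, hi⟩
    rw [hexp, moveSum, hempty, Finset.sum_empty, Finset.sum_empty]

/-- The inverse of `A_p` acts after the minor, on the `ξ` of the changed words, and cancels the
eigenvalue in each term separately. -/
theorem IsXiFor.opF_extremal (H : IsXiFor (siteEquiv n ε) ξ) {p : ℕ} (hp0 : 1 ≤ p) (hp : p < N)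
    {I : Word N n} (hI : Monotone (I ∘ siteEquiv n ε)) (s : ℕ) :
    PowerSeries.coeff s (opF N n ε hp) (ξ I) =
      moveSum (fun i => PowerSeries.coeff s (invSub (z i))) (-h)
        ⟨p - 1, lt_of_le_of_lt (Nat.sub_le p 1) hp⟩ ⟨p, hp⟩ ξ I := by
  set c : Fin N := ⟨p - 1, lt_of_le_of_lt (Nat.sub_le p 1) hp⟩ with hc
  set d : Fin N := ⟨p, hp⟩ with hd
  let κ : Fin n → RatFn n := fun j =>
    ∏ k : Fin n with I k = c ∧ k ≠ j, (z j - z k + -h) / (z j - z k)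
  have h1 := (mul_col_eq_sum_iff I (serAct N n ε (qminor N (idxI hp.le) (idxJ hp))) (ξ I)
    (Finset.univ.filter fun j => I j = c)
    (fun j => (ySer j 0 * eigA p (Function.update I j d)) * PowerSeries.C (κ j))
    (fun j => ξ (Function.update I j d))).2 fun s => by
      rw [H.minor_IJ_extremal hp0 hp hI s, moveSum]
      simp only [PowerSeries.coeff_mul_C, κ, ← hc, ← hd]
  refine (coeff_hInvDivH ε _ _ I (Finset.univ.filter fun j => I j = c)
    (fun j => invSub (z j) * PowerSeries.C (κ j))
    (fun m => by simp [invSub]) (fun j => ξ (Function.update I j d)) ?_ s).trans ?_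
  · rw [map_mul, mul_assoc, h1, Finset.mul_sum]
    refine Finset.sum_congr rfl fun j _ => ?_
    rw [mul_smul_comm]
    change _ • (invA N n ε hp.le * _) = _
    rw [(H.reached _).invA, smul_smul, ySer_zero]
    congr 1
    have h2 := eigA_mul_inv p (Function.update I j d)
    linear_combination (PowerSeries.C h * invSub (z j) * PowerSeries.C (κ j)) * h2
  · simp only [PowerSeries.coeff_mul_C, moveSum, κ]

theorem IsXiFor.opF_apply (H : IsXiFor (siteEquiv n ε) ξ) {p : ℕ} (hp0 : 1 ≤ p) (hp : p < N)
    (I : Word N n) (s : ℕ) :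
    PowerSeries.coeff s (opF N n ε hp) (ξ I) =
      moveSum (fun i => PowerSeries.coeff s (invSub (z i))) (-h)
        ⟨p - 1, lt_of_le_of_lt (Nat.sub_le p 1) hp⟩ ⟨p, hp⟩ ξ I := by
  induction I using word_induction (siteEquiv n ε) with
  | base I hI => exact H.opF_extremal hp0 hp hI s
  | step a b I hab ih =>
    rw [← sGen_moveSum (H.swap a b hab) (by rw [map_neg, swapVars_h])
      (fun i => coeff_swapVars_invSub a b i s), ← ih, H.swap a b hab, opF, PowerSeries.coeff_map,
      phi_sGen hab]

end Main

end YangianXi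

end

theorem mainTheorem9 (N n : ℕ) (ε : YangianXi.PM) :
    (∃! ξ : YangianXi.Word N n → YangianXi.VFun N n, YangianXi.IsXi ε ξ) ∧
    ∀ ξ : YangianXi.Word N n → YangianXi.VFun N n, YangianXi.IsXi ε ξ →
      -- the action of `A_p(u)`, for `1 ≤ p ≤ N`
      (∀ (p : ℕ) (_ : 1 ≤ p) (hp : p ≤ N) (I : YangianXi.Word N n) (s : ℕ),
        PowerSeries.coeff s (YangianXi.opA N n ε hp) (ξ I) =
          PowerSeries.coeff s
            (∏ a ∈ Finset.univ.filter (fun a : Fin N => (a : ℕ) < p), ∏ i : Fin n with I i = a,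
              (1 + PowerSeries.C YangianXi.h * YangianXi.invSub (YangianXi.z i))) • ξ I) ∧
      -- the action of `E_p(u)`, for `1 ≤ p ≤ N - 1`; the indices `p`, `p + 1` counted from `0`
      -- are `p - 1`, `p`
      (∀ (p : ℕ) (_ : 1 ≤ p) (hp : p < N) (I : YangianXi.Word N n) (s : ℕ),
        PowerSeries.coeff s (YangianXi.opE N n ε hp) (ξ I) =
          ∑ i : Fin n with I i = ⟨p, hp⟩,
            (PowerSeries.coeff s (YangianXi.invSub (YangianXi.z i)) *
              ∏ k : Fin n with I k = ⟨p, hp⟩ ∧ k ≠ i,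
                (YangianXi.z i - YangianXi.z k + YangianXi.h) /
                  (YangianXi.z i - YangianXi.z k)) •
            ξ (Function.update I i ⟨p - 1, lt_of_le_of_lt (Nat.sub_le p 1) hp⟩)) ∧
      -- the action of `F_p(u)`, for `1 ≤ p ≤ N - 1`
      (∀ (p : ℕ) (_ : 1 ≤ p) (hp : p < N) (I : YangianXi.Word N n) (s : ℕ),
        PowerSeries.coeff s (YangianXi.opF N n ε hp) (ξ I) =
          ∑ j : Fin n with I j = ⟨p - 1, lt_of_le_of_lt (Nat.sub_le p 1) hp⟩,
            (PowerSeries.coeff s (YangianXi.invSub (YangianXi.z j)) *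
              ∏ k : Fin n with
                  I k = ⟨p - 1, lt_of_le_of_lt (Nat.sub_le p 1) hp⟩ ∧ k ≠ j,
                (YangianXi.z j - YangianXi.z k - YangianXi.h) /
                  (YangianXi.z j - YangianXi.z k)) •
            ξ (Function.update I j ⟨p, hp⟩)) := by
  refine ⟨YangianXi.existsUnique_isXi ε, fun ξ hξ => ?_⟩
  have H := (YangianXi.isXi_iff ε ξ).1 hξ
  refine ⟨fun p _ hp I s => ?_, fun p hp0 hp I s => H.opE_apply hp0 hp I s,
    fun p hp0 hp I s => ?_⟩
  · rw [← YangianXi.eigA_eq]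
    exact (H.reached I).opA hp s
  · rw [H.opF_apply hp0 hp I s, YangianXi.moveSum]
    simp only [← sub_eq_add_neg]
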